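/- Let $A$ be a nonzero separable C$^\ast$-algebra and let $\mathfrak r=(\rho_n)_{n\in\mathbb N}$, $\mathbb N=\{0,1,2,\ldots\}$, be a sequence of non-degenerate $\ast$-endomorphisms of $A$ (each $\rho_n$ sends an approximate unit of $A$ to an approximate unit of $A$). All ideals below are closed and two-sided. Assume that - for every $a\in A$, $\limsup_{n\to\infty}\|\rho_n(a)\|=\|a\|$; - the only ideals $I$ of $A$ with $\rho_n(I)\subset I$ for all $n\in\mathbb N$ are $0$ and $A$. Let $\mathcal E_{\mathfrak r}=\ell^2(\mathbb N)\otimes A$ be the right Hilbert $A$-module of sequences $\xi=(\xi_n)_n$ in $A$ for which $\sum_n\xi_n^\ast\xi_n$ converges in norm, with $\langle\xi,\eta\rangle=\sum_n\xi_n^\ast\eta_n$, right action $(\xi a)_n=\xi_n a$ and left action $(a\xi)_n=\rho_n(a)\xi_n$. Let $\mathcal T_{\mathcal E_{\mathfrak r}}$ be its Toeplitz–Pimsner algebra, i.e. the universal C$^\ast$-algebra generated by a copy of $A$ and symbols $T_\xi$ ($\xi\in\mathcal E_{\mathfrak r}$), linear in $\xi$, subject to $T_{a\xi}=aT_\xi$,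 $T_{\xi a}=T_\xi a$ and $T_\xi^\ast T_\eta=\langle\xi,\eta\rangle$. Let $\mathfrak x=(x_n)_{n\in\mathbb N}\in\mathbb R^{\mathbb N}$, put $(u_{\mathfrak x,t}\xi)_n=e^{ix_nt}\xi_n$, and let $\gamma_{\mathfrak x}\colon\mathbb R\curvearrowright\mathcal T_{\mathcal E_{\mathfrak r}}$ be the quasi-free flow determined by $\gamma_{\mathfrak x,t}(T_\xi)=T_{u_{\mathfrak x,t}\xi}$ and $\gamma_{\mathfrak x,t}(a)=a$ for $a\in A$. For a finite word $\mathfrak n=(i_1,\ldots,i_k)$ in $\mathbb N$ put $\rho_{\mathfrak n}=\rho_{i_k}\circ\cdots\circ\rho_{i_1}$ and $x_{\mathfrak n}=x_{i_1}+\cdots+x_{i_k}$; for the empty word, $\rho_\emptyset=\mathrm{id}_A$ and $x_\emptyset=0$. For $S\subset A$ let $\mathcal I(S;A)$ be the ideal of $A$ generated by $S$. Assume that 1. the closure $K_{\mathfrak x}$ of $\{(e^{ix_nt})_{n\in\mathbb N}:t\in\mathbb R\}$ in $\mathbb T^{\mathbb N}$ contains every constant sequence $(z,z,z,\ldots)$,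 $z\in\mathbb T$; 2. for every nonzero ideal $I$ of $A$ there is a nonzero ideal $J$ of $A$ such that the set of all $x_{\mathfrak n}$, where $\mathfrak n$ ranges over the finite words with $J\subset\mathcal I(\rho_{\mathfrak n}(I);A)$, is dense in $\mathbb R$. Then the reduced crossed product $\mathcal T_{\mathcal E_{\mathfrak r}}\rtimes_{\gamma_{\mathfrak x}}\mathbb R$ (formed on $L^2(\mathbb R,H)$ from any faithful representation of $\mathcal T_{\mathcal E_{\mathfrak r}}$ on a Hilbert space $H$) is simple: it is nonzero and has no ideals other than $0$ and itself. -/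

import Mathlib

open Filter Topology MeasureTheory
open scoped ENNReal

universe u v w

noncomputable section

namespace QuasiFree

/-! ### Summability of positive series in a C⋆-algebra -/

section Sums

variable {A : Type u} [NonUnitalCStarAlgebra A]

theorem summable_star_mul_of_le (x y c : ℕ → A)
    (h : ∀ n, star (x n) * x n + star (c n) * c n = y n) (hy : Summable y) :
    Summable fun n => star (x n) * x n := by
  let _ := CStarAlgebra.spectralOrder A
  have _ := CStarAlgebra.spectralOrderedRing A
  rw [summable_iff_vanishing_norm] at hy ⊢
  intro ε hε
  obtain ⟨s, hs⟩ := hy ε hε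
  refine ⟨s, fun t ht => lt_of_le_of_lt ?_ (hs t ht)⟩
  refine CStarAlgebra.norm_le_norm_of_nonneg_of_le
    (Finset.sum_nonneg fun n _ => star_mul_self_nonneg (x n)) (Finset.sum_le_sum fun n _ => ?_)
  rw [← h n]
  exact le_add_of_nonneg_right (star_mul_self_nonneg (c n))

end Sums

/-! ### The right Hilbert module `ℓ²(ℕ) ⊗ A` -/

/-- The right Hilbert `A`-module `ℓ²(ℕ) ⊗ A`: sequences `ξ` in `A` such that the series
`∑ ξₙ⋆ ξₙ` converges in norm. The elementary tensor `δₙ ⊗ a` is the sequence with the single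
entry `a` at `n`. -/
def hilbertModule (A : Type u) [NonUnitalCStarAlgebra A] : Submodule ℂ (ℕ → A) where
  carrier := {ξ | Summable fun n => star (ξ n) * ξ n}
  zero_mem' := by simp
  add_mem' := by
    intro ξ η hξ hη
    have hξ : Summable fun n => star (ξ n) * ξ n := hξ
    have hη : Summable fun n => star (η n) * η n := hη
    refine summable_star_mul_of_le (fun n => (ξ + η) n)
      (fun n => (2 : ℂ) • (star (ξ n) * ξ n) + (2 : ℂ) • (star (η n) * η n))
      (fun n => ξ n - η n) (fun n => ?_) ((hξ.const_smul _).add (hη.const_smul _))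
    simp only [Pi.add_apply, star_add, star_sub, mul_add, add_mul, mul_sub, sub_mul, two_smul]
    abel
  smul_mem' := by
    intro c ξ hξ
    have hξ : Summable fun n => star (ξ n) * ξ n := hξ
    have : (fun n => star ((c • ξ) n) * (c • ξ) n)
        = fun n => (star c * c) • (star (ξ n) * ξ n) := by
      funext n
      simp [smul_mul_smul_comm]
    change Summable fun n => star ((c • ξ) n) * (c • ξ) n
    rw [this]
    exact hξ.const_smul _

section Module

variable {A : Type u} [NonUnitalCStarAlgebra A]

/-- The `A`-valued inner product `⟨ξ, η⟩ = ∑ ξₙ⋆ ηₙ` (the series is norm convergent, see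
`summable_ip`). -/
def ip (ξ η : hilbertModule A) : A := ∑' n, star (ξ.1 n) * η.1 n

theorem summable_ip (ξ η : hilbertModule A) : Summable fun n => star (ξ.1 n) * η.1 n := by
  have h1 : Summable fun n => star (ξ.1 n) * ξ.1 n := ξ.2
  have h2 : Summable fun n => star (η.1 n) * η.1 n := η.2
  have h3 : Summable fun n => star ((ξ + η).1 n) * (ξ + η).1 n := (ξ + η).2
  have h4 : Summable fun n =>
    star ((ξ + Complex.I • η).1 n) * (ξ + Complex.I • η).1 n := (ξ + Complex.I • η).2
  have h := (((h3.sub h1).sub h2).sub (((h4.sub h1).sub h2).const_smul Complex.I)).const_smul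
    (2⁻¹ : ℂ)
  refine h.congr fun n => ?_
  simp only [Submodule.coe_add, Submodule.coe_smul, Pi.add_apply, Pi.smul_apply, star_add,
    star_smul, mul_add, add_mul, smul_mul_assoc, mul_smul_comm, smul_sub, smul_add, smul_smul]
  simp only [RCLike.star_def, Complex.conj_I]
  match_scalars <;> ring_nf <;> (try simp only [Complex.I_sq]) <;> norm_num

/-- The right action `(ξ a)ₙ = ξₙ a`. -/
def rightAct (ξ : hilbertModule A) (a : A) : hilbertModule A :=
  ⟨fun n => ξ.1 n * a, by
    have h : Summable fun n => star (ξ.1 n) * ξ.1 n := ξ.2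
    refine ((h.mul_left (star a)).mul_right a).congr fun n => ?_
    simp [mul_assoc]⟩

theorem norm_star_mul_le_aux (b : A) (r : A →⋆ₙₐ[ℂ] A) (a : A) :
    ∃ c : A, star (r a * b) * (r a * b) + star c * c = ((‖a‖ : ℂ) ^ 2) • (star b * b) := by
  let _ := CStarAlgebra.spectralOrder A
  have _ := CStarAlgebra.spectralOrderedRing A
  have hsa : IsSelfAdjoint (star (r a) * r a) := IsSelfAdjoint.star_mul_self _
  have h1 : star b * (star (r a) * r a) * b ≤ ‖star (r a) * r a‖ • (star b * b) :=
    CStarAlgebra.star_left_conjugate_le_norm_smul hsa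
  have h2 : ‖star (r a) * r a‖ ≤ ‖a‖ ^ 2 := by
    rw [CStarRing.norm_star_mul_self, ← sq]
    gcongr
    exact NonUnitalStarAlgHom.norm_apply_le r a
  have h3 : star b * (star (r a) * r a) * b ≤ (‖a‖ ^ 2 : ℝ) • (star b * b) := by
    refine h1.trans ?_
    rw [← sub_nonneg, ← sub_smul]
    exact smul_nonneg (sub_nonneg.2 h2) (star_mul_self_nonneg b)
  obtain ⟨c, hc⟩ := CStarAlgebra.nonneg_iff_eq_star_mul_self.1 (sub_nonneg.2 h3)
  refine ⟨c, ?_⟩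
  rw [← hc]
  have : ((‖a‖ : ℂ) ^ 2) • (star b * b) = (‖a‖ ^ 2 : ℝ) • (star b * b) := by
    rw [← Complex.ofReal_pow, Complex.coe_smul]
  rw [this, star_mul]
  simp only [mul_assoc]
  abel

/-- The left action `(a ξ)ₙ = ρₙ(a) ξₙ` determined by a sequence `ρ` of endomorphisms. -/
def leftAct (ρ : ℕ → A →⋆ₙₐ[ℂ] A) (a : A) (ξ : hilbertModule A) : hilbertModule A :=
  ⟨fun n => ρ n a * ξ.1 n, by
    have h : Summable fun n => star (ξ.1 n) * ξ.1 n := ξ.2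
    choose c hc using fun n => norm_star_mul_le_aux (ξ.1 n) (ρ n) a
    exact summable_star_mul_of_le _ _ c hc (h.const_smul _)⟩

/-- The unitary `u_{x,t}` with `u_{x,t}(δₙ ⊗ a) = exp(i xₙ t) δₙ ⊗ a`. -/
def phase (x : ℕ → ℝ) (t : ℝ) : hilbertModule A →ₗ[ℂ] hilbertModule A where
  toFun ξ := ⟨fun n => (Circle.exp (x n * t) : ℂ) • ξ.1 n, by
    have h : Summable fun n => star (ξ.1 n) * ξ.1 n := ξ.2
    refine h.congr fun n => ?_
    rw [star_smul, smul_mul_smul_comm, RCLike.star_def, ← Circle.coe_inv_eq_conj,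
      ← Circle.coe_mul, inv_mul_cancel, Circle.coe_one, one_smul]⟩
  map_add' ξ η := by ext n; simp
  map_smul' c ξ := by
    ext n
    exact smul_comm _ _ _

theorem ip_phase (x : ℕ → ℝ) (t : ℝ) (ξ η : hilbertModule A) :
    ip (phase x t ξ) (phase x t η) = ip ξ η := by
  refine tsum_congr fun n => ?_
  change star ((Circle.exp (x n * t) : ℂ) • ξ.1 n) * ((Circle.exp (x n * t) : ℂ) • η.1 n) = _
  rw [star_smul, smul_mul_smul_comm, RCLike.star_def, ← Circle.coe_inv_eq_conj,
    ← Circle.coe_mul, inv_mul_cancel, Circle.coe_one, one_smul]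

theorem phase_leftAct (ρ : ℕ → A →⋆ₙₐ[ℂ] A) (x : ℕ → ℝ) (t : ℝ) (a : A) (ξ : hilbertModule A) :
    phase x t (leftAct ρ a ξ) = leftAct ρ a (phase x t ξ) := by
  ext n
  exact (mul_smul_comm _ _ _).symm

theorem phase_rightAct (x : ℕ → ℝ) (t : ℝ) (ξ : hilbertModule A) (a : A) :
    phase x t (rightAct ξ a) = rightAct (phase x t ξ) a := by
  ext n
  exact (smul_mul_assoc _ _ _).symm

theorem phase_zero (x : ℕ → ℝ) (ξ : hilbertModule A) : phase x 0 ξ = ξ := by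
  ext n
  simp [phase]

theorem phase_add (x : ℕ → ℝ) (s t : ℝ) (ξ : hilbertModule A) :
    phase x (s + t) ξ = phase x s (phase x t ξ) := by
  ext n
  simp [phase, mul_add, Circle.exp_add, mul_smul]

end Module

/-! ### The Toeplitz–Pimsner algebra -/

/-- A representation, in a C⋆-algebra, of the defining relations of the Toeplitz–Pimsner algebra
of the correspondence `ℓ²(ℕ) ⊗ A` with left action given by `ρ`. -/
structure ToeplitzRep {A : Type u} [NonUnitalCStarAlgebra A] (ρ : ℕ → A →⋆ₙₐ[ℂ] A) where
  carrier : Type u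
  [inst : NonUnitalCStarAlgebra carrier]
  coeff : A →⋆ₙₐ[ℂ] carrier
  op : hilbertModule A →ₗ[ℂ] carrier
  op_left : ∀ a ξ, op (leftAct ρ a ξ) = coeff a * op ξ
  op_right : ∀ ξ a, op (rightAct ξ a) = op ξ * coeff a
  star_op_mul_op : ∀ ξ η, star (op ξ) * op η = coeff (ip ξ η)

attribute [instance] ToeplitzRep.inst

section Toeplitz

variable {A : Type u} [NonUnitalCStarAlgebra A] (ρ : ℕ → A →⋆ₙₐ[ℂ] A)

theorem ToeplitzRep.norm_op_sq_le {ρ : ℕ → A →⋆ₙₐ[ℂ] A} (R : ToeplitzRep ρ)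
    (ξ : hilbertModule A) : ‖R.op ξ‖ ≤ √‖ip ξ ξ‖ := by
  apply Real.le_sqrt_of_sq_le
  rw [sq, ← CStarRing.norm_star_mul_self, R.star_op_mul_op]
  exact NonUnitalStarAlgHom.norm_apply_le R.coeff _

/-- The product C⋆-algebra of all representations of the relations. -/
abbrev ToeplitzProd : Type (u + 1) := lp (fun R : ToeplitzRep ρ => R.carrier) ∞

/-- The copy of `a ∈ A` in the universal representation. -/
def univCoeff (a : A) : ToeplitzProd ρ :=
  ⟨fun R => R.coeff a, memℓp_infty ⟨‖a‖, by
    rintro _ ⟨R, rfl⟩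
    exact NonUnitalStarAlgHom.norm_apply_le R.coeff a⟩⟩

/-- The symbol `T_ξ` in the universal representation. -/
def univOp (ξ : hilbertModule A) : ToeplitzProd ρ :=
  ⟨fun R => R.op ξ, memℓp_infty ⟨√‖ip ξ ξ‖, by
    rintro _ ⟨R, rfl⟩
    exact R.norm_op_sq_le ξ⟩⟩

theorem norm_univOp_le (ξ : hilbertModule A) : ‖univOp ρ ξ‖ ≤ √‖ip ξ ξ‖ :=
  lp.norm_le_of_forall_le (Real.sqrt_nonneg _) fun R => R.norm_op_sq_le ξ

/-- `univOp` as a linear map. -/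
def univOpₗ : hilbertModule A →ₗ[ℂ] ToeplitzProd ρ where
  toFun := univOp ρ
  map_add' ξ η := by
    ext R
    exact R.op.map_add ξ η
  map_smul' c ξ := by
    ext R
    exact R.op.map_smul c ξ

/-- The Toeplitz–Pimsner algebra: the universal C⋆-algebra generated by a copy of `A` and symbols
`T_ξ` subject to the relations of `ToeplitzRep`, realized as the C⋆-algebra generated by the
universal representation. -/
def toeplitz : NonUnitalStarSubalgebra ℂ (ToeplitzProd ρ) :=
  (NonUnitalStarAlgebra.adjoin ℂ
    (Set.range (univCoeff ρ) ∪ Set.range (univOp ρ))).topologicalClosure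

instance toeplitz_isClosed : IsClosed (toeplitz ρ : Set (ToeplitzProd ρ)) :=
  NonUnitalStarSubalgebra.isClosed_topologicalClosure _

instance : NonUnitalCStarAlgebra (toeplitz ρ) :=
  NonUnitalStarSubalgebra.nonUnitalCStarAlgebra (toeplitz ρ)

end Toeplitz

/-! ### Flows and the quasi-free flow -/

/-- A flow: a point-norm continuous action of `ℝ` on a C⋆-algebra by ⋆-automorphisms (each
`hom t` is invertible with inverse `hom (-t)` by `map_zero` and `map_add`). -/
structure Flow (B : Type v) [NonUnitalCStarAlgebra B] where
  hom : ℝ → B →⋆ₙₐ[ℂ] B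
  map_zero : ∀ b, hom 0 b = b
  map_add : ∀ s t b, hom (s + t) b = hom s (hom t b)
  continuous : ∀ b, Continuous fun t => hom t b

section QuasiFreeFlow

variable {A : Type u} [NonUnitalCStarAlgebra A] (ρ : ℕ → A →⋆ₙₐ[ℂ] A) (x : ℕ → ℝ)

/-- The representation obtained by replacing each `T_ξ` by `T_{u_{x,t} ξ}`. -/
abbrev ToeplitzRep.twist {ρ : ℕ → A →⋆ₙₐ[ℂ] A} (R : ToeplitzRep ρ) (x : ℕ → ℝ) (t : ℝ) :
    ToeplitzRep ρ where
  carrier := R.carrier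
  coeff := R.coeff
  op := R.op ∘ₗ phase x t
  op_left a ξ := by simp [phase_leftAct, R.op_left]
  op_right ξ a := by simp [phase_rightAct, R.op_right]
  star_op_mul_op ξ η := by simp [R.star_op_mul_op, ip_phase]

/-- Reindexing of the product of all representations along `R ↦ R.twist x t`. -/
def prodFlow (t : ℝ) : ToeplitzProd ρ →⋆ₙₐ[ℂ] ToeplitzProd ρ where
  toFun y := ⟨fun R => y.1 (R.twist x t), memℓp_infty ⟨‖y‖, by
    rintro _ ⟨R, rfl⟩
    exact lp.norm_apply_le_norm (by simp) y (R.twist x t)⟩⟩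
  map_smul' _ _ := rfl
  map_zero' := rfl
  map_add' _ _ := rfl
  map_mul' _ _ := rfl
  map_star' _ := rfl

theorem prodFlow_univCoeff (t : ℝ) (a : A) :
    prodFlow ρ x t (univCoeff ρ a) = univCoeff ρ a := rfl

theorem prodFlow_univOp (t : ℝ) (ξ : hilbertModule A) :
    prodFlow ρ x t (univOp ρ ξ) = univOp ρ (phase x t ξ) := rfl

theorem prodFlow_mem (t : ℝ) (y : ToeplitzProd ρ) (hy : y ∈ toeplitz ρ) :
    prodFlow ρ x t y ∈ toeplitz ρ := by
  have hc : Continuous (prodFlow ρ x t) :=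
    AddMonoidHomClass.continuous_of_bound (prodFlow ρ x t) 1 fun z => by
      simpa using NonUnitalStarAlgHom.norm_apply_le (prodFlow ρ x t) z
  have : toeplitz ρ ≤ (toeplitz ρ).comap (prodFlow ρ x t) := by
    refine NonUnitalStarSubalgebra.topologicalClosure_minimal _ ?_
      ((toeplitz_isClosed ρ).preimage hc)
    refine NonUnitalStarAlgebra.adjoin_le ?_
    rintro _ (⟨a, rfl⟩ | ⟨ξ, rfl⟩)
    · exact NonUnitalStarSubalgebra.le_topologicalClosure _
        (NonUnitalStarAlgebra.subset_adjoin ℂ _ (Or.inl ⟨a, rfl⟩))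
    · exact NonUnitalStarSubalgebra.le_topologicalClosure _
        (NonUnitalStarAlgebra.subset_adjoin ℂ _ (Or.inr ⟨phase x t ξ, rfl⟩))
  exact this hy

theorem apply_eq_of_op_eq {ρ : ℕ → A →⋆ₙₐ[ℂ] A} (y : ToeplitzProd ρ) (R R' : ToeplitzRep ρ)
    (h : R = R') : HEq (y.1 R) (y.1 R') := by
  subst h; rfl

theorem ToeplitzRep.twist_zero {ρ : ℕ → A →⋆ₙₐ[ℂ] A} (R : ToeplitzRep ρ) (x : ℕ → ℝ) :
    R.twist x 0 = R := by
  have h : R.op ∘ₗ phase x 0 = R.op := LinearMap.ext fun ξ => by simp [phase_zero]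
  cases R
  simp only [ToeplitzRep.twist] at h ⊢
  congr

theorem ToeplitzRep.twist_add {ρ : ℕ → A →⋆ₙₐ[ℂ] A} (R : ToeplitzRep ρ) (x : ℕ → ℝ) (s t : ℝ) :
    R.twist x (s + t) = (R.twist x s).twist x t := by
  have h : R.op ∘ₗ phase x (s + t) = (R.op ∘ₗ phase x s) ∘ₗ phase x t :=
    LinearMap.ext fun ξ => by simp [phase_add]
  cases R
  simp only [ToeplitzRep.twist] at h ⊢
  congr

theorem prodFlow_zero (y : ToeplitzProd ρ) : prodFlow ρ x 0 y = y := by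
  ext R
  exact eq_of_heq (apply_eq_of_op_eq y _ _ (R.twist_zero x))

theorem prodFlow_add (s t : ℝ) (y : ToeplitzProd ρ) :
    prodFlow ρ x (s + t) y = prodFlow ρ x s (prodFlow ρ x t y) := by
  ext R
  exact eq_of_heq (apply_eq_of_op_eq y _ _ (R.twist_add x s t))

theorem norm_prodFlow_le (t : ℝ) (y : ToeplitzProd ρ) : ‖prodFlow ρ x t y‖ ≤ ‖y‖ :=
  NonUnitalStarAlgHom.norm_apply_le (prodFlow ρ x t) y

/-- The elements of the product with norm continuous orbit. -/
def contPart : NonUnitalStarSubalgebra ℂ (ToeplitzProd ρ) where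
  carrier := {y | Continuous fun t => prodFlow ρ x t y}
  zero_mem' := by simpa using continuous_const
  add_mem' := by
    intro y z hy hz
    have h : Continuous (fun t => prodFlow ρ x t (y + z)) := by
      simp only [map_add]
      exact Continuous.add hy hz
    exact h
  mul_mem' := by
    intro y z hy hz
    have h : Continuous (fun t => prodFlow ρ x t (y * z)) := by
      simp only [map_mul]
      exact Continuous.mul hy hz
    exact h
  smul_mem' := by
    intro c y hy
    have h : Continuous (fun t => prodFlow ρ x t (c • y)) := by
      simp only [map_smul]
      exact Continuous.const_smul hy c
    exact h
  star_mem' := by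
    intro y hy
    have h : Continuous (fun t => prodFlow ρ x t (star y)) := by
      simp only [map_star]
      exact Continuous.star hy
    exact h

theorem isClosed_contPart : IsClosed (contPart ρ x : Set (ToeplitzProd ρ)) := by
  rw [← closure_subset_iff_isClosed]
  intro y hy
  refine continuous_of_uniform_approx_of_continuous fun u hu => ?_
  obtain ⟨ε, hε, hu⟩ := Metric.mem_uniformity_dist.1 hu
  obtain ⟨z, hz, hyz⟩ := Metric.mem_closure_iff.1 hy ε hε
  refine ⟨fun t => prodFlow ρ x t z, hz, fun t => hu ?_⟩
  rw [dist_eq_norm, ← map_sub]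
  refine lt_of_le_of_lt (norm_prodFlow_le ρ x t _) ?_
  rwa [← dist_eq_norm]

/-- The elementary tensor `δₙ ⊗ a`. -/
def delta (n : ℕ) (a : A) : hilbertModule A :=
  ⟨Pi.single n a, by
    refine summable_of_ne_finset_zero (s := {n}) fun m hm => ?_
    simp [Pi.single_eq_of_ne (Finset.notMem_singleton.1 hm)]⟩

theorem phase_delta (t : ℝ) (n : ℕ) (a : A) :
    phase x t (delta n a) = (Circle.exp (x n * t) : ℂ) • delta n a := by
  ext m
  by_cases h : m = n
  · subst h; rfl
  · simp [phase, delta, Pi.single_eq_of_ne h]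

/-- Every `ξ` is the sum of its coordinates `δₙ ⊗ ξₙ`, also after applying `T`. -/
theorem hasSum_univOp (ξ : hilbertModule A) :
    HasSum (fun n => univOp ρ (delta n (ξ.1 n))) (univOp ρ ξ) := by
  have hξ : Summable fun n => star (ξ.1 n) * ξ.1 n := ξ.2
  have key : ∀ s : Finset ℕ, ‖(∑ n ∈ s, univOp ρ (delta n (ξ.1 n))) - univOp ρ ξ‖
      ≤ √‖ip ξ ξ - ∑ n ∈ s, star (ξ.1 n) * ξ.1 n‖ := by
    intro s
    let η : hilbertModule A := (∑ n ∈ s, delta n (ξ.1 n)) - ξ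
    have h1 : (∑ n ∈ s, univOp ρ (delta n (ξ.1 n))) - univOp ρ ξ = univOp ρ η := by
      rw [show univOp ρ η = univOpₗ ρ η from rfl, map_sub, map_sum]
      rfl
    have h2 : ∀ n, η.1 n = if n ∈ s then 0 else -ξ.1 n := by
      intro n
      have : (∑ m ∈ s, delta m (ξ.1 m)).1 n = if n ∈ s then ξ.1 n else 0 := by
        rw [show (∑ m ∈ s, delta m (ξ.1 m)).1 = ∑ m ∈ s, (delta m (ξ.1 m)).1 from
          map_sum (hilbertModule A).subtype _ _, Finset.sum_apply]
        simp [delta, Pi.single_apply]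
      change (∑ m ∈ s, delta m (ξ.1 m)).1 n - ξ.1 n = _
      rw [this]
      split_ifs <;> simp
    have h3 : ip η η = ip ξ ξ - ∑ n ∈ s, star (ξ.1 n) * ξ.1 n := by
      have hf : HasSum (fun n => if n ∈ s then star (ξ.1 n) * ξ.1 n else 0)
          (∑ n ∈ s, star (ξ.1 n) * ξ.1 n) := by
        rw [← Finset.sum_congr (rfl : s = s) fun n hn =>
          (if_pos hn : (if n ∈ s then star (ξ.1 n) * ξ.1 n else 0) = star (ξ.1 n) * ξ.1 n)]
        exact hasSum_sum_of_ne_finset_zero fun n hn => if_neg hn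
      refine Eq.trans (tsum_congr fun n => ?_) (hξ.hasSum.sub hf).tsum_eq
      rw [h2]
      split_ifs <;> simp
    rw [h1, ← h3]
    exact norm_univOp_le ρ η
  rw [HasSum, SummationFilter.unconditional_filter, tendsto_iff_norm_sub_tendsto_zero]
  refine squeeze_zero (fun _ => norm_nonneg _) key ?_
  have h : Tendsto (fun s : Finset ℕ => ip ξ ξ - ∑ n ∈ s, star (ξ.1 n) * ξ.1 n) atTop
      (𝓝 (ip ξ ξ - ip ξ ξ)) := tendsto_const_nhds.sub hξ.hasSum
  rw [sub_self] at h
  simpa using h.norm.sqrt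

theorem univOp_mem_contPart (ξ : hilbertModule A) : univOp ρ ξ ∈ contPart ρ x := by
  have hd : ∀ n a, univOp ρ (delta n a) ∈ contPart ρ x := by
    intro n a
    have : (fun t => prodFlow ρ x t (univOp ρ (delta n a)))
        = fun t => (Circle.exp (x n * t) : ℂ) • univOp ρ (delta n a) := by
      funext t
      rw [prodFlow_univOp, phase_delta]
      ext R
      exact R.op.map_smul _ _
    change Continuous fun t => prodFlow ρ x t (univOp ρ (delta n a))
    rw [this]
    fun_prop
  have hs : Tendsto (fun s : Finset ℕ => ∑ n ∈ s, univOp ρ (delta n (ξ.1 n))) atTop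
      (𝓝 (univOp ρ ξ)) := hasSum_univOp ρ ξ
  exact (isClosed_contPart ρ x).mem_of_tendsto hs
    (Eventually.of_forall fun s => sum_mem fun n _ => hd n _)

theorem toeplitz_le_contPart : toeplitz ρ ≤ contPart ρ x := by
  refine NonUnitalStarSubalgebra.topologicalClosure_minimal _ ?_ (isClosed_contPart ρ x)
  refine NonUnitalStarAlgebra.adjoin_le ?_
  rintro _ (⟨a, rfl⟩ | ⟨ξ, rfl⟩)
  · change Continuous fun t => prodFlow ρ x t (univCoeff ρ a)
    simp only [prodFlow_univCoeff]
    exact continuous_const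
  · exact univOp_mem_contPart ρ x ξ

/-- The quasi-free flow on the Toeplitz–Pimsner algebra: it fixes `A` and sends `T_ξ` to
`T_{u_{x,t} ξ}` (see `prodFlow_univCoeff` and `prodFlow_univOp`). -/
def quasiFreeFlow : Flow (toeplitz ρ) where
  hom t := NonUnitalStarAlgHom.codRestrict
    ((prodFlow ρ x t).comp (NonUnitalStarSubalgebraClass.subtype (toeplitz ρ)))
    (toeplitz ρ) fun y => prodFlow_mem ρ x t y y.2
  map_zero y := Subtype.ext (prodFlow_zero ρ x y)
  map_add s t y := Subtype.ext (prodFlow_add ρ x s t y)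
  continuous y := Continuous.subtype_mk (toeplitz_le_contPart ρ x y.2) _

end QuasiFreeFlow

/-! ### Reduced crossed products by flows -/

section CrossedProduct

variable {B : Type v} [NonUnitalCStarAlgebra B] (α : Flow B)
  {H : Type w} [NormedAddCommGroup H] [InnerProductSpace ℂ H] [CompleteSpace H]
  (π : B →⋆ₙₐ[ℂ] (H →L[ℂ] H))

/-- The Hilbert space `L²(ℝ, H)`. -/
abbrev L2 (H : Type w) [NormedAddCommGroup H] : Type w := Lp H 2 (volume : Measure ℝ)

theorem memLp_orbit (b : B) :
    MemLp (fun s : ℝ => π (α.hom (-s) b)) ∞ (volume : Measure ℝ) := by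
  have hπ : Continuous π := AddMonoidHomClass.continuous_of_bound π 1 fun z => by
    simpa using NonUnitalStarAlgHom.norm_apply_le π z
  refine memLp_top_of_bound
    (hπ.comp ((α.continuous b).comp continuous_neg)).aestronglyMeasurable ‖b‖
    (Eventually.of_forall fun s => ?_)
  exact (NonUnitalStarAlgHom.norm_apply_le π _).trans
    (NonUnitalStarAlgHom.norm_apply_le (α.hom (-s)) b)

/-- The operator on `L²(ℝ, H)` given by `(b ξ)(s) = π(α₋ₛ(b)) ξ(s)`. -/
def regCoeff (b : B) : L2 H →L[ℂ] L2 H :=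
  (ContinuousLinearMap.id ℂ (H →L[ℂ] H)).holderL volume ∞ 2 2 ((memLp_orbit α π b).toLp _)

/-- The translation `(λₜ ξ)(s) = ξ(s - t)` on `L²(ℝ, H)`. -/
def translation (H : Type w) [NormedAddCommGroup H] [InnerProductSpace ℂ H] (t : ℝ) :
    L2 H →L[ℂ] L2 H :=
  (Lp.compMeasurePreservingₗᵢ ℂ (fun s : ℝ => s - t)
    (measurePreserving_sub_right volume t)).toContinuousLinearMap

theorem regCoeff_sub (b c : B) : regCoeff α π (b - c) = regCoeff α π b - regCoeff α π c := by
  rw [regCoeff, regCoeff, regCoeff, ← map_sub, ← MemLp.toLp_sub]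
  congr 1
  refine MemLp.toLp_congr _ _ (Eventually.of_forall fun s => ?_)
  simp

theorem norm_regCoeff_le (b : B) : ‖regCoeff α π b‖ ≤ ‖b‖ := by
  refine ContinuousLinearMap.opNorm_le_bound _ (norm_nonneg _) fun ξ => ?_
  refine (ContinuousLinearMap.norm_holder_apply_apply_le (r := 2)
    (ContinuousLinearMap.id ℂ (H →L[ℂ] H)) ((memLp_orbit α π b).toLp _) ξ).trans ?_
  have h1 : ‖ContinuousLinearMap.id ℂ (H →L[ℂ] H)‖ ≤ 1 := ContinuousLinearMap.norm_id_le
  have h2 : ‖(memLp_orbit α π b).toLp _‖ ≤ ‖b‖ := by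
    rw [Lp.norm_toLp, eLpNorm_exponent_top]
    refine ENNReal.toReal_le_of_le_ofReal (norm_nonneg _)
      (eLpNormEssSup_le_of_ae_bound (Eventually.of_forall fun s => ?_))
    exact (NonUnitalStarAlgHom.norm_apply_le π _).trans
      (NonUnitalStarAlgHom.norm_apply_le (α.hom (-s)) b)
  calc _ ≤ 1 * ‖b‖ * ‖ξ‖ := by gcongr
    _ = _ := by ring

theorem regCoeff_zero : regCoeff α π 0 = 0 := by
  simpa using regCoeff_sub α π 0 0

theorem continuous_regCoeff : Continuous (regCoeff α π) := by
  refine (LipschitzWith.of_dist_le_mul (K := 1) fun b c => ?_).continuous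
  rw [dist_eq_norm, dist_eq_norm, ← regCoeff_sub]
  simpa using norm_regCoeff_le α π (b - c)

theorem continuous_translation (ξ : L2 H) : Continuous fun t => translation H t ξ := by
  let g : ℝ → C(ℝ, ℝ) := fun t => ⟨fun s => s - t, by fun_prop⟩
  have hg : Continuous g := ContinuousMap.continuous_of_continuous_uncurry _ (by
    change Continuous fun p : ℝ × ℝ => p.2 - p.1
    fun_prop)
  exact Continuous.compMeasurePreservingLp (continuous_const (y := ξ)) hg
    (fun t => measurePreserving_sub_right volume t) (by simp)

theorem integrable_aux (f : CompactlySupportedContinuousMap ℝ B) (ξ : L2 H) :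
    Integrable (fun t => regCoeff α π (f t) (translation H t ξ)) := by
  refine Continuous.integrable_of_hasCompactSupport
    (((continuous_regCoeff α π).comp f.continuous).clm_apply (continuous_translation ξ)) ?_
  refine f.hasCompactSupport.mono' fun t ht => subset_closure ?_
  intro h0
  apply ht
  simp [h0, regCoeff_zero]

/-- The operator `∫ f(t) λₜ dt` on `L²(ℝ, H)` given by `f ∈ C_c(ℝ, B)` in the regular
representation induced from `π`. -/
def integratedForm (f : CompactlySupportedContinuousMap ℝ B) : L2 H →L[ℂ] L2 H :=
  LinearMap.mkContinuous
    { toFun := fun ξ => ∫ t, regCoeff α π (f t) (translation H t ξ)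
      map_add' := fun ξ η => by
        simp only [map_add]
        exact integral_add (integrable_aux α π f ξ) (integrable_aux α π f η)
      map_smul' := fun c ξ => by
        simp only [map_smul, RingHom.id_apply]
        exact integral_smul c _ }
    (∫ t, ‖f t‖) fun ξ => by
      rw [← integral_mul_const]
      refine norm_integral_le_of_norm_le ?_ (Eventually.of_forall fun t => ?_)
      · exact ((f.continuous.norm.integrable_of_hasCompactSupport
          f.hasCompactSupport.norm)).mul_const _
      · refine (ContinuousLinearMap.le_opNorm _ _).trans ?_
        gcongr
        · exact norm_regCoeff_le α π _
        · exact (Lp.norm_compMeasurePreserving ξ (measurePreserving_sub_right volume t)).le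

/-- The reduced crossed product `B ⋊_α ℝ`: the closure of the image of `C_c(ℝ, B)` in the bounded
operators on `L²(ℝ, H)` under the regular representation induced from a faithful representation
`π` of `B` on `H`. -/
def reducedCrossedProduct : NonUnitalStarSubalgebra ℂ (L2 H →L[ℂ] L2 H) :=
  (NonUnitalStarAlgebra.adjoin ℂ (Set.range (integratedForm α π))).topologicalClosure

end CrossedProduct

/-! ### Ideals, simplicity, and the conditions on `ρ` and `x` -/

/-- A C⋆-algebra is simple if it is nonzero and its only closed two-sided ideals are `0` and the
whole algebra. -/
def IsSimpleCStar (B : Type v) [NonUnitalNonAssocRing B] [TopologicalSpace B] : Prop :=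
  Nontrivial B ∧ ∀ I : TwoSidedIdeal B, IsClosed (I : Set B) → I = ⊥ ∨ I = ⊤

section Conditions

variable {A : Type u} [NonUnitalCStarAlgebra A]

/-- The closed two-sided ideal generated by `S`, as a set. -/
def closedIdealSpan (S : Set A) : Set A := closure (TwoSidedIdeal.span S : Set A)

/-- An endomorphism is non-degenerate if it sends some approximate unit to an approximate unit. -/
def Nondegenerate (r : A →⋆ₙₐ[ℂ] A) : Prop :=
  ∃ l : Filter A, l.IsApproximateUnit ∧ (l.map r).IsApproximateUnit

/-- `ρ_w = ρ_{iₙ} ∘ ⋯ ∘ ρ_{i₁}` for the word `w = (i₁, …, iₙ)`; the identity for the empty word. -/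
def wordHom (ρ : ℕ → A →⋆ₙₐ[ℂ] A) : List ℕ → A →⋆ₙₐ[ℂ] A
  | [] => NonUnitalStarAlgHom.id ℂ A
  | i :: w => (wordHom ρ w).comp (ρ i)

/-- `x_w = x_{i₁} + ⋯ + x_{iₙ}` for the word `w = (i₁, …, iₙ)`. -/
def wordSum (x : ℕ → ℝ) (w : List ℕ) : ℝ := (w.map x).sum

end Conditions

/-- The closure `K_x` in `𝕋^ℕ` of the one-parameter subgroup `t ↦ (exp(i xₙ t))ₙ`. -/
def orbitClosure (x : ℕ → ℝ) : Set (ℕ → Circle) :=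
  closure (Set.range fun t : ℝ => fun n => Circle.exp (x n * t))

end QuasiFree

end

namespace QuasiFree

/-! ### Contractive approximate units -/

section ApproximateUnits

/-! A Fourier transform in the direction of ℝ turns the crossed product into an algebra of the same
kind over B = C₀(ℝ, A). On L²(ℝ, H) the operators a λ(φ), with λ(φ) = ∫ φ(t) λₜ dt, span a dense
part of a faithful copy Ψ(B). The strong limits Sₙ of T_{δₙ ⊗ e}, with e running through an
approximate unit of A, are isometries with orthogonal ranges on the essential subspace of Ψ. They
satisfy Ψ(g) Sₙ = Sₙ Ψ(σₙ g) with (σₙ g)(s) = ρₙ(g(s − xₙ/2π)) (`fourRep_mul_isometryOp`). The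
crossed product is the closed span of the monomials S_u Ψ(g) S_v⋆ for words u, v
(`system_generates`).

The main point is that a nonzero closed ideal I must meet Ψ(B). The translations λₜ are multipliers
of the crossed product, so conjugation by them preserves I; it multiplies S_u Ψ(g) S_v⋆ by exp(i(x_u
− x_v)t). As K_x contains the constant sequences, limits of these conjugations realise the full
gauge action, with factor z^(|u| − |v|) (`exists_isGaugeOrbit`). Averaging a positive element of I
over the circle gives a nonzero element of I in the closure of the core, the part where |u| = |v|
(`PhaseSystem.exists_map_mem`).

The core is exhausted by closed ⋆-algebras obtained from Ψ(B) by repeatedly forming Ψ(B) + ∑ Sᵢ X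
Sⱼ⋆ over finitely many i, j. Compressing Ψ(b) + ∑ Sᵢ dᵢⱼ Sⱼ⋆ by Sₙ with n large erases the sum and
leaves Ψ(σₙ b), and by the limsup condition these compressions recover the norm of b. Hence an ideal
that misses Ψ(B) meets every stage trivially (`eq_zero_of_mem_core`), and a functional calculus
estimate passes to the closure (`cfcₙ_softThreshold_mem`).

The preimage of I under Ψ is thus a nonzero closed ideal J of C₀(ℝ, A) invariant under all σₙ, and
it remains to see that J is everything (`eq_top_of_twistHom_invariant`). If J contains f ⊗ a, it
contains the translate of f by x_w/2π tensored with ρ_w(a), for every word w. By the density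
condition J then contains f ⊗ b for all f and all b in some nonzero ideal of A. The b with f ⊗ b ∈ J
for all f form an ideal of A that is invariant under every ρₙ, hence equals A by minimality. -/

theorem exists_contractiveUnit (B : Type u) [NonUnitalCStarAlgebra B] :
    ∃ l : Filter B, l.IsApproximateUnit ∧ (∀ᶠ e in l, ‖e‖ ≤ 1) ∧ ∀ᶠ e in l, star e = e := by
  let _ := CStarAlgebra.spectralOrder B
  have _ := CStarAlgebra.spectralOrderedRing B
  have h := CStarAlgebra.increasingApproximateUnit B
  exact ⟨_, h.toIsApproximateUnit, h.eventually_norm, h.eventually_star_eq⟩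

/-- A chosen approximate unit consisting of selfadjoint contractions. -/
noncomputable def contractiveUnit (B : Type u) [NonUnitalCStarAlgebra B] : Filter B :=
  (exists_contractiveUnit B).choose

variable (B : Type u) [NonUnitalCStarAlgebra B]

theorem contractiveUnit_isApproximateUnit : (contractiveUnit B).IsApproximateUnit :=
  (exists_contractiveUnit B).choose_spec.1

theorem contractiveUnit_norm : ∀ᶠ e in contractiveUnit B, ‖e‖ ≤ 1 :=
  (exists_contractiveUnit B).choose_spec.2.1

theorem contractiveUnit_star : ∀ᶠ e in contractiveUnit B, star e = e :=
  (exists_contractiveUnit B).choose_spec.2.2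

instance : (contractiveUnit B).NeBot := (contractiveUnit_isApproximateUnit B).neBot

variable {B}

theorem continuous_starHom {B : Type u} [NonUnitalCStarAlgebra B] {D : Type v}
    [NonUnitalCStarAlgebra D] (τ : B →⋆ₙₐ[ℂ] D) : Continuous τ :=
  AddMonoidHomClass.continuous_of_bound τ 1 fun z => by
    simpa using NonUnitalStarAlgHom.norm_apply_le τ z

/-- The set on which a net of contractions acts asymptotically as a left unit is closed. -/
theorem tendsto_mul_of_approx {D : Type v} [NonUnitalNormedRing D] {ι : Type*} {l : Filter ι}
    {f : ι → D} (hf : ∀ᶠ e in l, ‖f e‖ ≤ 1) {y : D}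
    (hy : ∀ ε > 0, ∃ z, ‖y - z‖ < ε ∧ Tendsto (fun e => f e * z) l (𝓝 z)) :
    Tendsto (fun e => f e * y) l (𝓝 y) := by
  rw [Metric.tendsto_nhds]
  intro ε hε
  obtain ⟨z, hz, hlim⟩ := hy (ε / 3) (by positivity)
  filter_upwards [hf, Metric.tendsto_nhds.1 hlim (ε / 3) (by positivity)] with e he hd
  rw [dist_eq_norm] at hd ⊢
  have h1 : f e * y - y = f e * (y - z) + (f e * z - z) - (y - z) := by
    rw [mul_sub]; abel
  have h2 : ‖f e * (y - z)‖ ≤ ‖y - z‖ :=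
    (norm_mul_le _ _).trans (mul_le_of_le_one_left (norm_nonneg _) he)
  rw [h1]
  refine (norm_sub_le _ _).trans_lt ?_
  have := norm_add_le (f e * (y - z)) (f e * z - z)
  linarith

/-- A ⋆-homomorphism acts non-degenerately from the left on `D`, relative to a fixed approximate
unit. -/
def LeftEssential {D : Type v} [NonUnitalCStarAlgebra D] (τ : B →⋆ₙₐ[ℂ] D) (y : D) : Prop :=
  Tendsto (fun e => τ e * y) (contractiveUnit B) (𝓝 y)

section

variable {D : Type v} [NonUnitalCStarAlgebra D]

theorem eventually_norm_map_le (τ : B →⋆ₙₐ[ℂ] D) : ∀ᶠ e in contractiveUnit B, ‖τ e‖ ≤ 1 :=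
  (contractiveUnit_norm B).mono fun e he => (NonUnitalStarAlgHom.norm_apply_le τ e).trans he

theorem LeftEssential.of_approx {τ : B →⋆ₙₐ[ℂ] D} {y : D}
    (hy : ∀ ε > 0, ∃ z, ‖y - z‖ < ε ∧ LeftEssential τ z) : LeftEssential τ y :=
  tendsto_mul_of_approx (eventually_norm_map_le τ) hy

theorem isClosed_leftEssential (τ : B →⋆ₙₐ[ℂ] D) : IsClosed {y | LeftEssential τ y} := by
  rw [← closure_subset_iff_isClosed]
  intro y hy
  refine LeftEssential.of_approx fun ε hε => ?_
  obtain ⟨z, hz, hyz⟩ := Metric.mem_closure_iff.1 hy ε hε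
  exact ⟨z, by rwa [← dist_eq_norm], hz⟩

theorem leftEssential_map_mul (τ : B →⋆ₙₐ[ℂ] D) (b : B) (y : D) :
    LeftEssential τ (τ b * y) := by
  have h := ((continuous_starHom τ).tendsto b).comp
    ((contractiveUnit_isApproximateUnit B).tendsto_mul_right b)
  refine (h.mul_const y).congr fun e => ?_
  simp [mul_assoc]

theorem leftEssential_map (τ : B →⋆ₙₐ[ℂ] D) (b : B) : LeftEssential τ (τ b) := by
  have h := ((continuous_starHom τ).tendsto b).comp
    ((contractiveUnit_isApproximateUnit B).tendsto_mul_right b)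
  refine h.congr fun e => ?_
  simp

theorem LeftEssential.mul {τ : B →⋆ₙₐ[ℂ] D} {y : D} (hy : LeftEssential τ y) (z : D) :
    LeftEssential τ (y * z) :=
  (Tendsto.mul_const z hy).congr fun e => by rw [mul_assoc]

theorem LeftEssential.exists_norm_sub_lt {τ : B →⋆ₙₐ[ℂ] D} {y : D} (hy : LeftEssential τ y)
    {ε : ℝ} (hε : 0 < ε) : ∃ e, ‖y - τ e * y‖ < ε := by
  obtain ⟨e, he⟩ := (Metric.tendsto_nhds.1 hy ε hε).exists
  exact ⟨e, by rwa [dist_comm, dist_eq_norm] at he⟩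

/-- An endomorphism is essential if it maps the fixed approximate unit to a left unit. -/
def Essential (τ : B →⋆ₙₐ[ℂ] B) : Prop := ∀ b, LeftEssential τ b

/-- It suffices to treat Ψ(e) y in place of y, and there the claim is the convergence τ(e') e → e
inside B. -/
theorem LeftEssential.comp {Ψ : B →⋆ₙₐ[ℂ] D} {τ : B →⋆ₙₐ[ℂ] B} (hτ : Essential τ) {y : D}
    (hy : LeftEssential Ψ y) : LeftEssential (Ψ.comp τ) y := by
  refine LeftEssential.of_approx fun ε hε => ?_
  obtain ⟨e, he⟩ := hy.exists_norm_sub_lt hε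
  refine ⟨_, he, ?_⟩
  have h := ((continuous_starHom Ψ).tendsto e).comp (hτ e)
  refine (h.mul_const y).congr fun e => ?_
  simp [mul_assoc]

theorem LeftEssential.add {τ : B →⋆ₙₐ[ℂ] D} {y z : D} (hy : LeftEssential τ y)
    (hz : LeftEssential τ z) : LeftEssential τ (y + z) :=
  (Tendsto.add hy hz).congr fun e => by rw [mul_add]

theorem LeftEssential.sum {τ : B →⋆ₙₐ[ℂ] D} {ι : Type*} {s : Finset ι} {y : ι → D}
    (hy : ∀ i ∈ s, LeftEssential τ (y i)) : LeftEssential τ (∑ i ∈ s, y i) :=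
  (tendsto_finsetSum s hy).congr fun e => by rw [Finset.mul_sum]

end

/-- The approximate unit in `Nondegenerate` is arbitrary and need not be bounded. It is used only to
approximate b by elements r(e) b, on which the fixed contractive unit acts well; contractivity then
carries this over to b. -/
theorem Nondegenerate.essential {r : B →⋆ₙₐ[ℂ] B} (h : Nondegenerate r) : Essential r := by
  obtain ⟨l, hl, hr⟩ := h
  intro b
  have hne := hl.neBot
  refine LeftEssential.of_approx fun ε hε => ?_
  have h1 : Tendsto (fun e => r e * b) l (𝓝 b) := (hr.tendsto_mul_right b)
  obtain ⟨e, he⟩ := (Metric.tendsto_nhds.1 h1 ε hε).exists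
  exact ⟨r e * b, by rwa [dist_comm, dist_eq_norm] at he, leftEssential_map_mul r e b⟩

end ApproximateUnits

/-! ### Closed ideals -/

section Ideals

variable {D : Type u} [NonUnitalCStarAlgebra D]

/-- A subspace of a C⋆-algebra that is a two-sided ideal of the ⋆-subalgebra `C`. -/
structure IsIdealIn (C : NonUnitalStarSubalgebra ℂ D) (I : Submodule ℂ D) : Prop where
  le : ∀ x ∈ I, x ∈ C
  mul_left : ∀ c ∈ C, ∀ x ∈ I, c * x ∈ I
  mul_right : ∀ c ∈ C, ∀ x ∈ I, x * c ∈ I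

/-- The real functional calculus stays in the closed real ⋆-algebra generated by c, so C is first
viewed as a real ⋆-subalgebra. -/
theorem cfcₙ_mem_of_isClosed {C : NonUnitalStarSubalgebra ℂ D} (hC : IsClosed (C : Set D))
    (f : ℝ → ℝ) {c : D} (hc : c ∈ C) : cfcₙ f c ∈ C := by
  let S : NonUnitalStarSubalgebra ℝ D :=
    { carrier := C
      add_mem' := fun h h' => add_mem h h'
      zero_mem' := zero_mem C
      mul_mem' := fun h h' => mul_mem h h'
      smul_mem' := fun r x h => by
        have : (r : ℂ) • x ∈ C := SMulMemClass.smul_mem (r : ℂ) h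
        rwa [Complex.coe_smul] at this
      star_mem' := fun h => star_mem h }
  have h : NonUnitalStarAlgebra.elemental ℝ c ≤ S :=
    NonUnitalStarAlgebra.elemental.le_of_mem (s := S) hC hc
  exact h (cfcₙ_mem_elemental f c)

/-- The soft threshold function. -/
noncomputable def softThreshold (δ t : ℝ) : ℝ := t - max (-δ) (min t δ)

theorem softThreshold_of_abs_le {δ t : ℝ} (ht : |t| ≤ δ) : softThreshold δ t = 0 := by
  rw [abs_le] at ht
  simp [softThreshold, ht.1, ht.2]

theorem continuous_softThreshold (δ : ℝ) : Continuous (softThreshold δ) := by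
  unfold softThreshold; fun_prop

theorem softThreshold_zero {δ : ℝ} (hδ : 0 ≤ δ) : softThreshold δ 0 = 0 :=
  softThreshold_of_abs_le (by simpa using hδ)

theorem abs_softThreshold_le {δ : ℝ} (hδ : 0 ≤ δ) (t : ℝ) : |softThreshold δ t| ≤ |t| := by
  unfold softThreshold
  rcases le_total t δ with h | h
  · rw [min_eq_left h]
    rcases le_total (-δ) t with h' | h'
    · rw [max_eq_right h']; simp
    · rw [max_eq_left h', abs_le]
      rw [abs_of_nonpos (by linarith)]
      constructor <;> linarith
  · rw [min_eq_right h, max_eq_right (by linarith), abs_of_nonneg (by linarith),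
      abs_of_nonneg (by linarith)]
    linarith

/-- The function t − softThreshold δ t is the truncation of t to [−δ, δ]. In particular, an element
whose soft threshold vanishes has norm at most δ. -/
theorem norm_sub_cfcₙ_softThreshold_le {δ : ℝ} (hδ : 0 ≤ δ) {c : D} (hc : IsSelfAdjoint c) :
    ‖c - cfcₙ (softThreshold δ) c‖ ≤ δ := by
  have h1 : c - cfcₙ (softThreshold δ) c = cfcₙ (fun t => t - softThreshold δ t) c := by
    rw [cfcₙ_sub (fun t : ℝ => t) (softThreshold δ) c (by fun_prop) rfl
      (continuous_softThreshold δ).continuousOn (softThreshold_zero hδ), cfcₙ_id' ℝ c]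
  rw [h1]
  refine norm_cfcₙ_le fun t _ => ?_
  simp only [softThreshold, sub_sub_cancel, Real.norm_eq_abs, abs_le]
  exact ⟨le_max_left _ _, max_le (by linarith) (min_le_right _ _)⟩

/-- If a selfadjoint element is within `ε` of a closed ideal, then its soft threshold at level
`2 ε` belongs to that ideal. -/
theorem cfcₙ_softThreshold_mem {C : NonUnitalStarSubalgebra ℂ D} (hC : IsClosed (C : Set D))
    {I : Submodule ℂ D} (hI : IsIdealIn C I) (hIc : IsClosed (I : Set D)) {c i : D}
    (hc : c ∈ C) (hsa : IsSelfAdjoint c) (hi : i ∈ I) {ε : ℝ} (hε : 0 < ε)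
    (hci : ‖c - i‖ ≤ ε) : cfcₙ (softThreshold (2 * ε)) c ∈ I := by
  -- Modulo I the element c has norm at most ε, so a function vanishing on [−2ε, 2ε] should send c
  -- into I. Without quotients: the distance of c^(m+1) to I is at most ε^(m+1), which beats the
  -- growth of the cofactor g below.
  have key : ∀ m : ℕ, ∃ j ∈ I, ‖cfcₙ (fun t : ℝ => t ^ (m + 1)) c - j‖ ≤ ε ^ (m + 1) := by
    intro m
    induction m with
    | zero => exact ⟨i, hi, by simpa [cfcₙ_id' ℝ c] using hci⟩
    | succ m ih =>
      obtain ⟨j, hj, hm⟩ := ih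
      set p := cfcₙ (fun t : ℝ => t ^ (m + 1)) c with hp
      have hpC : p ∈ C := cfcₙ_mem_of_isClosed hC _ hc
      -- The approximant is c p − (c − i)(p − j), so the two errors multiply.
      refine ⟨i * p + c * j - i * j, sub_mem (add_mem (hI.mul_right _ hpC _ hi)
        (hI.mul_left _ hc _ hj)) (hI.mul_left _ (hI.le _ hi) _ hj), ?_⟩
      have h1 : cfcₙ (fun t : ℝ => t ^ (m + 1 + 1)) c = c * p := by
        have : (fun t : ℝ => t ^ (m + 1 + 1)) = fun t => t * t ^ (m + 1) := by
          funext t; ring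
        rw [this, cfcₙ_mul (fun t : ℝ => t) (fun t => t ^ (m + 1)) c (by fun_prop) rfl
          (by fun_prop) (by simp), cfcₙ_id' ℝ c]
      have h2 : c * p - (i * p + c * j - i * j) = (c - i) * (p - j) := by
        rw [sub_mul, mul_sub, mul_sub]; abel
      rw [h1, h2, pow_succ']
      exact (norm_mul_le _ _).trans (by gcongr)
  have hle : ∀ m : ℕ, ∃ j ∈ I, ‖cfcₙ (softThreshold (2 * ε)) c - j‖ ≤ ‖c‖ * (1 / 2) ^ (m + 1) := by
    intro m
    obtain ⟨j, hj, hm⟩ := key m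
    -- The threshold factors as t^(m+1) g(t). Near 0 the numerator vanishes, so g is continuous
    -- there, and |g| ≤ ‖c‖ / (2ε)^(m+1) on the spectrum; the total error is ‖c‖ / 2^(m+1).
    let g : ℝ → ℝ := fun t => softThreshold (2 * ε) t / t ^ (m + 1)
    have hg0 : ∀ t, |t| ≤ 2 * ε → g t = 0 := fun t ht => by
      simp [g, softThreshold_of_abs_le ht]
    have hgc : Continuous g := by
      rw [continuous_iff_continuousAt]
      intro t
      by_cases ht : t = 0
      · have : g =ᶠ[𝓝 t] fun _ => 0 := by
          filter_upwards [Metric.ball_mem_nhds t (by positivity : 0 < 2 * ε)] with s hs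
          refine hg0 s ?_
          rw [Metric.mem_ball, Real.dist_eq, ht, sub_zero] at hs
          exact hs.le
        exact continuousAt_const.congr this.symm
      · exact (continuous_softThreshold _).continuousAt.div (by fun_prop) (pow_ne_zero _ ht)
    have hgz : g 0 = 0 := hg0 0 (by simp; positivity)
    have h1 : cfcₙ (softThreshold (2 * ε)) c = cfcₙ (fun t : ℝ => t ^ (m + 1)) c * cfcₙ g c := by
      rw [← cfcₙ_mul (fun t : ℝ => t ^ (m + 1)) g c (by fun_prop) (by simp)
        hgc.continuousOn hgz]
      congr 1
      funext t
      by_cases ht : t = 0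
      · simp [ht, softThreshold_zero (by positivity : 0 ≤ 2 * ε)]
      · simp only [g]
        field_simp
    have h2 : ‖cfcₙ g c‖ ≤ ‖c‖ / (2 * ε) ^ (m + 1) := by
      refine norm_cfcₙ_le fun t ht => ?_
      by_cases hte : |t| ≤ 2 * ε
      · rw [hg0 t hte, norm_zero]; positivity
      · have h3 : |t| ≤ ‖c‖ := by
          have := norm_apply_le_norm_cfcₙ (fun t : ℝ => t) c ht
          rwa [cfcₙ_id' ℝ c] at this
        push Not at hte
        simp only [g, norm_div, norm_pow, Real.norm_eq_abs]
        gcongr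
        exact (abs_softThreshold_le (by positivity) t).trans h3
    refine ⟨j * cfcₙ g c, hI.mul_right _ (cfcₙ_mem_of_isClosed hC g hc) _ hj, ?_⟩
    rw [h1, ← sub_mul]
    refine (norm_mul_le _ _).trans ?_
    calc _ ≤ ε ^ (m + 1) * (‖c‖ / (2 * ε) ^ (m + 1)) := by gcongr
      _ = _ := by rw [mul_pow, div_pow, one_pow]; field_simp
  refine hIc.closure_subset_iff.2 le_rfl (Metric.mem_closure_iff.2 fun δ hδ => ?_)
  have hlim : Tendsto (fun m : ℕ => ‖c‖ * (1 / 2 : ℝ) ^ (m + 1)) atTop (𝓝 (‖c‖ * 0)) :=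
    ((tendsto_pow_atTop_nhds_zero_of_lt_one (by norm_num) (by norm_num)).comp
      (tendsto_add_atTop_nat 1)).const_mul _
  rw [mul_zero] at hlim
  obtain ⟨m, hm⟩ := ((tendsto_order.1 hlim).2 δ hδ).exists
  obtain ⟨j, hj, hjm⟩ := hle m
  exact ⟨j, hj, by rw [dist_eq_norm]; exact hjm.trans_lt hm⟩

/-- Closed two-sided ideals of a C⋆-algebra are subspaces. -/
theorem smul_mem_of_isClosed {I : TwoSidedIdeal D} (hI : IsClosed (I : Set D)) (z : ℂ) {x : D}
    (hx : x ∈ I) : z • x ∈ I := by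
  have h := ((contractiveUnit_isApproximateUnit D).tendsto_mul_right x).const_smul z
  refine hI.mem_of_tendsto h (Eventually.of_forall fun e => ?_)
  change z • (e * x) ∈ I
  rw [← smul_mul_assoc]
  exact I.mul_mem_left _ _ hx

end Ideals

end QuasiFree

namespace QuasiFree

/-! ### Systems of isometries implementing a sequence of endomorphisms -/

/-- A faithful representation `Ψ` of `B` together with operators `S n` that restrict to isometries
with orthogonal ranges on the essential subspace of `Ψ` and implement the endomorphisms `σ n`. -/
structure CuntzSystem (B : Type u) [NonUnitalCStarAlgebra B] (D : Type v) [CStarAlgebra D] where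
  σ : ℕ → B →⋆ₙₐ[ℂ] B
  Ψ : B →⋆ₙₐ[ℂ] D
  S : ℕ → D
  injective : Function.Injective Ψ
  essential : ∀ n, Essential (σ n)
  map_mul_S : ∀ n b, Ψ b * S n = S n * Ψ (σ n b)
  star_S_mul : ∀ m n b, star (S m) * (S n * Ψ b) = if m = n then Ψ b else 0
  norm_S_le : ∀ n, ‖S n‖ ≤ 1
  -- The limsup condition in the form needed here: the norm of b is recovered by σ n for indices n
  -- beyond any finite corner.
  exists_norm_lt : ∀ b N r, r < ‖b‖ → ∃ n ≥ N, r < ‖σ n b‖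

namespace CuntzSystem

variable {B : Type u} [NonUnitalCStarAlgebra B] {D : Type v} [CStarAlgebra D]
  (P : CuntzSystem B D)

theorem star_S_mul_map (n : ℕ) (b : B) : star (P.S n) * P.Ψ b = P.Ψ (P.σ n b) * star (P.S n) := by
  have := congrArg star (P.map_mul_S n (star b))
  simpa [← map_star] using this

/-- Since Ψ(e) S n y = S n Ψ(σ n e) y, non-degeneracy of σ n lets the approximate unit pass through
S n. -/
theorem leftEssential_S_mul {y : D} (hy : LeftEssential P.Ψ y) (n : ℕ) :
    LeftEssential P.Ψ (P.S n * y) := by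
  have h := Tendsto.const_mul (P.S n) (hy.comp (P.essential n))
  refine h.congr fun e => ?_
  simp only [NonUnitalStarAlgHom.comp_apply]
  rw [← mul_assoc, ← P.map_mul_S, mul_assoc]

/-- The isometry relation is known only in front of Ψ b; writing y as the limit of Ψ(e) y extends it
to the whole essential part. -/
theorem star_S_mul_S_mul {y : D} (hy : LeftEssential P.Ψ y) (m n : ℕ) :
    star (P.S m) * (P.S n * y) = if m = n then y else 0 := by
  have h1 := Tendsto.const_mul (star (P.S m)) (Tendsto.const_mul (P.S n) hy)
  have h2 : ∀ e, star (P.S m) * (P.S n * (P.Ψ e * y)) = if m = n then P.Ψ e * y else 0 := by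
    intro e
    rw [← mul_assoc, ← mul_assoc, mul_assoc (star _), P.star_S_mul]
    split_ifs <;> simp
  simp only [h2] at h1
  refine tendsto_nhds_unique h1 ?_
  split_ifs
  · exact hy
  · exact tendsto_const_nhds

theorem mul_star_S_mul_S {y : D} (hy : LeftEssential P.Ψ (star y)) (m n : ℕ) :
    y * star (P.S m) * P.S n = if m = n then y else 0 := by
  have h := congrArg star (P.star_S_mul_S_mul hy n m)
  simp only [star_mul, star_star] at h
  rw [h]
  by_cases hmn : m = n <;> simp [hmn, Ne.symm]

/-- The operator `∑ Sᵢ dᵢⱼ Sⱼ⋆` over `i, j < M`. -/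
def corner (M : ℕ) (d : ℕ → ℕ → D) : D :=
  ∑ i ∈ Finset.range M, ∑ j ∈ Finset.range M, P.S i * d i j * star (P.S j)

theorem star_S_mul_corner {M : ℕ} {d : ℕ → ℕ → D}
    (hd : ∀ i < M, ∀ j < M, LeftEssential P.Ψ (d i j)) (k : ℕ) :
    star (P.S k) * P.corner M d
      = if k < M then ∑ j ∈ Finset.range M, d k j * star (P.S j) else 0 := by
  rw [corner, Finset.mul_sum]
  have h : ∀ i ∈ Finset.range M, star (P.S k) * ∑ j ∈ Finset.range M, P.S i * d i j * star (P.S j)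
      = if k = i then ∑ j ∈ Finset.range M, d k j * star (P.S j) else 0 := by
    intro i hi
    rw [Finset.mul_sum]
    split_ifs with hki
    · refine Finset.sum_congr rfl fun j hj => ?_
      rw [← mul_assoc, P.star_S_mul_S_mul (hd i (Finset.mem_range.1 hi) j (Finset.mem_range.1 hj)),
        if_pos hki, hki]
    · refine Finset.sum_eq_zero fun j hj => ?_
      rw [← mul_assoc, P.star_S_mul_S_mul (hd i (Finset.mem_range.1 hi) j (Finset.mem_range.1 hj)),
        if_neg hki, zero_mul]
  rw [Finset.sum_congr rfl h, Finset.sum_ite_eq]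
  simp

theorem star_S_mul_corner_mul_S {M : ℕ} {d : ℕ → ℕ → D}
    (hd : ∀ i < M, ∀ j < M, LeftEssential P.Ψ (d i j))
    (hd' : ∀ i < M, ∀ j < M, LeftEssential P.Ψ (star (d i j))) (k l : ℕ) :
    star (P.S k) * P.corner M d * P.S l = if k < M ∧ l < M then d k l else 0 := by
  rw [P.star_S_mul_corner hd]
  by_cases hk : k < M
  · rw [if_pos hk, Finset.sum_mul]
    have h : ∀ j ∈ Finset.range M, d k j * star (P.S j) * P.S l = if j = l then d k j else 0 :=
      fun j hj => P.mul_star_S_mul_S (hd' k hk j (Finset.mem_range.1 hj)) j l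
    rw [Finset.sum_congr rfl h, Finset.sum_ite_eq']
    simp [hk]
  · simp [hk]

theorem corner_mul_corner {M : ℕ} (d : ℕ → ℕ → D) {d' : ℕ → ℕ → D}
    (hd : ∀ i < M, ∀ j < M, LeftEssential P.Ψ (d' i j)) :
    P.corner M d * P.corner M d'
      = P.corner M fun i j => ∑ k ∈ Finset.range M, d i k * d' k j := by
  have h : ∀ i ∈ Finset.range M, (∑ k ∈ Finset.range M, P.S i * d i k * star (P.S k))
      * P.corner M d' = ∑ j ∈ Finset.range M,
        P.S i * (∑ k ∈ Finset.range M, d i k * d' k j) * star (P.S j) := by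
    intro i _
    simp only [Finset.sum_mul, Finset.mul_sum]
    rw [Finset.sum_comm]
    refine Finset.sum_congr rfl fun k hk => ?_
    rw [mul_assoc, P.star_S_mul_corner hd, if_pos (Finset.mem_range.1 hk), Finset.mul_sum]
    simp only [mul_assoc]
  rw [corner, Finset.sum_mul, Finset.sum_congr rfl h]
  rfl

theorem map_mul_corner (M : ℕ) (b : B) (d : ℕ → ℕ → D) :
    P.Ψ b * P.corner M d = P.corner M fun i j => P.Ψ (P.σ i b) * d i j := by
  simp only [corner, Finset.mul_sum]
  refine Finset.sum_congr rfl fun i _ => Finset.sum_congr rfl fun j _ => ?_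
  rw [← mul_assoc, ← mul_assoc, P.map_mul_S, mul_assoc (P.S i)]

theorem corner_mul_map (M : ℕ) (b : B) (d : ℕ → ℕ → D) :
    P.corner M d * P.Ψ b = P.corner M fun i j => d i j * P.Ψ (P.σ j b) := by
  simp only [corner, Finset.sum_mul]
  refine Finset.sum_congr rfl fun i _ => Finset.sum_congr rfl fun j _ => ?_
  rw [mul_assoc, P.star_S_mul_map]
  simp only [mul_assoc]

theorem star_corner (M : ℕ) (d : ℕ → ℕ → D) :
    star (P.corner M d) = P.corner M fun i j => star (d j i) := by
  simp only [corner, star_sum, star_mul, star_star]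
  rw [Finset.sum_comm]
  simp only [mul_assoc]

theorem corner_add (M : ℕ) (d d' : ℕ → ℕ → D) :
    P.corner M d + P.corner M d' = P.corner M fun i j => d i j + d' i j := by
  simp only [corner, mul_add, add_mul, Finset.sum_add_distrib]

theorem smul_corner (M : ℕ) (z : ℂ) (d : ℕ → ℕ → D) :
    z • P.corner M d = P.corner M fun i j => z • d i j := by
  simp only [corner, Finset.smul_sum, mul_smul_comm, smul_mul_assoc]

theorem corner_zero (M : ℕ) : P.corner M (fun _ _ => 0) = 0 := by simp [corner]

theorem norm_map (b : B) : ‖P.Ψ b‖ = ‖b‖ := NonUnitalStarAlgHom.norm_map P.Ψ P.injective b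

theorem norm_compress_le (c : D) (i j : ℕ) : ‖star (P.S i) * c * P.S j‖ ≤ ‖c‖ := by
  refine (norm_mul_le _ _).trans ((mul_le_of_le_one_right (norm_nonneg _) (P.norm_S_le j)).trans ?_)
  refine (norm_mul_le _ _).trans (mul_le_of_le_one_left (norm_nonneg _) ?_)
  rw [norm_star]
  exact P.norm_S_le i

theorem compress_map (b : B) (i j : ℕ) :
    star (P.S i) * P.Ψ b * P.S j = if i = j then P.Ψ (P.σ i b) else 0 := by
  rw [mul_assoc, P.map_mul_S, P.star_S_mul]
  by_cases h : i = j <;> simp [h]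

/-- For n ≥ M the range of S n is orthogonal to the ranges of the S i with i < M that carry the
corner. -/
theorem compress_map_add_corner {M : ℕ} {d : ℕ → ℕ → D}
    (hd : ∀ i < M, ∀ j < M, LeftEssential P.Ψ (d i j)) (b : B) {n : ℕ} (hn : M ≤ n) :
    star (P.S n) * (P.Ψ b + P.corner M d) * P.S n = P.Ψ (P.σ n b) := by
  rw [mul_add, add_mul, P.compress_map, if_pos rfl, P.star_S_mul_corner hd, if_neg (by omega),
    zero_mul, add_zero]

/-- Compressions by S n with n ≥ M are contractive, do not see the corner, and recover the norm of b
by `exists_norm_lt`. Hence b depends continuously on the sum, which makes `coreStep` closed. -/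
theorem norm_le_norm_map_add_corner {M : ℕ} {d : ℕ → ℕ → D}
    (hd : ∀ i < M, ∀ j < M, LeftEssential P.Ψ (d i j)) (b : B) :
    ‖b‖ ≤ ‖P.Ψ b + P.corner M d‖ := by
  refine le_of_forall_lt fun r hr => ?_
  obtain ⟨n, hn, hrn⟩ := P.exists_norm_lt b M r hr
  rw [← P.norm_map, ← P.compress_map_add_corner hd b hn] at hrn
  exact hrn.trans_le (P.norm_compress_le _ _ _)

/-- The closed ⋆-subalgebras that contain `Ψ B` and for which `Ψ B` is essential. -/
structure IsCore (X : NonUnitalStarSubalgebra ℂ D) : Prop where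
  map_mem : ∀ b, P.Ψ b ∈ X
  essential : ∀ y ∈ X, LeftEssential P.Ψ y
  isClosed : IsClosed (X : Set D)

variable {P}

theorem IsCore.essential_star {X : NonUnitalStarSubalgebra ℂ D} (hX : P.IsCore X) {y : D}
    (hy : y ∈ X) : LeftEssential P.Ψ (star y) := hX.essential _ (star_mem hy)

variable (P)

/-- The ⋆-subalgebra `Ψ B + ∑ Sᵢ X Sⱼ⋆`, the sum being over `i, j < M`. -/
def coreStep (M : ℕ) (X : NonUnitalStarSubalgebra ℂ D) (hX : P.IsCore X) :
    NonUnitalStarSubalgebra ℂ D where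
  carrier := {c | ∃ b, ∃ d : ℕ → ℕ → D, (∀ i < M, ∀ j < M, d i j ∈ X) ∧ c = P.Ψ b + P.corner M d}
  zero_mem' := ⟨0, fun _ _ => 0, fun _ _ _ _ => zero_mem X, by simp [corner_zero]⟩
  add_mem' := by
    rintro _ _ ⟨b, d, hd, rfl⟩ ⟨b', d', hd', rfl⟩
    refine ⟨b + b', _, fun i hi j hj => add_mem (hd i hi j hj) (hd' i hi j hj), ?_⟩
    rw [← corner_add, map_add]
    abel
  smul_mem' := by
    rintro z _ ⟨b, d, hd, rfl⟩
    refine ⟨z • b, _, fun i hi j hj => SMulMemClass.smul_mem z (hd i hi j hj), ?_⟩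
    rw [← smul_corner, map_smul, smul_add]
  star_mem' := by
    rintro _ ⟨b, d, hd, rfl⟩
    refine ⟨star b, _, fun i hi j hj => star_mem (hd j hj i hi), ?_⟩
    rw [← star_corner, map_star, star_add]
  mul_mem' := by
    rintro _ _ ⟨b, d, hd, rfl⟩ ⟨b', d', hd', rfl⟩
    refine ⟨b * b', fun i j => P.Ψ (P.σ i b) * d' i j + d i j * P.Ψ (P.σ j b')
      + ∑ k ∈ Finset.range M, d i k * d' k j, fun i hi j hj => ?_, ?_⟩
    · exact add_mem (add_mem (mul_mem (hX.map_mem _) (hd' i hi j hj))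
        (mul_mem (hd i hi j hj) (hX.map_mem _)))
        (sum_mem fun k hk => mul_mem (hd i hi k (Finset.mem_range.1 hk))
          (hd' k (Finset.mem_range.1 hk) j hj))
    · rw [← P.corner_add, ← P.corner_add, ← map_mul_corner, ← corner_mul_map,
        ← P.corner_mul_corner d fun i hi j hj => hX.essential _ (hd' i hi j hj), map_mul, add_mul,
        mul_add, mul_add]
      abel

theorem isCore_coreStep (M : ℕ) (X : NonUnitalStarSubalgebra ℂ D) (hX : P.IsCore X) :
    P.IsCore (P.coreStep M X hX) where
  map_mem b := ⟨b, fun _ _ => 0, fun _ _ _ _ => zero_mem X, by simp [corner_zero]⟩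
  essential := by
    rintro _ ⟨b, d, hd, rfl⟩
    refine (leftEssential_map P.Ψ b).add (LeftEssential.sum fun i hi => LeftEssential.sum
      fun j hj => LeftEssential.mul (P.leftEssential_S_mul (hX.essential _
        (hd i (Finset.mem_range.1 hi) j (Finset.mem_range.1 hj))) _) _)
  isClosed := by
    refine IsSeqClosed.isClosed fun c a hc ha => ?_
    choose b d hd hcd using hc
    -- The coefficients b are controlled by the norm of the whole sum; the matrix entries are
    -- recovered afterwards by the continuous compressions S i⋆ · S j.
    have hb : CauchySeq b := by
      have h2 := ha.cauchySeq
      rw [Metric.cauchySeq_iff'] at h2 ⊢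
      intro ε hε
      obtain ⟨N, hN⟩ := h2 ε hε
      refine ⟨N, fun n hn => lt_of_le_of_lt ?_ (hN n hn)⟩
      have h3 : c n - c N = P.Ψ (b n - b N) + P.corner M (fun i j => d n i j + (-1 : ℂ) • d N i j) := by
        rw [← corner_add, ← smul_corner, map_sub, hcd n, hcd N, neg_one_smul]
        abel
      rw [dist_eq_norm, dist_eq_norm, h3]
      refine P.norm_le_norm_map_add_corner (fun i hi j hj => ?_) _
      exact hX.essential _ (add_mem (hd n i hi j hj) (SMulMemClass.smul_mem _ (hd N i hi j hj)))
    obtain ⟨b', hb'⟩ := cauchySeq_tendsto_of_complete hb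
    have hΨ : Tendsto (fun n => P.Ψ (b n)) atTop (𝓝 (P.Ψ b')) :=
      ((continuous_starHom P.Ψ).tendsto b').comp hb'
    have hT : ∀ n, c n - P.Ψ (b n) = P.corner M (d n) := fun n => by rw [hcd n]; abel
    have hsub := ha.sub hΨ
    have hd2 : ∀ i j, Tendsto (fun n => star (P.S i) * (c n - P.Ψ (b n)) * P.S j) atTop
        (𝓝 (star (P.S i) * (a - P.Ψ b') * P.S j)) := fun i j =>
      (hsub.const_mul _).mul_const _
    have hdn : ∀ i < M, ∀ j < M, ∀ n, star (P.S i) * (c n - P.Ψ (b n)) * P.S j = d n i j := by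
      intro i hi j hj n
      rw [hT, P.star_S_mul_corner_mul_S (fun i hi j hj => hX.essential _ (hd n i hi j hj))
        (fun i hi j hj => hX.essential_star (hd n i hi j hj)), if_pos ⟨hi, hj⟩]
    refine ⟨b', fun i j => star (P.S i) * (a - P.Ψ b') * P.S j, fun i hi j hj => ?_, ?_⟩
    · exact hX.isClosed.mem_of_tendsto (hd2 i j) (Eventually.of_forall fun n => by
        rw [hdn i hi j hj]
        exact hd n i hi j hj)
    · rw [← sub_eq_iff_eq_add']
      refine tendsto_nhds_unique hsub ?_
      have h4 : Tendsto (fun n => P.corner M fun i j => star (P.S i) * (c n - P.Ψ (b n)) * P.S j)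
          atTop (𝓝 (P.corner M fun i j => star (P.S i) * (a - P.Ψ b') * P.S j)) :=
        tendsto_finsetSum _ fun i _ => tendsto_finsetSum _ fun j _ =>
          ((hd2 i j).const_mul _).mul_const _
      refine h4.congr fun n => ?_
      rw [hT]
      refine Finset.sum_congr rfl fun i hi => Finset.sum_congr rfl fun j hj => ?_
      dsimp only
      rw [← hT, hdn i (Finset.mem_range.1 hi) j (Finset.mem_range.1 hj)]

/-! ### The increasing filtration of the core. -/

theorem isCore_range : P.IsCore (NonUnitalStarAlgHom.range P.Ψ) where
  map_mem b := ⟨b, rfl⟩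
  essential := by
    rintro _ ⟨b, rfl⟩
    exact leftEssential_map P.Ψ b
  isClosed := by
    have h := (NonUnitalStarAlgHom.isometry P.Ψ P.injective).isClosedEmbedding.isClosed_range
    convert h
    ext; simp

/-- The increasing sequence of ⋆-subalgebras whose union is dense in the gauge-fixed part. -/
noncomputable def coreAux : ℕ → {X : NonUnitalStarSubalgebra ℂ D // P.IsCore X}
  | 0 => ⟨_, P.isCore_range⟩
  -- The same N bounds the depth and the number of isometries, so the stages increase and every S i
  -- X S j⋆ is eventually absorbed.
  | N + 1 => ⟨P.coreStep N (coreAux N).1 (coreAux N).2, P.isCore_coreStep _ _ _⟩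

/-- The members of the sequence `coreAux`. -/
noncomputable def core (N : ℕ) : NonUnitalStarSubalgebra ℂ D := (P.coreAux N).1

theorem isCore_core (N : ℕ) : P.IsCore (P.core N) := (P.coreAux N).2

theorem mem_core_succ {N : ℕ} {c : D} : c ∈ P.core (N + 1) ↔ ∃ b, ∃ d : ℕ → ℕ → D,
    (∀ i < N, ∀ j < N, d i j ∈ P.core N) ∧ c = P.Ψ b + P.corner N d := Iff.rfl

theorem core_le_succ (N : ℕ) : P.core N ≤ P.core (N + 1) := by
  induction N with
  | zero =>
    rintro _ ⟨b, rfl⟩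
    exact (P.isCore_core 1).map_mem b
  | succ N ih =>
    intro c hc
    obtain ⟨b, d, hd, rfl⟩ := P.mem_core_succ.1 hc
    -- The next corner has one more row and column, which are filled with zeros.
    refine P.mem_core_succ.2 ⟨b, fun i j => if i < N ∧ j < N then d i j else 0, ?_, ?_⟩
    · intro i _ j _
      dsimp only
      split_ifs with h
      · exact ih (hd i h.1 j h.2)
      · exact zero_mem _
    · congr 1
      simp only [corner, Finset.sum_range_succ, lt_irrefl, false_and, and_false, if_false, mul_zero,
        zero_mul, Finset.sum_const_zero, add_zero]
      refine Finset.sum_congr rfl fun i hi => Finset.sum_congr rfl fun j hj => ?_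
      rw [if_pos ⟨Finset.mem_range.1 hi, Finset.mem_range.1 hj⟩]

theorem core_mono : Monotone P.core := monotone_nat_of_le_succ P.core_le_succ

/-- Stage N + i + j + 2 uses the cut-off N + i + j + 1, which exceeds both i and j, and its entries
come from a stage containing stage N. -/
theorem S_mul_mul_star_S_mem_core {N : ℕ} {y : D} (hy : y ∈ P.core N) (i j : ℕ) :
    P.S i * y * star (P.S j) ∈ P.core (N + i + j + 2) := by
  refine P.mem_core_succ.2 ⟨0, fun k l => if k = i ∧ l = j then y else 0, ?_, ?_⟩
  · intro k _ l _
    dsimp only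
    split_ifs
    · exact P.core_mono (by omega) hy
    · exact zero_mem _
  · rw [map_zero, zero_add, corner, Finset.sum_eq_single i, Finset.sum_eq_single j]
    · simp
    · intro l _ hl; simp [hl]
    · intro hj; exact absurd (Finset.mem_range.2 (by omega)) hj
    · intro k _ hk; simp [hk]
    · intro hi; exact absurd (Finset.mem_range.2 (by omega)) hi

/-! ### Ideals and the core -/

variable {C : NonUnitalStarSubalgebra ℂ D} {I : Submodule ℂ D}

/-- Two-sided essentiality makes y a limit of the sandwiched elements, first on the left and then on
the right. -/
theorem mem_of_sandwich (hIc : IsClosed (I : Set D)) {y : D} (hy : LeftEssential P.Ψ y)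
    (hy' : LeftEssential P.Ψ (star y)) (h : ∀ b b', P.Ψ b * y * P.Ψ b' ∈ I) : y ∈ I := by
  have h1 : ∀ b', y * P.Ψ b' ∈ I := fun b' => by
    refine hIc.mem_of_tendsto (hy.mul (P.Ψ b')) (Eventually.of_forall fun e => ?_)
    rw [← mul_assoc]
    exact h e b'
  have h2 := Tendsto.star hy'
  rw [star_star] at h2
  refine hIc.mem_of_tendsto h2 (Eventually.of_forall fun e => ?_)
  rw [star_mul, star_star, ← map_star]
  exact h1 _

/-- The operators S i need not lie in C, so S i⋆ c S j is not visibly in I. Sandwiched between Ψ b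
and Ψ b' it is c multiplied by elements S n Ψ(b) of C and their adjoints. -/
theorem compress_mem (hS : ∀ n b, P.S n * P.Ψ b ∈ C) (hI : IsIdealIn C I)
    (hIc : IsClosed (I : Set D)) {c y : D} (hc : c ∈ I) {i j : ℕ}
    (hcy : star (P.S i) * c * P.S j = y) (hy : LeftEssential P.Ψ y)
    (hy' : LeftEssential P.Ψ (star y)) : y ∈ I := by
  refine P.mem_of_sandwich hIc hy hy' fun b b' => ?_
  have : P.Ψ b * y * P.Ψ b' = star (P.S i * P.Ψ (star b)) * c * (P.S j * P.Ψ b') := by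
    rw [← hcy, star_mul, map_star, star_star]
    simp only [mul_assoc]
  rw [this]
  exact hI.mul_right _ (hS _ _) _ (hI.mul_left _ (star_mem (hS _ _)) _ hc)

theorem map_σ_mem (hS : ∀ n b, P.S n * P.Ψ b ∈ C) (hI : IsIdealIn C I)
    (hIc : IsClosed (I : Set D)) {b : B} (hb : P.Ψ b ∈ I) (n : ℕ) : P.Ψ (P.σ n b) ∈ I :=
  P.compress_mem hS hI hIc hb (by rw [P.compress_map, if_pos rfl]) (leftEssential_map _ _)
    (by rw [← map_star]; exact leftEssential_map _ _)

/-- For Ψ(b) + ∑ S i d i j S j⋆ in I, compressing by S n with n ≥ N puts Ψ(σ n b) into I, so σ n b =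
0 for all these n and b = 0 by the norm condition. Compressing by S i and S j then puts the entries
into I, and induction on N applies. -/
theorem eq_zero_of_mem_core (hS : ∀ n b, P.S n * P.Ψ b ∈ C) (hI : IsIdealIn C I)
    (hIc : IsClosed (I : Set D)) (h0 : ∀ b, P.Ψ b ∈ I → b = 0) (N : ℕ) :
    ∀ c ∈ P.core N, c ∈ I → c = 0 := by
  induction N with
  | zero =>
    rintro _ ⟨b, rfl⟩ hb
    have := h0 b hb
    subst this
    exact map_zero _
  | succ N ih =>
    intro c hc hcI
    obtain ⟨b, d, hd, rfl⟩ := P.mem_core_succ.1 hc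
    have hE : ∀ i < N, ∀ j < N, LeftEssential P.Ψ (d i j) := fun i hi j hj =>
      (P.isCore_core N).essential _ (hd i hi j hj)
    have hE' : ∀ i < N, ∀ j < N, LeftEssential P.Ψ (star (d i j)) := fun i hi j hj =>
      (P.isCore_core N).essential_star (hd i hi j hj)
    have hb : b = 0 := by
      by_contra hb
      obtain ⟨n, hn, hbn⟩ := P.exists_norm_lt b N 0 (norm_pos_iff.2 hb)
      refine hbn.ne' (norm_eq_zero.2 (h0 _ ?_))
      exact P.compress_mem hS hI hIc hcI (P.compress_map_add_corner hE b hn)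
        (leftEssential_map _ _) (by rw [← map_star]; exact leftEssential_map _ _)
    subst hb
    rw [map_zero, zero_add] at hcI ⊢
    refine Finset.sum_eq_zero fun i hi => Finset.sum_eq_zero fun j hj => ?_
    rw [Finset.mem_range] at hi hj
    rw [ih (d i j) (hd i hi j hj) (P.compress_mem hS hI hIc hcI (i := i) (j := j) ?_
      (hE i hi j hj) (hE' i hi j hj)), mul_zero, zero_mul]
    rw [P.star_S_mul_corner_mul_S hE hE', if_pos ⟨hi, hj⟩]

/-- A closed ideal that contains a nonzero element of the closure of the core contains a nonzero
element of `Ψ B`. -/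
theorem exists_map_mem_of_mem_closure_core (hCc : IsClosed (C : Set D))
    (hS : ∀ n b, P.S n * P.Ψ b ∈ C) (hcore : ∀ N, P.core N ≤ C) (hI : IsIdealIn C I)
    (hIc : IsClosed (I : Set D)) {c : D} (hc : c ∈ I) (hc0 : c ≠ 0)
    (hcc : c ∈ closure (⋃ N, (P.core N : Set D))) : ∃ b, b ≠ 0 ∧ P.Ψ b ∈ I := by
  by_contra! hcon
  have h0 : ∀ b, P.Ψ b ∈ I → b = 0 := fun b hb => by
    by_contra hb0
    exact hcon b hb0 hb
  -- With ‖c⋆c‖ = 4ε and y⋆y within ε of c⋆c, a vanishing threshold of y⋆y at level 2ε would give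
  -- ‖c⋆c‖ ≤ 3ε.
  set ε := ‖c‖ ^ 2 / 4 with hε
  have hcpos : 0 < ‖c‖ := norm_pos_iff.2 hc0
  have hεpos : 0 < ε := by positivity
  have hcont : Continuous fun y : D => star y * y := by fun_prop
  obtain ⟨y, hy, hyc⟩ := mem_closure_iff.1 hcc {y | ‖star y * y - star c * c‖ < ε}
    (isOpen_lt ((hcont.sub continuous_const).norm) continuous_const) (by simpa using hεpos)
  obtain ⟨N, hyN⟩ := Set.mem_iUnion.1 hyc
  have hy : ‖star y * y - star c * c‖ < ε := hy
  have hyN : y ∈ P.core N := hyN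
  have hyy : star y * y ∈ P.core N := mul_mem (star_mem hyN) hyN
  have hccI : star c * c ∈ I := hI.mul_left _ (star_mem (hI.le _ hc)) _ hc
  -- The threshold of y⋆y lies in I and in stage N of the core, so it vanishes.
  have hmem := cfcₙ_softThreshold_mem hCc hI hIc (hcore N hyy) (IsSelfAdjoint.star_mul_self y) hccI
    hεpos hy.le
  have hzero := P.eq_zero_of_mem_core hS hI hIc h0 N _
    (cfcₙ_mem_of_isClosed (P.isCore_core N).isClosed _ hyy) hmem
  have h1 := norm_sub_cfcₙ_softThreshold_le (δ := 2 * ε) (by positivity)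
    (IsSelfAdjoint.star_mul_self y)
  rw [hzero, sub_zero] at h1
  have h2 : ‖star c * c‖ = 4 * ε := by
    rw [CStarRing.norm_star_mul_self, hε]; ring
  have h3 : ‖star c * c‖ ≤ ‖star y * y‖ + ‖star y * y - star c * c‖ := by
    have := norm_sub_le (star y * y) (star y * y - star c * c)
    simpa using this
  linarith

end CuntzSystem

end QuasiFree

/-! ### Words in the isometries and the closed span of the monomials. -/

namespace QuasiFree

namespace CuntzSystem

variable {B : Type u} [NonUnitalCStarAlgebra B] {D : Type v} [CStarAlgebra D]
  (P : CuntzSystem B D)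

/-- The operator `S_w = S_{i₁} ⋯ S_{iₙ}` for the word `w = (i₁, …, iₙ)`. -/
def word : List ℕ → D
  | [] => 1
  | i :: w => P.S i * word w

@[simp] theorem word_nil : P.word [] = 1 := rfl

theorem word_cons (i : ℕ) (w : List ℕ) : P.word (i :: w) = P.S i * P.word w := rfl

theorem word_append (v w : List ℕ) : P.word (v ++ w) = P.word v * P.word w := by
  induction v with
  | nil => simp
  | cons i v ih => rw [List.cons_append, word_cons, word_cons, ih, mul_assoc]

theorem map_mul_word (w : List ℕ) (b : B) :
    P.Ψ b * P.word w = P.word w * P.Ψ (wordHom P.σ w b) := by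
  induction w generalizing b with
  | nil => simp [wordHom]
  | cons i w ih => rw [word_cons, ← mul_assoc, P.map_mul_S, mul_assoc, ih, mul_assoc]; rfl

theorem star_word_mul_map (w : List ℕ) (b : B) :
    star (P.word w) * P.Ψ b = P.Ψ (wordHom P.σ w b) * star (P.word w) := by
  have := congrArg star (P.map_mul_word w (star b))
  simpa [← map_star] using this

theorem leftEssential_word_mul {y : D} (hy : LeftEssential P.Ψ y) (w : List ℕ) :
    LeftEssential P.Ψ (P.word w * y) := by
  induction w with
  | nil => simpa using hy
  | cons i w ih =>
    rw [word_cons, mul_assoc]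
    exact P.leftEssential_S_mul ih i

/-- The set of all `S_u Ψ(b) S_v⋆`. -/
def monomials : Set D := {y | ∃ u v b, y = P.word u * P.Ψ b * star (P.word v)}

theorem word_mul_map_mem (w : List ℕ) (b : B) : P.word w * P.Ψ b ∈ P.monomials :=
  ⟨w, [], b, by simp⟩

theorem map_mem_monomials (b : B) : P.Ψ b ∈ P.monomials := by
  simpa using P.word_mul_map_mem [] b

theorem S_mul_map_mem (n : ℕ) (b : B) : P.S n * P.Ψ b ∈ P.monomials := by
  simpa [word_cons] using P.word_mul_map_mem [n] b

theorem star_mem_monomials {y : D} (hy : y ∈ P.monomials) : star y ∈ P.monomials := by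
  obtain ⟨u, v, b, rfl⟩ := hy
  exact ⟨v, u, star b, by simp [map_star, mul_assoc]⟩

theorem leftEssential_monomial {y : D} (hy : y ∈ P.monomials) : LeftEssential P.Ψ y := by
  obtain ⟨u, v, b, rfl⟩ := hy
  exact (P.leftEssential_word_mul (leftEssential_map _ b) u).mul _

/-- The ⋆-subalgebra `C` is the closed linear span of the monomials. -/
def Generates (C : NonUnitalStarSubalgebra ℂ D) : Prop :=
  (C : Set D) = closure (Submodule.span ℂ P.monomials : Set D)

variable {P} {C : NonUnitalStarSubalgebra ℂ D}

theorem Generates.isClosed (hC : P.Generates C) : IsClosed (C : Set D) := by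
  rw [Generates] at hC
  rw [hC]
  exact isClosed_closure

theorem Generates.mem (hC : P.Generates C) {y : D} (hy : y ∈ P.monomials) : y ∈ C := by
  change y ∈ (C : Set D)
  rw [Generates] at hC
  rw [hC]
  exact subset_closure (Submodule.subset_span hy)

/-- Induction principle for the closed linear span of the monomials. -/
theorem Generates.induction (hC : P.Generates C) {p : Submodule ℂ D} (hp : IsClosed (p : Set D))
    (h : ∀ y ∈ P.monomials, y ∈ p) {c : D} (hc : c ∈ C) : c ∈ p := by
  have hc : c ∈ (C : Set D) := hc
  rw [Generates] at hC
  rw [hC] at hc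
  exact hp.closure_subset_iff.2 (Submodule.span_le.2 h) hc

theorem Generates.core_le (hC : P.Generates C) (N : ℕ) : P.core N ≤ C := by
  -- Arbitrary outer words are needed for the induction: the factors S i and S j⋆ of the corner are
  -- absorbed into u and v.
  have key : ∀ N, ∀ c ∈ P.core N, ∀ u v, P.word u * c * star (P.word v) ∈ C := by
    intro N
    induction N with
    | zero =>
      rintro _ ⟨b, rfl⟩ u v
      exact hC.mem ⟨u, v, b, rfl⟩
    | succ N ih =>
      intro c hc u v
      obtain ⟨b, d, hd, rfl⟩ := P.mem_core_succ.1 hc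
      rw [mul_add, add_mul, corner, Finset.mul_sum, Finset.sum_mul]
      refine add_mem (hC.mem ⟨u, v, b, rfl⟩) (sum_mem fun i hi => ?_)
      rw [Finset.mul_sum, Finset.sum_mul]
      refine sum_mem fun j hj => ?_
      have := ih _ (hd i (Finset.mem_range.1 hi) j (Finset.mem_range.1 hj)) (u ++ [i]) (v ++ [j])
      simpa [word_append, word_cons, mul_assoc] using this
  intro c hc
  simpa using key N c hc [] []

variable (P)

/-- The closure of the union of the subalgebras `core N`. -/
noncomputable def coreClosure : Submodule ℂ D :=
  (⨆ N, (P.core N).toSubmodule).topologicalClosure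

theorem isClosed_coreClosure : IsClosed (P.coreClosure : Set D) :=
  Submodule.isClosed_topologicalClosure _

theorem mem_coreClosure {y : D} :
    y ∈ P.coreClosure ↔ y ∈ closure (⋃ N, (P.core N : Set D)) := by
  have h : ((⨆ N, (P.core N).toSubmodule : Submodule ℂ D) : Set D)
      = ⋃ N, (P.core N : Set D) :=
    Submodule.coe_iSup_of_directed _ (Monotone.directed_le fun _ _ h => P.core_mono h)
  rw [← h, ← Submodule.topologicalClosure_coe]
  rfl

theorem mem_coreClosure_of_mem {N : ℕ} {y : D} (hy : y ∈ P.core N) : y ∈ P.coreClosure :=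
  P.mem_coreClosure.2 (subset_closure (Set.mem_iUnion.2 ⟨N, hy⟩))

/-- Words of equal length can be stripped of their first letters simultaneously, down to Ψ b; these
are the monomials of gauge degree zero. -/
theorem monomial_mem_core (b : B) : ∀ u v : List ℕ, u.length = v.length →
    ∃ N, P.word u * P.Ψ b * star (P.word v) ∈ P.core N
  | [], [], _ => ⟨0, by simpa using (P.isCore_core 0).map_mem b⟩
  | i :: u, j :: v, h => by
    obtain ⟨N, hN⟩ := monomial_mem_core b u v (by simpa using h)
    have := P.S_mul_mul_star_S_mem_core hN i j
    exact ⟨N + i + j + 2, by simpa only [word_cons, star_mul, mul_assoc] using this⟩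

end CuntzSystem

/-! ### Phases and averaging -/

/-- A `CuntzSystem` of operators on a Hilbert space with a unitary group `U` that multiplies `S n`
by the phase `exp (i x n t)` and commutes with `Ψ B`. -/
structure PhaseSystem (B : Type u) [NonUnitalCStarAlgebra B] (K : Type v) [NormedAddCommGroup K]
    [InnerProductSpace ℂ K] [CompleteSpace K] extends CuntzSystem B (K →L[ℂ] K) where
  x : ℕ → ℝ
  U : ℝ → K →L[ℂ] K
  U_zero : U 0 = 1
  U_mul_star : ∀ t, U t * star (U t) = 1
  star_mul_U : ∀ t, star (U t) * U t = 1
  U_mul_S : ∀ t n, U t * S n = (Circle.exp (x n * t) : ℂ) • (S n * U t)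
  U_mul_map : ∀ t b, U t * Ψ b = Ψ b * U t
  -- This makes U t a multiplier of the generated algebra, so that conjugation by U t preserves its
  -- closed ideals.
  U_map_mem : ∀ t b, ∃ b', U t * Ψ b = Ψ b'
  const_mem : ∀ z : Circle, (fun _ : ℕ => z) ∈ orbitClosure x

namespace PhaseSystem

variable {B : Type u} [NonUnitalCStarAlgebra B] {K : Type v} [NormedAddCommGroup K]
  [InnerProductSpace ℂ K] [CompleteSpace K] (P : PhaseSystem B K)

theorem U_mul_word (t : ℝ) (w : List ℕ) :
    P.U t * P.word w = (Circle.exp (wordSum P.x w * t) : ℂ) • (P.word w * P.U t) := by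
  induction w with
  | nil => simp [wordSum]
  | cons i w ih =>
    rw [CuntzSystem.word_cons, ← mul_assoc, P.U_mul_S, smul_mul_assoc, mul_assoc, ih,
      mul_smul_comm, smul_smul, ← Circle.coe_mul, ← Circle.exp_add, ← mul_assoc, wordSum, wordSum,
      List.map_cons, List.sum_cons, add_mul]

/-- Conjugation by `U t`. -/
noncomputable def conj (t : ℝ) : (K →L[ℂ] K) →ₗ[ℂ] (K →L[ℂ] K) where
  toFun c := P.U t * c * star (P.U t)
  map_add' c d := by rw [mul_add, add_mul]
  map_smul' z c := by simp

theorem conj_apply (t : ℝ) (c : K →L[ℂ] K) : P.conj t c = P.U t * c * star (P.U t) := rfl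

theorem norm_conj_le (t : ℝ) (c : K →L[ℂ] K) : ‖P.conj t c‖ ≤ ‖c‖ := by
  have h1 : ‖P.U t‖ ≤ 1 := by
    have : ‖star (P.U t) * P.U t‖ ≤ 1 := by
      rw [P.star_mul_U]
      exact ContinuousLinearMap.norm_id_le
    rw [CStarRing.norm_star_mul_self] at this
    nlinarith [norm_nonneg (P.U t)]
  rw [conj_apply]
  refine (norm_mul_le _ _).trans ?_
  rw [norm_star]
  refine (mul_le_of_le_one_right (norm_nonneg _) h1).trans ((norm_mul_le _ _).trans ?_)
  exact mul_le_of_le_one_left (norm_nonneg _) h1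

/-- As U t commutes with Ψ b, it passes through the monomial and cancels against its adjoint,
leaving only the phases of the two words. -/
theorem conj_monomial (t : ℝ) (u v : List ℕ) (b : B) :
    P.conj t (P.word u * P.Ψ b * star (P.word v))
      = ((Circle.exp (wordSum P.x u * t) : ℂ) * star (Circle.exp (wordSum P.x v * t) : ℂ)) •
        (P.word u * P.Ψ b * star (P.word v)) := by
  have h1 : star (P.word v) * star (P.U t)
      = star (Circle.exp (wordSum P.x v * t) : ℂ) • (star (P.U t) * star (P.word v)) := by
    rw [← star_mul, P.U_mul_word, star_smul, star_mul]
  have h2 : P.word u * P.U t * P.Ψ b * (star (P.U t) * star (P.word v))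
      = P.word u * P.Ψ b * star (P.word v) := by
    rw [mul_assoc (P.word u), P.U_mul_map, ← mul_assoc, ← mul_assoc (P.word u),
      mul_assoc (P.word u * P.Ψ b), P.U_mul_star, mul_one]
  have h3 : P.conj t (P.word u * P.Ψ b * star (P.word v))
      = P.U t * P.word u * P.Ψ b * (star (P.word v) * star (P.U t)) := by
    simp only [conj_apply, mul_assoc]
  rw [h3, h1, P.U_mul_word, smul_mul_assoc, smul_mul_assoc, mul_smul_comm, smul_smul, h2]

variable {P} {C : NonUnitalStarSubalgebra ℂ (K →L[ℂ] K)} {I : Submodule ℂ (K →L[ℂ] K)}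

theorem U_mul_mem (hC : P.Generates C) (t : ℝ) {c : K →L[ℂ] K} (hc : c ∈ C) : P.U t * c ∈ C := by
  let p : Submodule ℂ (K →L[ℂ] K) := C.toSubmodule.comap (LinearMap.mulLeft ℂ (P.U t))
  have hp : IsClosed (p : Set (K →L[ℂ] K)) :=
    hC.isClosed.preimage (continuous_const_mul (P.U t))
  refine hC.induction (p := p) hp ?_ hc
  rintro _ ⟨u, v, b, rfl⟩
  change P.U t * (P.word u * P.Ψ b * star (P.word v)) ∈ C
  obtain ⟨b', hb'⟩ := P.U_map_mem t b
  rw [← mul_assoc, ← mul_assoc, P.U_mul_word, smul_mul_assoc, smul_mul_assoc,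
    mul_assoc (P.word u), hb']
  exact SMulMemClass.smul_mem _ (hC.mem ⟨u, v, b', rfl⟩)

theorem mul_star_U_mem (hC : P.Generates C) (t : ℝ) {c : K →L[ℂ] K} (hc : c ∈ C) :
    c * star (P.U t) ∈ C := by
  have := star_mem (U_mul_mem hC t (star_mem hc))
  rwa [star_mul, star_star] at this

/-- Since U t is only a multiplier of C, an approximate unit e of C is inserted: U t e lies in C and
U t e c converges to U t c; likewise on the right. -/
theorem conj_mem (hC : P.Generates C) (hI : IsIdealIn C I) (hIc : IsClosed (I : Set (K →L[ℂ] K)))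
    (t : ℝ) {c : K →L[ℂ] K} (hc : c ∈ I) : P.conj t c ∈ I := by
  have : Fact (IsClosed (C : Set (K →L[ℂ] K))) := ⟨hC.isClosed⟩
  have hcl : IsClosed (C : Set (K →L[ℂ] K)) := hC.isClosed
  let _ : NonUnitalCStarAlgebra C := NonUnitalStarSubalgebra.nonUnitalCStarAlgebra C
  have hu := contractiveUnit_isApproximateUnit C
  have hval : Continuous (Subtype.val : C → K →L[ℂ] K) := continuous_subtype_val
  have h1 : P.U t * c ∈ I := by
    have h := ((hval.tendsto _).comp (hu.tendsto_mul_right ⟨c, hI.le c hc⟩)).const_mul (P.U t)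
    refine hIc.mem_of_tendsto h (Eventually.of_forall fun e => ?_)
    change P.U t * (e.1 * c) ∈ I
    rw [← mul_assoc]
    exact hI.mul_left _ (U_mul_mem hC t e.2) _ hc
  have h := ((hval.tendsto _).comp (hu.tendsto_mul_left ⟨_, hI.le _ h1⟩)).mul_const (star (P.U t))
  refine hIc.mem_of_tendsto h (Eventually.of_forall fun e => ?_)
  change P.U t * c * e.1 * star (P.U t) ∈ I
  rw [mul_assoc]
  exact hI.mul_right _ (mul_star_U_mem hC t e.2) _ h1

variable (P)

/-- The filter of those times at which the flow is close to the gauge action of `z`. -/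
noncomputable def gaugeFilter (z : Circle) : Filter ℝ :=
  comap (fun t : ℝ => fun n => Circle.exp (P.x n * t)) (𝓝 fun _ : ℕ => z)

/-- This is exactly the hypothesis that the constant sequence z lies in the closure of the
one-parameter subgroup. -/
instance (z : Circle) : (P.gaugeFilter z).NeBot := by
  rw [gaugeFilter, comap_neBot_iff]
  intro s hs
  obtain ⟨_, hy, t, rfl⟩ := mem_closure_iff_nhds.1 (P.const_mem z) s hs
  exact ⟨t, hy⟩

theorem tendsto_exp_gaugeFilter (z : Circle) (n : ℕ) :
    Tendsto (fun t => Circle.exp (P.x n * t)) (P.gaugeFilter z) (𝓝 z) :=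
  (tendsto_pi_nhds.1 (tendsto_comap (f := fun t : ℝ => fun n => Circle.exp (P.x n * t))
    (x := 𝓝 fun _ : ℕ => z))) n

theorem tendsto_wordSum_gaugeFilter (z : Circle) (w : List ℕ) :
    Tendsto (fun t => Circle.exp (wordSum P.x w * t)) (P.gaugeFilter z) (𝓝 (z ^ w.length)) := by
  induction w with
  | nil => simp [wordSum]
  | cons i w ih =>
    have h := (P.tendsto_exp_gaugeFilter z i).mul ih
    rw [← pow_succ'] at h
    refine h.congr fun t => ?_
    rw [← Circle.exp_add, wordSum, wordSum, List.map_cons, List.sum_cons, add_mul]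

/-- At z = 1 the time t = 0 is available, which identifies the value of a gauge orbit at θ = 0 with
the original element. -/
theorem pure_le_gaugeFilter : pure 0 ≤ P.gaugeFilter 1 := by
  rw [gaugeFilter, ← map_le_iff_le_comap, map_pure]
  have : (fun n => Circle.exp (P.x n * 0)) = fun _ => 1 := by simp
  rw [this]
  exact pure_le_nhds _

/-- `f` is the orbit of `c` under the gauge action, and its average lies in the closed core. -/
structure IsGaugeOrbit (c : K →L[ℂ] K) (f : ℝ → K →L[ℂ] K) : Prop where
  continuous : Continuous f
  tendsto : ∀ θ, Tendsto (fun t => P.conj t c) (P.gaugeFilter (Circle.exp θ)) (𝓝 (f θ))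
  integral_mem : ∫ θ in (0 : ℝ)..2 * Real.pi, f θ ∈ P.coreClosure

theorem integral_exp_int_mul {k : ℤ} (hk : k ≠ 0) :
    ∫ θ in (0 : ℝ)..2 * Real.pi, Complex.exp (k * Complex.I * θ) = 0 := by
  rw [integral_exp_mul_complex (by simp [hk, Complex.I_ne_zero])]
  have : Complex.exp (k * Complex.I * ((2 * Real.pi : ℝ) : ℂ)) = 1 := by
    rw [← Complex.exp_int_mul_two_pi_mul_I k]
    congr 1
    push_cast
    ring
  rw [this]
  simp

/-- Along the gauge filter at z the phases of u and v tend to z^|u| and z^|v|. If |u| ≠ |v| the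
average over the circle vanishes; if |u| = |v| the monomial is already in the core. -/
theorem isGaugeOrbit_monomial (u v : List ℕ) (b : B) :
    P.IsGaugeOrbit (P.word u * P.Ψ b * star (P.word v)) fun θ =>
      Complex.exp (((u.length : ℤ) - v.length : ℤ) * Complex.I * θ) •
        (P.word u * P.Ψ b * star (P.word v)) where
  continuous := by fun_prop
  tendsto θ := by
    simp only [P.conj_monomial]
    refine Tendsto.smul_const ?_ _
    have hc : Continuous ((↑) : Circle → ℂ) := continuous_subtype_val
    have h := ((hc.tendsto _).comp (P.tendsto_wordSum_gaugeFilter (Circle.exp θ) u)).mul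
      ((hc.tendsto _).comp (P.tendsto_wordSum_gaugeFilter (Circle.exp θ) v)).star
    suffices hz : Complex.exp (((u.length : ℤ) - v.length : ℤ) * Complex.I * θ)
        = ((Circle.exp θ ^ u.length : Circle) : ℂ)
          * star ((Circle.exp θ ^ v.length : Circle) : ℂ) by
      rw [hz]
      exact h
    rw [Circle.coe_pow, Circle.coe_pow, star_pow, RCLike.star_def, ← Circle.coe_inv_eq_conj,
      ← Circle.exp_neg, Circle.coe_exp, Circle.coe_exp, ← Complex.exp_nat_mul,
      ← Complex.exp_nat_mul, ← Complex.exp_add]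
    congr 1
    push_cast
    ring
  integral_mem := by
    rw [intervalIntegral.integral_smul_const]
    by_cases h : u.length = v.length
    · obtain ⟨N, hN⟩ := P.monomial_mem_core b u v h
      exact Submodule.smul_mem _ _ (P.mem_coreClosure_of_mem hN)
    · rw [integral_exp_int_mul (by omega), zero_smul]
      exact zero_mem _

variable {P}

theorem IsGaugeOrbit.add {c d : K →L[ℂ] K} {f g : ℝ → K →L[ℂ] K} (hf : P.IsGaugeOrbit c f)
    (hg : P.IsGaugeOrbit d g) : P.IsGaugeOrbit (c + d) (fun θ => f θ + g θ) where
  continuous := hf.continuous.add hg.continuous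
  tendsto θ := by
    simp only [map_add]
    exact (hf.tendsto θ).add (hg.tendsto θ)
  integral_mem := by
    rw [intervalIntegral.integral_add (hf.continuous.intervalIntegrable _ _)
      (hg.continuous.intervalIntegrable _ _)]
    exact add_mem hf.integral_mem hg.integral_mem

theorem IsGaugeOrbit.smul {c : K →L[ℂ] K} {f : ℝ → K →L[ℂ] K} (hf : P.IsGaugeOrbit c f) (z : ℂ) :
    P.IsGaugeOrbit (z • c) (fun θ => z • f θ) where
  continuous := hf.continuous.const_smul z
  tendsto θ := by
    simp only [map_smul]
    exact (hf.tendsto θ).const_smul z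
  integral_mem := by
    rw [intervalIntegral.integral_smul]
    exact Submodule.smul_mem _ _ hf.integral_mem

theorem IsGaugeOrbit.norm_sub_le {c d : K →L[ℂ] K} {f : ℝ → K →L[ℂ] K} (hf : P.IsGaugeOrbit c f)
    {θ : ℝ} {y : K →L[ℂ] K}
    (hd : Tendsto (fun t => P.conj t d) (P.gaugeFilter (Circle.exp θ)) (𝓝 y)) :
    ‖y - f θ‖ ≤ ‖d - c‖ := by
  refine le_of_tendsto (hd.sub (hf.tendsto θ)).norm (Eventually.of_forall fun t => ?_)
  rw [← map_sub]
  exact P.norm_conj_le t _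

/-- Conjugation is contractive uniformly in t, so approximation of c gives approximation of its
orbit uniformly in θ. Limits along the filters, continuity and membership of the average in the
closed core all survive. -/
theorem exists_isGaugeOrbit_of_approx {c : K →L[ℂ] K}
    (h : ∀ ε > 0, ∃ d f, ‖c - d‖ < ε ∧ P.IsGaugeOrbit d f) : ∃ f, P.IsGaugeOrbit c f := by
  have hlim : ∀ θ, ∃ y, Tendsto (fun t => P.conj t c) (P.gaugeFilter (Circle.exp θ)) (𝓝 y) := by
    intro θ
    refine cauchy_map_iff_exists_tendsto.1 (Metric.cauchy_iff.2 ⟨inferInstance, fun ε hε => ?_⟩)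
    obtain ⟨d, f, hcd, hf⟩ := h (ε / 4) (by positivity)
    refine ⟨Metric.ball (f θ) (ε / 2), ?_, ?_⟩
    · refine mem_map.2 ?_
      filter_upwards [Metric.tendsto_nhds.1 (hf.tendsto θ) (ε / 4) (by positivity)] with t ht
      rw [Set.mem_preimage, Metric.mem_ball]
      refine (dist_triangle _ (P.conj t d) _).trans_lt ?_
      have : dist (P.conj t c) (P.conj t d) < ε / 4 := by
        rw [dist_eq_norm, ← map_sub]
        exact (P.norm_conj_le t _).trans_lt hcd
      linarith
    · intro y hy z hz
      rw [Metric.mem_ball] at hy hz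
      refine (dist_triangle_right _ _ (f θ)).trans_lt ?_
      linarith
  choose g hg using hlim
  have happrox : ∀ ε > 0, ∃ d f, ‖c - d‖ < ε ∧ P.IsGaugeOrbit d f ∧ ∀ θ, ‖g θ - f θ‖ < ε := by
    intro ε hε
    obtain ⟨d, f, hcd, hf⟩ := h ε hε
    exact ⟨d, f, hcd, hf, fun θ => (hf.norm_sub_le (hg θ)).trans_lt hcd⟩
  have hcont : Continuous g := by
    refine continuous_of_uniform_approx_of_continuous fun u hu => ?_
    obtain ⟨ε, hε, hu⟩ := Metric.mem_uniformity_dist.1 hu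
    obtain ⟨d, f, -, hf, hgf⟩ := happrox ε hε
    exact ⟨f, hf.continuous, fun θ => hu (by rw [dist_eq_norm]; exact hgf θ)⟩
  refine ⟨g, hcont, hg, P.isClosed_coreClosure.closure_subset_iff.2 le_rfl
    (Metric.mem_closure_iff.2 fun ε hε => ?_)⟩
  have hpi := Real.two_pi_pos
  -- The interval of integration has length 2π, so this tolerance makes the integrals differ by at
  -- most ε/2.
  obtain ⟨d, f, -, hf, hgf⟩ := happrox (ε / (2 * (2 * Real.pi))) (by positivity)
  refine ⟨_, hf.integral_mem, ?_⟩
  rw [dist_eq_norm, ← intervalIntegral.integral_sub (hcont.intervalIntegrable _ _)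
    (hf.continuous.intervalIntegrable _ _)]
  refine (intervalIntegral.norm_integral_le_of_norm_le_const fun θ _ => (hgf θ).le).trans_lt ?_
  rw [sub_zero, abs_of_pos hpi]
  field_simp
  linarith

theorem exists_isGaugeOrbit (hC : P.Generates C) {c : K →L[ℂ] K} (hc : c ∈ C) :
    ∃ f, P.IsGaugeOrbit c f := by
  have hspan : ∀ d ∈ Submodule.span ℂ P.monomials, ∃ f, P.IsGaugeOrbit d f := by
    intro d hd
    induction hd using Submodule.span_induction with
    | mem y hy =>
      obtain ⟨u, v, b, rfl⟩ := hy
      exact ⟨_, P.isGaugeOrbit_monomial u v b⟩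
    | zero => exact ⟨_, by simpa using (P.isGaugeOrbit_monomial [] [] 0)⟩
    | add y z _ _ hy hz =>
      obtain ⟨f, hf⟩ := hy
      obtain ⟨g, hg⟩ := hz
      exact ⟨_, hf.add hg⟩
    | smul z y _ hy =>
      obtain ⟨f, hf⟩ := hy
      exact ⟨_, hf.smul z⟩
  refine exists_isGaugeOrbit_of_approx fun ε hε => ?_
  have hc : c ∈ (C : Set (K →L[ℂ] K)) := hc
  rw [CuntzSystem.Generates] at hC
  rw [hC] at hc
  obtain ⟨d, hd, hcd⟩ := Metric.mem_closure_iff.1 hc ε hε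
  obtain ⟨f, hf⟩ := hspan d hd
  exact ⟨d, f, by rwa [← dist_eq_norm], hf⟩

/-- Averages of a function stay in a closed convex set, and the integral is the average times the
length of the interval. -/
theorem integral_mem_of_isClosed {E : Type*} [NormedAddCommGroup E] [NormedSpace ℂ E]
    [CompleteSpace E] {I : Submodule ℂ E} (hI : IsClosed (I : Set E)) {f : ℝ → E}
    (hf : Continuous f) (h : ∀ θ, f θ ∈ I) {a b : ℝ} (hab : a < b) :
    ∫ θ in a..b, f θ ∈ I := by
  rw [intervalIntegral.integral_of_le hab.le]
  have hconv : Convex ℝ (I : Set E) := (I.restrictScalars ℝ).convex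
  have h1 : ⨍ θ in Set.Ioc a b, f θ ∈ (I : Set E) :=
    hconv.set_average_mem hI (by simp [hab]) (by simp) (Eventually.of_forall h)
      (hf.integrableOn_Ioc)
  rw [setAverage_eq] at h1
  have h2 := I.smul_mem ((volume.real (Set.Ioc a b) : ℝ) : ℂ) h1
  rw [Complex.coe_smul, smul_smul, mul_inv_cancel₀, one_smul] at h2
  · exact h2
  · simp [hab.le]
    linarith

/-- A nonzero closed ideal of the algebra generated by a `PhaseSystem` contains a nonzero element
of `Ψ B`. -/
theorem exists_map_mem (hC : P.Generates C) (hI : IsIdealIn C I)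
    (hIc : IsClosed (I : Set (K →L[ℂ] K))) (hI0 : I ≠ ⊥) : ∃ b, b ≠ 0 ∧ P.Ψ b ∈ I := by
  obtain ⟨c, hc, hc0⟩ := (Submodule.ne_bot_iff I).1 hI0
  obtain ⟨h, hh⟩ : ∃ h, c h ≠ 0 := by
    by_contra! hcon
    exact hc0 (ContinuousLinearMap.ext hcon)
  have hd : star c * c ∈ I := hI.mul_left _ (star_mem (hI.le _ hc)) _ hc
  obtain ⟨f, hf⟩ := exists_isGaugeOrbit hC (hI.le _ hd)
  have hfI : ∀ θ, f θ ∈ I := fun θ =>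
    hIc.mem_of_tendsto (hf.tendsto θ) (Eventually.of_forall fun t => conj_mem hC hI hIc t hd)
  have hf0 : f 0 = star c * c := by
    have h1 : Tendsto (fun t => P.conj t (star c * c)) (pure 0) (𝓝 (f 0)) :=
      (hf.tendsto 0).mono_left (by rw [Circle.exp_zero]; exact P.pure_le_gaugeFilter)
    refine tendsto_nhds_unique h1 ?_
    rw [tendsto_pure_left]
    intro s hs
    have : P.conj 0 (star c * c) = star c * c := by rw [conj_apply, P.U_zero]; simp
    rw [this]
    exact mem_of_mem_nhds hs
  -- The vector functional at h is positive, hence nonnegative on every conjugate of c⋆c and on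
  -- their limits, while at θ = 0 it equals ‖c h‖² > 0. By continuity its integral over the circle
  -- is strictly positive, so the averaged element is nonzero.
  let ev : (K →L[ℂ] K) →L[ℂ] ℂ := (innerSL ℂ h).comp (ContinuousLinearMap.apply ℂ K h)
  have hev : ∀ y, ev y = inner ℂ h (y h) := fun y => rfl
  have hnonneg : ∀ θ, 0 ≤ (ev (f θ)).re := by
    intro θ
    refine ge_of_tendsto ((Complex.continuous_re.comp ev.continuous).tendsto _ |>.comp
      (hf.tendsto θ)) (Eventually.of_forall fun t => ?_)
    have h1 : P.conj t (star c * c) = star (c * star (P.U t)) * (c * star (P.U t)) := by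
      rw [conj_apply, star_mul, star_star]
      simp only [mul_assoc]
    change 0 ≤ (inner ℂ h ((P.conj t (star c * c)) h)).re
    rw [h1, mul_apply_eq_comp, ContinuousLinearMap.star_eq_adjoint,
      ContinuousLinearMap.adjoint_inner_right]
    exact inner_self_nonneg (𝕜 := ℂ)
  have hpos : 0 < (ev (f 0)).re := by
    rw [hf0, hev, mul_apply_eq_comp, ContinuousLinearMap.star_eq_adjoint,
      ContinuousLinearMap.adjoint_inner_right]
    have h1 : (inner ℂ (c h) (c h)).re = ‖c h‖ ^ 2 := inner_self_eq_norm_sq (𝕜 := ℂ) (c h)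
    rw [h1]
    positivity
  have hint : (ev (∫ θ in (0 : ℝ)..2 * Real.pi, f θ)).re
      = ∫ θ in (0 : ℝ)..2 * Real.pi, (ev (f θ)).re := by
    rw [← ev.intervalIntegral_comp_comm (hf.continuous.intervalIntegrable _ _)]
    exact (Complex.reCLM.intervalIntegral_comp_comm
      ((ev.continuous.comp hf.continuous).intervalIntegrable _ _)).symm
  have hne : ∫ θ in (0 : ℝ)..2 * Real.pi, f θ ≠ 0 := by
    intro h0
    rw [h0, map_zero] at hint
    have := intervalIntegral.integral_pos (f := fun θ => (ev (f θ)).re) Real.two_pi_pos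
      (by have := hf.continuous; fun_prop) (fun θ _ => hnonneg θ)
      ⟨0, ⟨le_rfl, Real.two_pi_pos.le⟩, hpos⟩
    rw [← hint] at this
    simp at this
  exact P.exists_map_mem_of_mem_closure_core hC.isClosed (fun n b => hC.mem (P.S_mul_map_mem n b))
    hC.core_le hI hIc (integral_mem_of_isClosed hIc hf.continuous hfI Real.two_pi_pos) hne
    (P.mem_coreClosure.1 hf.integral_mem)

/-- A closed ideal that contains `Ψ B` is everything. -/
theorem mem_of_map_mem (hC : P.Generates C) (hI : IsIdealIn C I)
    (hIc : IsClosed (I : Set (K →L[ℂ] K))) (h : ∀ b, P.Ψ b ∈ I) {c : K →L[ℂ] K} (hc : c ∈ C) :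
    c ∈ I := by
  refine hC.induction hIc (fun y hy => ?_) hc
  exact hIc.mem_of_tendsto (P.leftEssential_monomial hy) (Eventually.of_forall fun e =>
    hI.mul_right _ (hC.mem hy) _ (h e))

/-- If `B` has no nontrivial closed ideals that are invariant under the endomorphisms `σ n`, then
the algebra generated by the system has no nontrivial closed ideals. -/
theorem isSimpleCStar [Nontrivial B] (hC : P.Generates C)
    (hB : ∀ J : Submodule ℂ B, IsClosed (J : Set B) → (∀ b, ∀ j ∈ J, b * j ∈ J) →
      (∀ b, ∀ j ∈ J, j * b ∈ J) → (∀ n, ∀ j ∈ J, P.σ n j ∈ J) → J ≠ ⊥ → J = ⊤) :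
    IsSimpleCStar C := by
  have hcl := hC.isClosed
  let _ : NonUnitalCStarAlgebra C := NonUnitalStarSubalgebra.nonUnitalCStarAlgebra C
  refine ⟨?_, fun I hI => ?_⟩
  · obtain ⟨b, hb⟩ := exists_ne (0 : B)
    refine ⟨⟨P.Ψ b, hC.mem (P.map_mem_monomials b)⟩, 0, fun h => hb (P.injective ?_)⟩
    rw [map_zero]
    exact congrArg Subtype.val h
  rw [or_iff_not_imp_left]
  intro hI0
  -- The ideal is moved into the ambient operator algebra, where conjugation by U t makes sense.
  let J : Submodule ℂ (K →L[ℂ] K) :=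
    { carrier := Subtype.val '' (I : Set C)
      add_mem' := by
        rintro _ _ ⟨y, hy, rfl⟩ ⟨z, hz, rfl⟩
        exact ⟨y + z, I.add_mem hy hz, rfl⟩
      zero_mem' := ⟨0, I.zero_mem, rfl⟩
      smul_mem' := by
        rintro r _ ⟨y, hy, rfl⟩
        exact ⟨r • y, smul_mem_of_isClosed hI r hy, rfl⟩ }
  have hJ : ∀ c : C, (c : K →L[ℂ] K) ∈ J → c ∈ I := by
    rintro c ⟨y, hy, hyc⟩
    rwa [← Subtype.ext hyc]
  have hJc : IsClosed (J : Set (K →L[ℂ] K)) := hcl.isClosedEmbedding_subtypeVal.isClosedMap _ hI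
  have hJI : IsIdealIn C J :=
    { le := by rintro _ ⟨y, -, rfl⟩; exact y.2
      mul_left := by
        rintro c hc _ ⟨y, hy, rfl⟩
        exact ⟨⟨c, hc⟩ * y, I.mul_mem_left _ _ hy, rfl⟩
      mul_right := by
        rintro c hc _ ⟨y, hy, rfl⟩
        exact ⟨y * ⟨c, hc⟩, I.mul_mem_right _ _ hy, rfl⟩ }
  have hJ0 : J ≠ ⊥ := by
    intro h
    refine hI0 (le_antisymm (fun c hc => ?_) bot_le)
    have : (c : K →L[ℂ] K) ∈ J := ⟨c, hc, rfl⟩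
    rw [h, Submodule.mem_bot] at this
    rw [TwoSidedIdeal.mem_bot]
    exact Subtype.ext this
  obtain ⟨b, hb0, hb⟩ := exists_map_mem hC hJI hJc hJ0
  have hS : ∀ n b, P.S n * P.Ψ b ∈ C := fun n b => hC.mem (P.S_mul_map_mem n b)
  have hΨ : ∀ b, P.Ψ b ∈ C := fun b => hC.mem (P.map_mem_monomials b)
  let L : Submodule ℂ B := J.comap (P.Ψ : B →ₗ[ℂ] (K →L[ℂ] K))
  have hL : L = ⊤ := by
    refine hB L (hJc.preimage (continuous_starHom P.Ψ)) (fun b j hj => ?_) (fun b j hj => ?_)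
      (fun n j hj => P.map_σ_mem hS hJI hJc hj n) ?_
    · change P.Ψ (b * j) ∈ J
      rw [map_mul]
      exact hJI.mul_left _ (hΨ b) _ hj
    · change P.Ψ (j * b) ∈ J
      rw [map_mul]
      exact hJI.mul_right _ (hΨ b) _ hj
    · rw [Submodule.ne_bot_iff]
      exact ⟨b, hb, hb0⟩
  refine le_antisymm le_top fun c _ => hJ c (mem_of_map_mem hC hJI hJc (fun b => ?_) c.2)
  have : b ∈ L := by rw [hL]; trivial
  exact this

end PhaseSystem

end QuasiFree

namespace QuasiFree

open scoped ZeroAtInfty CompactlySupported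

/-! ### Hat functions on the line -/

section Hat

/-- The hat function with peak `1` at `p` and support in `[p - δ, p + δ]`. -/
noncomputable def hat (p δ t : ℝ) : ℝ := max 0 (1 - |(t - p) / δ|)

theorem continuous_hat (p δ : ℝ) : Continuous (hat p δ) := by unfold hat; fun_prop

theorem hat_nonneg (p δ t : ℝ) : 0 ≤ hat p δ t := le_max_left _ _

theorem hat_eq_zero {p δ t : ℝ} (hδ : 0 < δ) (h : δ ≤ |t - p|) : hat p δ t = 0 := by
  refine max_eq_left ?_
  rw [abs_div, abs_of_pos hδ, sub_nonpos, le_div_iff₀ hδ, one_mul]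
  exact h

theorem abs_hat_sub_hat_le {δ : ℝ} (hδ : 0 < δ) (p q t : ℝ) :
    |hat p δ t - hat q δ t| ≤ |p - q| / δ := by
  unfold hat
  refine (abs_max_sub_max_le_max _ _ _ _).trans ?_
  rw [sub_self, abs_zero, max_le_iff]
  refine ⟨by positivity, ?_⟩
  rw [sub_sub_sub_cancel_left]
  refine (abs_abs_sub_abs_le _ _).trans ?_
  rw [← sub_div, abs_div, abs_of_pos hδ, sub_sub_sub_cancel_left]

theorem hasCompactSupport_hat (p : ℝ) {δ : ℝ} (hδ : 0 < δ) : HasCompactSupport (hat p δ) := by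
  refine HasCompactSupport.intro (isCompact_Icc (a := p - δ) (b := p + δ)) fun t ht => ?_
  refine hat_eq_zero hδ ?_
  by_contra! h
  rw [abs_lt] at h
  exact ht ⟨by linarith, by linarith⟩

/-- The tent is a clipped ramp minus its unit translate, so that sums of neighbouring tents
telescope in `hatSum_eq`. -/
theorem max_zero_one_sub_abs (u : ℝ) :
    max 0 (1 - |u|) = max 0 (min 1 (u + 1)) - max 0 (min 1 u) := by
  rcases le_total 0 u with h | h
  · rw [abs_of_nonneg h, min_eq_left (by linarith), max_eq_right zero_le_one,
      max_eq_right (le_min zero_le_one h)]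
    rcases le_total 1 u with h' | h'
    · rw [min_eq_left h', max_eq_left (by linarith)]; ring
    · rw [min_eq_right h', max_eq_right (by linarith)]
  · rw [abs_of_nonpos h, min_eq_right (by linarith : u ≤ 1), max_eq_left h,
      min_eq_right (by linarith)]
    ring_nf

/-- The sum of the hat functions of width `δ` with peaks at `(k - N) δ` for `k ≤ 2 N`. -/
noncomputable def hatSum (N : ℕ) (δ t : ℝ) : ℝ :=
  ∑ k ∈ Finset.range (2 * N + 1), hat (((k : ℝ) - N) * δ) δ t

theorem hatSum_eq (N : ℕ) {δ : ℝ} (hδ : 0 < δ) (t : ℝ) :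
    hatSum N δ t = max 0 (min 1 (t / δ + N + 1)) - max 0 (min 1 (t / δ - N)) := by
  have h : ∀ k ∈ Finset.range (2 * N + 1), hat (((k : ℝ) - N) * δ) δ t
      = max 0 (min 1 (t / δ + N + 1 - (k : ℕ))) - max 0 (min 1 (t / δ + N + 1 - (k + 1 : ℕ))) := by
    intro k _
    rw [hat, max_zero_one_sub_abs]
    have : (t - ((k : ℝ) - N) * δ) / δ = t / δ + N - k := by field_simp; ring
    rw [this]
    push_cast
    ring_nf
  rw [hatSum, Finset.sum_congr rfl h,
    Finset.sum_range_sub' (fun k : ℕ => max 0 (min 1 (t / δ + N + 1 - (k : ℝ))))]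
  push_cast
  ring_nf

theorem hatSum_nonneg (N : ℕ) (δ t : ℝ) : 0 ≤ hatSum N δ t :=
  Finset.sum_nonneg fun _ _ => hat_nonneg _ _ _

theorem hatSum_le_one (N : ℕ) {δ : ℝ} (hδ : 0 < δ) (t : ℝ) : hatSum N δ t ≤ 1 := by
  rw [hatSum_eq N hδ]
  have h1 : max 0 (min 1 (t / δ + N + 1)) ≤ 1 := max_le zero_le_one (min_le_left _ _)
  have h2 : 0 ≤ max 0 (min 1 (t / δ - N)) := le_max_left _ _
  linarith

theorem hatSum_eq_one (N : ℕ) {δ : ℝ} (hδ : 0 < δ) {t : ℝ} (ht : |t| ≤ N * δ) :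
    hatSum N δ t = 1 := by
  rw [abs_le] at ht
  have h1 : t / δ ≤ N := by rw [div_le_iff₀ hδ]; exact ht.2
  have h2 : -(N : ℝ) ≤ t / δ := by rw [le_div_iff₀ hδ]; linarith
  rw [hatSum_eq N hδ, min_eq_left (by linarith), max_eq_right zero_le_one,
    min_eq_right (by linarith), max_eq_left (by linarith), sub_zero]

/-- Uniform approximation of a function vanishing at infinity by interpolation with hat
functions. -/
theorem exists_norm_sub_sum_hat_le {E : Type*} [NormedAddCommGroup E] [NormedSpace ℝ E]
    {f : ℝ → E} (hf : UniformContinuous f) (hf0 : Tendsto f (cocompact ℝ) (𝓝 0)) {ε : ℝ}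
    (hε : 0 < ε) : ∃ (N : ℕ) (δ : ℝ), 0 < δ ∧ δ ≤ 1 ∧ ∀ t, ‖f t -
      ∑ k ∈ Finset.range (2 * N + 1), hat (((k : ℝ) - N) * δ) δ t • f (((k : ℝ) - N) * δ)‖ ≤ ε := by
  obtain ⟨δ₀, hδ₀, hδf⟩ := Metric.uniformContinuous_iff.1 hf (ε / 2) (by positivity)
  -- The bound δ ≤ 1 later keeps the interpolation of a compactly supported function within distance
  -- one of a ball containing its support.
  set δ := min δ₀ 1 with hδdef
  have hδ : 0 < δ := by positivity
  have hev : ∀ᶠ t in cocompact ℝ, ‖f t‖ < ε / 2 := by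
    have := Metric.tendsto_nhds.1 hf0 (ε / 2) (by positivity)
    simpa [dist_zero_right] using this
  obtain ⟨K, hK, hKf⟩ := mem_cocompact.1 hev
  obtain ⟨R, hR⟩ := hK.isBounded.subset_closedBall 0
  obtain ⟨N, hN⟩ := exists_nat_ge (R / δ)
  rw [div_le_iff₀ hδ] at hN
  refine ⟨N, δ, hδ, min_le_right _ _, fun t => ?_⟩
  -- The hats sum to 1 on [−Nδ, Nδ]. The first term is nonzero only outside, where f is small; the
  -- second is controlled by uniform continuity, as a hat sees only points within δ of its node.
  have h1 : f t - ∑ k ∈ Finset.range (2 * N + 1),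
      hat (((k : ℝ) - N) * δ) δ t • f (((k : ℝ) - N) * δ)
      = (1 - hatSum N δ t) • f t + ∑ k ∈ Finset.range (2 * N + 1),
        hat (((k : ℝ) - N) * δ) δ t • (f t - f (((k : ℝ) - N) * δ)) := by
    simp only [smul_sub, Finset.sum_sub_distrib, ← Finset.sum_smul, sub_smul, one_smul, hatSum]
    abel
  have h2 : ‖(1 - hatSum N δ t) • f t‖ ≤ ε / 2 := by
    by_cases ht : |t| ≤ N * δ
    · rw [hatSum_eq_one N hδ ht]; simp; positivity
    · have h3 : ‖f t‖ < ε / 2 := by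
        refine hKf fun htK => ht ?_
        have := hR htK
        rw [Metric.mem_closedBall, dist_zero_right, Real.norm_eq_abs] at this
        linarith
      rw [norm_smul, Real.norm_eq_abs, abs_of_nonneg (by linarith [hatSum_le_one N hδ t])]
      nlinarith [hatSum_nonneg N δ t, norm_nonneg (f t)]
  have h3 : ‖∑ k ∈ Finset.range (2 * N + 1),
      hat (((k : ℝ) - N) * δ) δ t • (f t - f (((k : ℝ) - N) * δ))‖ ≤ ε / 2 := by
    calc _ ≤ ∑ k ∈ Finset.range (2 * N + 1), hat (((k : ℝ) - N) * δ) δ t * (ε / 2) := by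
          refine norm_sum_le_of_le _ fun k _ => ?_
          rw [norm_smul, Real.norm_eq_abs, abs_of_nonneg (hat_nonneg _ _ _)]
          by_cases hk : |t - ((k : ℝ) - N) * δ| < δ
          · refine mul_le_mul_of_nonneg_left ?_ (hat_nonneg _ _ _)
            have := hδf (a := t) (b := ((k : ℝ) - N) * δ) (by
              rw [Real.dist_eq]; exact hk.trans_le (min_le_left _ _))
            rw [dist_eq_norm] at this
            exact this.le
          · rw [hat_eq_zero hδ (not_lt.1 hk)]; simp
      _ = hatSum N δ t * (ε / 2) := by rw [hatSum, Finset.sum_mul]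
      _ ≤ 1 * (ε / 2) := by gcongr; exact hatSum_le_one N hδ t
      _ = ε / 2 := one_mul _
  rw [h1]
  refine (norm_add_le _ _).trans ?_
  linarith

/-- The hat function as a compactly supported complex function. -/
noncomputable def hatC (p : ℝ) {δ : ℝ} (hδ : 0 < δ) : C_c(ℝ, ℂ) where
  toFun t := (hat p δ t : ℂ)
  continuous_toFun := Complex.continuous_ofReal.comp (continuous_hat p δ)
  hasCompactSupport' := (hasCompactSupport_hat p hδ).comp_left (g := ((↑) : ℝ → ℂ)) (by simp)

@[simp] theorem hatC_apply (p : ℝ) {δ : ℝ} (hδ : 0 < δ) (t : ℝ) : hatC p hδ t = (hat p δ t : ℂ) :=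
  rfl

end Hat

/-! ### Continuous functions on the line with values in a C⋆-algebra -/

section FunctionAlgebra

variable {A : Type u} [NonUnitalCStarAlgebra A]

theorem norm_apply_le (g : C₀(ℝ, A)) (s : ℝ) : ‖g s‖ ≤ ‖g‖ := by
  rw [← ZeroAtInftyContinuousMap.norm_toBCF_eq_norm]
  exact g.toBCF.norm_coe_le_norm s

theorem norm_le_of_forall {g : C₀(ℝ, A)} {r : ℝ} (hr : 0 ≤ r) (h : ∀ s, ‖g s‖ ≤ r) : ‖g‖ ≤ r := by
  rw [← ZeroAtInftyContinuousMap.norm_toBCF_eq_norm]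
  exact (BoundedContinuousFunction.norm_le hr).2 h

/-- Pointwise multiplication by a scalar function. -/
noncomputable def pmul (f : C₀(ℝ, ℂ)) : C₀(ℝ, A) →L[ℂ] C₀(ℝ, A) :=
  LinearMap.mkContinuous
    { toFun := fun g =>
        { toFun := fun s => f s • g s
          continuous_toFun := f.continuous.smul g.continuous
          zero_at_infty' := by simpa using f.zero_at_infty'.smul g.zero_at_infty' }
      map_add' := fun g h => by ext s; exact smul_add _ _ _
      map_smul' := fun z g => by ext s; exact smul_comm _ _ _ }
    ‖f‖ fun g => norm_le_of_forall (by positivity) fun s => by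
      refine (norm_smul_le _ _).trans ?_
      exact mul_le_mul (norm_apply_le f s) (norm_apply_le g s) (norm_nonneg _) (norm_nonneg _)

@[simp] theorem pmul_apply (f : C₀(ℝ, ℂ)) (g : C₀(ℝ, A)) (s : ℝ) : pmul f g s = f s • g s := rfl

/-- The elementary tensor `f ⊗ a`, that is the function `s ↦ f s • a`. -/
noncomputable def tmul (f : C₀(ℝ, ℂ)) (a : A) : C₀(ℝ, A) where
  toFun s := f s • a
  continuous_toFun := f.continuous.smul continuous_const
  zero_at_infty' := by simpa using f.zero_at_infty'.smul_const a

@[simp] theorem tmul_apply (f : C₀(ℝ, ℂ)) (a : A) (s : ℝ) : tmul f a s = f s • a := rfl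

theorem tmul_add (f : C₀(ℝ, ℂ)) (a b : A) : tmul f (a + b) = tmul f a + tmul f b := by
  ext s; simp

theorem tmul_sub (f : C₀(ℝ, ℂ)) (a b : A) : tmul f (a - b) = tmul f a - tmul f b := by
  ext s; simp [smul_sub]

theorem tmul_neg (f : C₀(ℝ, ℂ)) (a : A) : tmul f (-a) = -tmul f a := by
  ext s; simp

theorem tmul_zero (f : C₀(ℝ, ℂ)) : tmul f (0 : A) = 0 := by ext s; simp

theorem sub_tmul (f g : C₀(ℝ, ℂ)) (a : A) : tmul (f - g) a = tmul f a - tmul g a := by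
  ext s; simp [sub_smul]

theorem tmul_mul_tmul (f g : C₀(ℝ, ℂ)) (a b : A) : tmul f a * tmul g b = tmul (f * g) (a * b) := by
  ext s; simp [smul_mul_smul_comm]

theorem norm_tmul_le (f : C₀(ℝ, ℂ)) (a : A) : ‖tmul f a‖ ≤ ‖f‖ * ‖a‖ :=
  norm_le_of_forall (by positivity) fun s => by
    refine (norm_smul_le _ _).trans ?_
    gcongr
    exact norm_apply_le f s

theorem continuous_tmul_right (f : C₀(ℝ, ℂ)) : Continuous (tmul f : A → C₀(ℝ, A)) := by
  refine (LipschitzWith.of_dist_le_mul (K := ‖f‖₊) fun a b => ?_).continuous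
  rw [dist_eq_norm, dist_eq_norm, ← tmul_sub]
  exact norm_tmul_le _ _

theorem continuous_tmul_left (a : A) : Continuous (fun f => tmul f a) := by
  refine (LipschitzWith.of_dist_le_mul (K := ‖a‖₊) fun f g => ?_).continuous
  rw [dist_eq_norm, dist_eq_norm, ← sub_tmul, mul_comm]
  exact norm_tmul_le _ _

/-- Compactly supported functions as functions that vanish at infinity. -/
def ofCc {E : Type*} [Zero E] [TopologicalSpace E] (φ : C_c(ℝ, E)) : C₀(ℝ, E) where
  toFun := φ
  continuous_toFun := φ.continuous
  zero_at_infty' := φ.hasCompactSupport.is_zero_at_infty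

@[simp] theorem ofCc_apply {E : Type*} [Zero E] [TopologicalSpace E] (φ : C_c(ℝ, E)) (s : ℝ) :
    ofCc φ s = φ s := rfl

/-- The span of the elementary tensors with compactly supported first factor is dense. -/
theorem mem_of_tmul_mem {p : Submodule ℂ C₀(ℝ, A)} (hp : IsClosed (p : Set C₀(ℝ, A)))
    (h : ∀ (φ : C_c(ℝ, ℂ)) (a : A), tmul (ofCc φ) a ∈ p) (g : C₀(ℝ, A)) : g ∈ p := by
  refine hp.closure_subset_iff.2 le_rfl (Metric.mem_closure_iff.2 fun ε hε => ?_)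
  obtain ⟨N, δ, hδ, -, hN⟩ := exists_norm_sub_sum_hat_le
    (ZeroAtInftyContinuousMap.uniformContinuous g) g.zero_at_infty' (half_pos hε)
  refine ⟨∑ k ∈ Finset.range (2 * N + 1), tmul (ofCc (hatC (((k : ℝ) - N) * δ) hδ))
    (g (((k : ℝ) - N) * δ)), sum_mem fun k _ => h _ _, ?_⟩
  rw [dist_eq_norm]
  refine (norm_le_of_forall (half_pos hε).le fun s => ?_).trans_lt (half_lt_self hε)
  have hsum : ∀ (F : Finset ℕ) (u : ℕ → C₀(ℝ, A)), (∑ k ∈ F, u k) s = ∑ k ∈ F, u k s := by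
    intro F u
    induction F using Finset.cons_induction with
    | empty => simp
    | cons i F hi ih => rw [Finset.sum_cons, Finset.sum_cons, ← ih]; rfl
  rw [ZeroAtInftyContinuousMap.sub_apply, hsum]
  refine le_trans (le_of_eq ?_) (hN s)
  congr 2

/-- The Fourier transform of a compactly supported continuous function. -/
noncomputable def fourierCc (φ : C_c(ℝ, ℂ)) : C₀(ℝ, ℂ) where
  toFun := FourierTransform.fourier (φ : ℝ → ℂ)
  continuous_toFun := by
    have h : Integrable (φ : ℝ → ℂ) :=
      φ.continuous.integrable_of_hasCompactSupport φ.hasCompactSupport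
    exact VectorFourier.fourierIntegral_continuous Real.continuous_fourierChar
      (by exact continuous_inner (𝕜 := ℝ) (E := ℝ)) h
  zero_at_infty' := Real.zero_at_infty_fourier _

theorem fourierCc_apply (φ : C_c(ℝ, ℂ)) (s : ℝ) :
    fourierCc φ s = FourierTransform.fourier (φ : ℝ → ℂ) s := rfl

/-- Smooth φ to a compactly supported h, which is the Fourier transform of a Schwartz function G,
and approximate G in L¹ by a compactly supported continuous ψ. The Fourier transform is contractive
from L¹ to the sup norm. -/
theorem exists_norm_sub_fourierCc_lt (φ : C_c(ℝ, ℂ)) {ε : ℝ} (hε : 0 < ε) :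
    ∃ ψ : C_c(ℝ, ℂ), ‖ofCc φ - fourierCc ψ‖ < ε := by
  obtain ⟨h, hsm, hh, hsupp⟩ := φ.continuous.exists_contDiff_approx (ε := fun _ => ε / 4)
    (⊤ : ℕ∞) continuous_const (fun _ => by positivity)
  have hcs : HasCompactSupport h := φ.hasCompactSupport.mono hsupp
  let H : SchwartzMap ℝ ℂ := hcs.toSchwartzMap hsm
  let G : SchwartzMap ℝ ℂ := FourierTransformInv.fourierInv H
  have hG : FourierTransform.fourier G = H := FourierTransform.fourier_fourierInv_eq H
  have hGi : Integrable (G : ℝ → ℂ) := G.integrable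
  obtain ⟨ψ, hψs, hψ, hψc, hψi⟩ := hGi.exists_hasCompactSupport_integral_sub_le
    (by positivity : 0 < ε / 4)
  refine ⟨⟨⟨ψ, hψc⟩, hψs⟩, (norm_le_of_forall (half_pos hε).le fun s => ?_).trans_lt
    (half_lt_self hε)⟩
  have h1 : FourierTransform.fourier (G : ℝ → ℂ) s = h s := by
    rw [← SchwartzMap.fourier_coe, hG]
    rfl
  have h2 : ‖FourierTransform.fourier (G : ℝ → ℂ) s - FourierTransform.fourier ψ s‖ ≤ ε / 4 := by
    rw [Real.fourier_real_eq, Real.fourier_real_eq, ← integral_sub]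
    · refine (norm_integral_le_integral_norm _).trans (le_trans (le_of_eq ?_) hψ)
      refine integral_congr_ae (Eventually.of_forall fun t => ?_)
      simp only [← smul_sub, Circle.norm_smul]
    · simpa [mul_comm] using (Real.fourierIntegral_convergent_iff (V := ℝ) s).2 hGi
    · simpa [mul_comm] using (Real.fourierIntegral_convergent_iff (V := ℝ) s).2 hψi
  have h3 : dist (h s) (φ s) < ε / 4 := hh s
  rw [dist_eq_norm] at h3
  change ‖φ s - FourierTransform.fourier ψ s‖ ≤ ε / 2
  have h4 : φ s - FourierTransform.fourier ψ s
      = -(h s - φ s) + (FourierTransform.fourier (G : ℝ → ℂ) s - FourierTransform.fourier ψ s) := by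
    rw [h1]; ring
  rw [h4]
  refine (norm_add_le _ _).trans ?_
  rw [norm_neg]
  linarith

/-- The span of the elementary tensors whose first factor is the Fourier transform of a compactly
supported function is dense. -/
theorem mem_of_tmul_fourierCc_mem {p : Submodule ℂ C₀(ℝ, A)} (hp : IsClosed (p : Set C₀(ℝ, A)))
    (h : ∀ (φ : C_c(ℝ, ℂ)) (a : A), tmul (fourierCc φ) a ∈ p) (g : C₀(ℝ, A)) : g ∈ p := by
  refine mem_of_tmul_mem hp (fun φ a => ?_) g
  have hcl : IsClosed {f : C₀(ℝ, ℂ) | tmul f a ∈ p} := hp.preimage (continuous_tmul_left a)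
  refine hcl.closure_subset_iff.2 le_rfl (Metric.mem_closure_iff.2 fun ε hε => ?_)
  obtain ⟨ψ, hψ⟩ := exists_norm_sub_fourierCc_lt φ hε
  exact ⟨fourierCc ψ, h ψ a, by rwa [dist_eq_norm]⟩

/-- The endomorphism `(τ g)(s) = r (g (s - y))` of `C₀(ℝ, A)`. -/
noncomputable def twistHom (r : A →⋆ₙₐ[ℂ] A) (y : ℝ) : C₀(ℝ, A) →⋆ₙₐ[ℂ] C₀(ℝ, A) where
  toFun g :=
    { toFun := fun s => r (g (s - y))
      continuous_toFun := (continuous_starHom r).comp (g.continuous.comp (by fun_prop))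
      zero_at_infty' := by
        have h := (Homeomorph.subRight y).isClosedEmbedding.tendsto_cocompact
        have h2 := ((continuous_starHom r).tendsto 0).comp (g.zero_at_infty'.comp h)
        rwa [map_zero] at h2 }
  map_smul' z g := by ext s; exact map_smul r z _
  map_zero' := by ext s; exact map_zero r
  map_add' g h := by ext s; exact map_add r _ _
  map_mul' g h := by ext s; exact map_mul r _ _
  map_star' g := by ext s; exact map_star r _

@[simp] theorem twistHom_apply (r : A →⋆ₙₐ[ℂ] A) (y : ℝ) (g : C₀(ℝ, A)) (s : ℝ) :
    twistHom r y g s = r (g (s - y)) := rfl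

theorem twistHom_tmul_hatC (r : A →⋆ₙₐ[ℂ] A) (y p : ℝ) {δ : ℝ} (hδ : 0 < δ) (a : A) :
    twistHom r y (tmul (ofCc (hatC p hδ)) a) = tmul (ofCc (hatC (p + y) hδ)) (r a) := by
  ext s
  simp only [twistHom_apply, tmul_apply, ofCc_apply, hatC_apply, map_smul, hat]
  rw [sub_sub, add_comm y p]

/-- On elementary tensors, φ ⊗ a is approximated by fφ ⊗ r(e)a with f and e from approximate units.
This product is τ(f(· + y) ⊗ e) times φ ⊗ a, hence left essential. -/
theorem essential_twistHom {r : A →⋆ₙₐ[ℂ] A} (hr : Essential r) (y : ℝ) :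
    Essential (twistHom r y) := by
  let p : Submodule ℂ C₀(ℝ, A) :=
    { carrier := {g | LeftEssential (twistHom r y) g}
      add_mem' := fun h h' => LeftEssential.add h h'
      zero_mem' := by
        change LeftEssential _ _
        simpa using leftEssential_map (twistHom r y) 0
      smul_mem' := fun z g h => by
        have : LeftEssential (twistHom r y) g := h
        change Tendsto _ _ _
        simp only [mul_smul_comm]
        exact this.const_smul z }
  have hp : IsClosed (p : Set C₀(ℝ, A)) := isClosed_leftEssential _
  refine fun g => mem_of_tmul_mem hp (fun φ a => ?_) g
  have ha : a ∈ closure {b | tmul (ofCc φ) b ∈ p} := by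
    refine mem_closure_of_tendsto (hr a) (Eventually.of_forall fun e => ?_)
    have hf : ofCc φ ∈ closure {f | tmul f (r e * a) ∈ p} := by
      refine mem_closure_of_tendsto
        ((contractiveUnit_isApproximateUnit C₀(ℝ, ℂ)).tendsto_mul_right (ofCc φ))
        (Eventually.of_forall fun f => ?_)
      have : tmul (f * ofCc φ) (r e * a) = twistHom r y
          (tmul (twistHom (NonUnitalStarAlgHom.id ℂ ℂ) (-y) f) e) * tmul (ofCc φ) a := by
        rw [← tmul_mul_tmul]
        congr 1
        ext s
        simp
      change tmul (f * ofCc φ) (r e * a) ∈ p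
      rw [this]
      exact leftEssential_map_mul _ _ _
    exact (hp.preimage (continuous_tmul_left (r e * a))).closure_subset_iff.2 le_rfl hf
  exact (hp.preimage (continuous_tmul_right (ofCc φ))).closure_subset_iff.2 le_rfl ha

/-- The norm of g exceeds r at a single point s, and the twisted function takes the value ρ n (g s)
at s + y n. Thus the limsup condition for the one element g s suffices, whatever the shifts. -/
theorem exists_norm_lt_twistHom {ρ : ℕ → A →⋆ₙₐ[ℂ] A}
    (hnorm : ∀ a : A, limsup (fun n => ‖ρ n a‖) atTop = ‖a‖) (y : ℕ → ℝ) (g : C₀(ℝ, A)) (N : ℕ)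
    (r : ℝ) (hr : r < ‖g‖) : ∃ n ≥ N, r < ‖twistHom (ρ n) (y n) g‖ := by
  rcases lt_or_ge r 0 with h0 | h0
  · exact ⟨N, le_rfl, h0.trans_le (norm_nonneg _)⟩
  obtain ⟨s, hs⟩ : ∃ s, r < ‖g s‖ := by
    by_contra! h
    exact hr.not_ge (norm_le_of_forall h0 h)
  rw [← hnorm (g s)] at hs
  obtain ⟨n, hn, hrn⟩ := frequently_atTop.1 (frequently_lt_of_lt_limsup
    (isCoboundedUnder_le_of_le atTop (x := 0) fun n => norm_nonneg _) hs) N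
  refine ⟨n, hn, hrn.trans_le ?_⟩
  have := norm_apply_le (twistHom (ρ n) (y n) g) (s + y n)
  simpa using this

end FunctionAlgebra

end QuasiFree

namespace QuasiFree

open scoped ZeroAtInfty CompactlySupported

/-! ### Closed ideals of `C₀(ℝ, A)` -/

section FunctionIdeals

variable {A : Type u} [NonUnitalCStarAlgebra A]

/-- A closed ideal is invariant under continuous maps that commute with right multiplications. -/
theorem mem_of_map_mul_right {D : Type v} [NonUnitalCStarAlgebra D] {J : Submodule ℂ D}
    (hJ : IsClosed (J : Set D)) (hl : ∀ b, ∀ j ∈ J, b * j ∈ J) {L : D → D} (hL : Continuous L)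
    (h : ∀ b c, L (b * c) = L b * c) {j : D} (hj : j ∈ J) : L j ∈ J := by
  refine hJ.mem_of_tendsto ((hL.tendsto j).comp
    ((contractiveUnit_isApproximateUnit D).tendsto_mul_right j)) (Eventually.of_forall fun e => ?_)
  simp only [Function.comp_apply, h]
  exact hl _ _ hj

/-- A closed ideal is invariant under continuous maps that commute with left multiplications. -/
theorem mem_of_map_mul_left {D : Type v} [NonUnitalCStarAlgebra D] {J : Submodule ℂ D}
    (hJ : IsClosed (J : Set D)) (hr : ∀ b, ∀ j ∈ J, j * b ∈ J) {L : D → D} (hL : Continuous L)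
    (h : ∀ b c, L (b * c) = b * L c) {j : D} (hj : j ∈ J) : L j ∈ J := by
  refine hJ.mem_of_tendsto ((hL.tendsto j).comp
    ((contractiveUnit_isApproximateUnit D).tendsto_mul_left j)) (Eventually.of_forall fun e => ?_)
  simp only [Function.comp_apply, h]
  exact hr _ _ hj

/-- Left multiplication by a constant. -/
noncomputable def constMul (a : A) : C₀(ℝ, A) →L[ℂ] C₀(ℝ, A) :=
  LinearMap.mkContinuous
    { toFun := fun g =>
        { toFun := fun s => a * g s
          continuous_toFun := continuous_const.mul g.continuous
          zero_at_infty' := by simpa using g.zero_at_infty'.const_mul a }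
      map_add' := fun g h => by ext s; exact mul_add _ _ _
      map_smul' := fun z g => by ext s; exact mul_smul_comm _ _ _ }
    ‖a‖ fun g => norm_le_of_forall (by positivity) fun s => by
      refine (norm_mul_le _ _).trans ?_
      exact mul_le_mul_of_nonneg_left (norm_apply_le g s) (norm_nonneg _)

@[simp] theorem constMul_apply (a : A) (g : C₀(ℝ, A)) (s : ℝ) : constMul a g s = a * g s := rfl

/-- Right multiplication by a constant. -/
noncomputable def mulConst (a : A) : C₀(ℝ, A) →L[ℂ] C₀(ℝ, A) :=
  LinearMap.mkContinuous
    { toFun := fun g =>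
        { toFun := fun s => g s * a
          continuous_toFun := g.continuous.mul continuous_const
          zero_at_infty' := by simpa using g.zero_at_infty'.mul_const a }
      map_add' := fun g h => by ext s; exact add_mul _ _ _
      map_smul' := fun z g => by ext s; exact smul_mul_assoc _ _ _ }
    ‖a‖ fun g => norm_le_of_forall (by positivity) fun s => by
      refine (norm_mul_le _ _).trans ?_
      rw [mul_comm]
      exact mul_le_mul_of_nonneg_left (norm_apply_le g s) (norm_nonneg _)

@[simp] theorem mulConst_apply (a : A) (g : C₀(ℝ, A)) (s : ℝ) : mulConst a g s = g s * a := rfl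

variable {J : Submodule ℂ C₀(ℝ, A)}

theorem pmul_mem (hJ : IsClosed (J : Set C₀(ℝ, A))) (hl : ∀ b, ∀ j ∈ J, b * j ∈ J)
    (f : C₀(ℝ, ℂ)) {j : C₀(ℝ, A)} (hj : j ∈ J) : pmul f j ∈ J :=
  mem_of_map_mul_right hJ hl (pmul f).continuous
    (fun b c => by ext s; simp [smul_mul_assoc]) hj

theorem tmul_mul_left_mem (hJ : IsClosed (J : Set C₀(ℝ, A)))
    (hl : ∀ b, ∀ j ∈ J, b * j ∈ J) {f : C₀(ℝ, ℂ)} {a : A} (b : A) (h : tmul f a ∈ J) :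
    tmul f (b * a) ∈ J := by
  have := mem_of_map_mul_right hJ hl (constMul b).continuous
    (fun b c => by ext s; simp [mul_assoc]) h
  convert this using 1
  ext s
  simp [mul_smul_comm]

theorem tmul_mul_right_mem (hJ : IsClosed (J : Set C₀(ℝ, A))) (hr : ∀ b, ∀ j ∈ J, j * b ∈ J)
    {f : C₀(ℝ, ℂ)} {a : A} (b : A) (h : tmul f a ∈ J) : tmul f (a * b) ∈ J := by
  have := mem_of_map_mul_left hJ hr (mulConst b).continuous
    (fun b c => by ext s; simp [mul_assoc]) h
  convert this using 1
  ext s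
  simp [smul_mul_assoc]

/-- A nonzero closed ideal of `C₀(ℝ, A)` contains a nonzero elementary tensor. -/
theorem exists_tmul_hatC_mem (hJ : IsClosed (J : Set C₀(ℝ, A))) (hl : ∀ b, ∀ j ∈ J, b * j ∈ J)
    (hr : ∀ b, ∀ j ∈ J, j * b ∈ J) (hJ0 : J ≠ ⊥) :
    ∃ (p δ : ℝ) (hδ : 0 < δ) (a : A), a ≠ 0 ∧ tmul (ofCc (hatC p hδ)) a ∈ J := by
  obtain ⟨g, hg, hg0⟩ := (Submodule.ne_bot_iff J).1 hJ0
  obtain ⟨p, hp⟩ : ∃ p, g p ≠ 0 := by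
    by_contra! h
    exact hg0 (ZeroAtInftyContinuousMap.ext h)
  set b := star g * g with hb
  have hbJ : b ∈ J := hl _ _ hg
  set a := b p with ha
  have hasa : IsSelfAdjoint a := by
    rw [ha, hb]
    exact IsSelfAdjoint.star_mul_self (g p)
  have hapos : 0 < ‖a‖ := by
    have : ‖a‖ = ‖g p‖ * ‖g p‖ := CStarRing.norm_star_mul_self (x := g p)
    rw [this]
    have := norm_pos_iff.2 hp
    positivity
  -- The threshold level 2ε = ‖a‖/2 lies below ‖a‖, so the soft threshold of a is nonzero.
  set ε := ‖a‖ / 4 with hε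
  have hεpos : 0 < ε := by positivity
  obtain ⟨δ, hδ, hδb⟩ := Metric.continuous_iff.1 b.continuous p ε hεpos
  -- `f = 1` on the ball of radius `δ / 2` and `f = 0` outside of the ball of radius `δ`
  have hδ2 : 0 < δ / 2 := by positivity
  let F : ℝ → ℝ := fun s => min 1 (2 * hat p δ s)
  have hF1 : ∀ s, |s - p| ≤ δ / 2 → F s = 1 := by
    intro s hs
    refine min_eq_left ?_
    have : |(s - p) / δ| ≤ 1 / 2 := by
      rw [abs_div, abs_of_pos hδ, div_le_iff₀ hδ]
      linarith
    have h2 : 1 - |(s - p) / δ| ≤ hat p δ s := le_max_right _ _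
    linarith
  have hF0 : ∀ s, δ ≤ |s - p| → F s = 0 := fun s hs => by
    simp [F, hat_eq_zero hδ hs]
  have hFle : ∀ s, |F s| ≤ 1 := fun s => by
    rw [abs_of_nonneg (le_min zero_le_one (by linarith [hat_nonneg p δ s]))]
    exact min_le_left _ _
  let φ : C_c(ℝ, ℂ) :=
    { toFun := fun s => (F s : ℂ)
      continuous_toFun := by
        have := continuous_hat p δ
        fun_prop
      hasCompactSupport' := (hasCompactSupport_hat p hδ).comp_left
        (g := fun t : ℝ => ((min 1 (2 * t) : ℝ) : ℂ)) (by simp) }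
  have hφ : ∀ s, ofCc φ s = (F s : ℂ) := fun s => rfl
  set c := tmul (ofCc φ) a with hc
  have hcsa : IsSelfAdjoint c := by
    refine ZeroAtInftyContinuousMap.ext fun s => ?_
    rw [ZeroAtInftyContinuousMap.star_apply, hc, tmul_apply, star_smul, hφ, hasa.star_eq]
    simp
  -- On the support of F the function b is within ε of its value a at p, so F ⊗ a is within ε of F
  -- b, an element of J.
  have hci : ‖c - pmul (ofCc φ) b‖ ≤ ε := by
    refine norm_le_of_forall hεpos.le fun s => ?_
    rw [ZeroAtInftyContinuousMap.sub_apply, hc, tmul_apply, pmul_apply, ← smul_sub, hφ, norm_smul,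
      Complex.norm_real, Real.norm_eq_abs]
    by_cases hs : |s - p| < δ
    · have h1 := hδb s (by rwa [Real.dist_eq])
      rw [dist_comm, dist_eq_norm] at h1
      calc _ ≤ 1 * ‖a - b s‖ := by gcongr; exact hFle s
        _ ≤ ε := by rw [one_mul]; exact h1.le
    · rw [hF0 s (not_lt.1 hs)]
      simp [hεpos.le]
  have hI : IsIdealIn (⊤ : NonUnitalStarSubalgebra ℂ C₀(ℝ, A)) J :=
    ⟨fun _ _ => trivial, fun b _ j hj => hl b j hj, fun b _ j hj => hr b j hj⟩
  have hk := cfcₙ_softThreshold_mem (C := ⊤) isClosed_univ hI hJ trivial hcsa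
    (pmul_mem hJ hl (ofCc φ) hbJ) hεpos hci
  -- Evaluation commutes with the functional calculus, so on the plateau of F the threshold of F ⊗ a
  -- is the constant threshold of a. A hat supported in the plateau cuts out an elementary tensor.
  have hk' := pmul_mem hJ hl (ofCc (hatC p hδ2)) hk
  refine ⟨p, δ / 2, hδ2, cfcₙ (softThreshold (2 * ε)) a, fun h0 => ?_, ?_⟩
  · have := norm_sub_cfcₙ_softThreshold_le (δ := 2 * ε) (by positivity) hasa
    rw [h0, sub_zero] at this
    linarith
  convert hk' using 1
  ext s
  rw [tmul_apply, pmul_apply, ofCc_apply, hatC_apply]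
  by_cases hs : |s - p| < δ / 2
  · congr 1
    let ev : C₀(ℝ, A) →⋆ₙₐ[ℂ] A :=
      { toFun := fun g => g s
        map_smul' := fun _ _ => rfl
        map_zero' := rfl
        map_add' := fun _ _ => rfl
        map_mul' := fun _ _ => rfl
        map_star' := fun _ => rfl }
    have hev : ev c = a := by
      change c s = a
      rw [hc, tmul_apply, hφ, hF1 s hs.le]
      simp
    have := NonUnitalStarAlgHomClass.map_cfcₙ ev (softThreshold (2 * ε)) c
      (continuous_softThreshold _).continuousOn (softThreshold_zero (by positivity))
      (continuous_starHom ev) hcsa (by rw [hev]; exact hasa)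
    rw [hev] at this
    exact this.symm
  · rw [hat_eq_zero hδ2 (not_lt.1 hs)]
    simp

/-- The ideal of all `a` with `f ⊗ a ∈ J` for every `f` in a given set. -/
def sliceIdeal (hJ : IsClosed (J : Set C₀(ℝ, A))) (hl : ∀ b, ∀ j ∈ J, b * j ∈ J)
    (hr : ∀ b, ∀ j ∈ J, j * b ∈ J) (F : Set C₀(ℝ, ℂ)) : TwoSidedIdeal A :=
  TwoSidedIdeal.mk' {a | ∀ f ∈ F, tmul f a ∈ J}
    (fun f _ => by rw [tmul_zero]; exact zero_mem J)
    (fun ha hb f hf => by rw [tmul_add]; exact add_mem (ha f hf) (hb f hf))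
    (fun ha f hf => by rw [tmul_neg]; exact neg_mem (ha f hf))
    (fun ha f hf => tmul_mul_left_mem hJ hl _ (ha f hf))
    (fun ha f hf => tmul_mul_right_mem hJ hr _ (ha f hf))

section

variable (hJ : IsClosed (J : Set C₀(ℝ, A))) (hl : ∀ b, ∀ j ∈ J, b * j ∈ J)
  (hr : ∀ b, ∀ j ∈ J, j * b ∈ J)

theorem mem_sliceIdeal {F : Set C₀(ℝ, ℂ)} {a : A} :
    a ∈ sliceIdeal hJ hl hr F ↔ ∀ f ∈ F, tmul f a ∈ J := by
  rw [sliceIdeal, TwoSidedIdeal.mem_mk']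
  rfl

theorem isClosed_sliceIdeal (F : Set C₀(ℝ, ℂ)) : IsClosed (sliceIdeal hJ hl hr F : Set A) := by
  rw [sliceIdeal, TwoSidedIdeal.coe_mk']
  have : {a : A | ∀ f ∈ F, tmul f a ∈ J} = ⋂ f ∈ F, {a | tmul f a ∈ J} := by ext; simp
  rw [this]
  exact isClosed_biInter fun f _ => hJ.preimage (continuous_tmul_right f)

theorem closedIdealSpan_subset {S : Set A} {I : TwoSidedIdeal A} (hI : IsClosed (I : Set A))
    (hS : S ⊆ I) : closedIdealSpan S ⊆ I :=
  hI.closure_subset_iff.2 (TwoSidedIdeal.span_le.2 hS)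

end

/-- If all translates of a hat function tensored with `a` lie in `J`, then so does every
elementary tensor `f ⊗ a`. -/
theorem tmul_mem_of_forall_hatC (hJ : IsClosed (J : Set C₀(ℝ, A)))
    (hl : ∀ b, ∀ j ∈ J, b * j ∈ J) {δ : ℝ} (hδ : 0 < δ) {a : A}
    (h : ∀ p, tmul (ofCc (hatC p hδ)) a ∈ J) (f : C₀(ℝ, ℂ)) : tmul f a ∈ J := by
  have hcl : IsClosed {f : C₀(ℝ, ℂ) | tmul f a ∈ J} := hJ.preimage (continuous_tmul_left a)
  refine hcl.closure_subset_iff.2 le_rfl (Metric.mem_closure_iff.2 fun ε hε => ?_)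
  have hev : ∀ᶠ t in cocompact ℝ, ‖f t‖ < ε / 2 := by
    have := Metric.tendsto_nhds.1 f.zero_at_infty' (ε / 2) (by positivity)
    filter_upwards [this] with t ht
    rwa [dist_zero_right] at ht
  obtain ⟨K, hK, hKf⟩ := mem_cocompact.1 hev
  obtain ⟨R, hR⟩ := hK.isBounded.subset_closedBall 0
  obtain ⟨N, hN⟩ := exists_nat_ge (R / δ)
  rw [div_le_iff₀ hδ] at hN
  -- The product of f with a partition of unity on [−Nδ, Nδ] made of translates of the given hat.
  let q : C₀(ℝ, ℂ) := ∑ k ∈ Finset.range (2 * N + 1), f * ofCc (hatC (((k : ℝ) - N) * δ) hδ)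
  have hq : ∀ s, q s = f s * (hatSum N δ s : ℂ) := by
    intro s
    have hsum : ∀ (F : Finset ℕ) (u : ℕ → C₀(ℝ, ℂ)), (∑ k ∈ F, u k) s = ∑ k ∈ F, u k s := by
      intro F u
      induction F using Finset.cons_induction with
      | empty => simp
      | cons i F hi ih => rw [Finset.sum_cons, Finset.sum_cons, ← ih]; rfl
    rw [hsum, hatSum]
    push_cast
    rw [Finset.mul_sum]
    rfl
  have hqJ : tmul q a ∈ J := by
    have : tmul q a = ∑ k ∈ Finset.range (2 * N + 1),
        pmul f (tmul (ofCc (hatC (((k : ℝ) - N) * δ) hδ)) a) := by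
      have hmap : ∀ F : Finset ℕ, tmul (∑ k ∈ F, f * ofCc (hatC (((k : ℝ) - N) * δ) hδ)) a
          = ∑ k ∈ F, pmul f (tmul (ofCc (hatC (((k : ℝ) - N) * δ) hδ)) a) := by
        intro F
        induction F using Finset.cons_induction with
        | empty => ext s; simp
        | cons i F hi ih =>
          rw [Finset.sum_cons, Finset.sum_cons, ← ih]
          ext s
          simp [add_smul, mul_smul]
      exact hmap _
    rw [this]
    exact sum_mem fun k _ => pmul_mem hJ hl f (h _)
  refine ⟨q, hqJ, ?_⟩
  rw [dist_eq_norm]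
  refine (norm_le_of_forall (half_pos hε).le fun s => ?_).trans_lt (half_lt_self hε)
  have h1 : (f - q) s = f s * ((1 - hatSum N δ s : ℝ) : ℂ) := by
    rw [ZeroAtInftyContinuousMap.sub_apply, hq]
    push_cast
    ring
  rw [h1, norm_mul, Complex.norm_real, Real.norm_eq_abs,
    abs_of_nonneg (by linarith [hatSum_le_one N hδ s])]
  by_cases ht : |s| ≤ N * δ
  · rw [hatSum_eq_one N hδ ht]; simp; positivity
  · have h3 : ‖f s‖ < ε / 2 := by
      refine hKf fun htK => ht ?_
      have := hR htK
      rw [Metric.mem_closedBall, dist_zero_right, Real.norm_eq_abs] at this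
      linarith
    nlinarith [hatSum_nonneg N δ s, norm_nonneg (f s)]

theorem continuous_ofCc_hatC {δ : ℝ} (hδ : 0 < δ) : Continuous fun p => ofCc (hatC p hδ) := by
  refine (LipschitzWith.of_dist_le_mul (K := ⟨1 / δ, by positivity⟩) fun p q => ?_).continuous
  rw [dist_eq_norm, Real.dist_eq]
  refine norm_le_of_forall (mul_nonneg (NNReal.coe_nonneg _) (abs_nonneg _)) fun s => ?_
  rw [ZeroAtInftyContinuousMap.sub_apply, ofCc_apply, ofCc_apply, hatC_apply, hatC_apply,
    ← Complex.ofReal_sub, Complex.norm_real, Real.norm_eq_abs]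
  refine (abs_hat_sub_hat_le hδ p q s).trans (le_of_eq ?_)
  change _ = 1 / δ * |p - q|
  ring

/-- Under the minimality and density conditions, the algebra `C₀(ℝ, A)` has no nontrivial closed
ideals that are invariant under the twisted endomorphisms. -/
theorem eq_top_of_twistHom_invariant (hJ : IsClosed (J : Set C₀(ℝ, A)))
    (hl : ∀ b, ∀ j ∈ J, b * j ∈ J) (hr : ∀ b, ∀ j ∈ J, j * b ∈ J) {ρ : ℕ → A →⋆ₙₐ[ℂ] A} {x : ℕ → ℝ}
    (hmin : ∀ I : TwoSidedIdeal A, IsClosed (I : Set A) →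
      (∀ n, ∀ a ∈ I, ρ n a ∈ I) → I = ⊥ ∨ I = ⊤)
    (hdense : ∀ I : TwoSidedIdeal A, IsClosed (I : Set A) → I ≠ ⊥ →
      ∃ J : TwoSidedIdeal A, IsClosed (J : Set A) ∧ J ≠ ⊥ ∧
        Dense {y : ℝ | ∃ w : List ℕ, wordSum x w = y ∧
          (J : Set A) ⊆ closedIdealSpan (wordHom ρ w '' (I : Set A))})
    {κ : ℝ} (hκ : κ ≠ 0) (hinv : ∀ n, ∀ j ∈ J, twistHom (ρ n) (κ * x n) j ∈ J) (hJ0 : J ≠ ⊥) :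
    J = ⊤ := by
  obtain ⟨p, δ, hδ, a, ha0, ha⟩ := exists_tmul_hatC_mem hJ hl hr hJ0
  -- Applying the twisted endomorphisms along w moves the peak by κ x_w and replaces a by ρ_w(a),
  -- leaving the width unchanged.
  have hword : ∀ w : List ℕ, ∀ p a, tmul (ofCc (hatC p hδ)) a ∈ J →
      tmul (ofCc (hatC (p + κ * wordSum x w) hδ)) (wordHom ρ w a) ∈ J := by
    intro w
    induction w with
    | nil => intro p a h; simpa [wordSum, wordHom] using h
    | cons i w ih =>
      intro p a h
      have h1 := hinv i _ h
      rw [twistHom_tmul_hatC] at h1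
      have h2 := ih _ _ h1
      rw [add_assoc, ← mul_add] at h2
      simpa [wordSum, wordHom] using h2
  let I := sliceIdeal hJ hl hr {ofCc (hatC p hδ)}
  have haI : a ∈ I := (mem_sliceIdeal hJ hl hr).2 (by rintro f rfl; exact ha)
  have hI0 : I ≠ ⊥ := fun h => ha0 (by rwa [h, TwoSidedIdeal.mem_bot] at haI)
  obtain ⟨J₀, -, hJ₀0, hJ₀d⟩ := hdense I (isClosed_sliceIdeal hJ hl hr _) hI0
  let L := sliceIdeal hJ hl hr Set.univ
  have hJ₀L : ∀ b ∈ J₀, b ∈ L := by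
    intro b hb
    refine (mem_sliceIdeal hJ hl hr).2 fun f _ => tmul_mem_of_forall_hatC hJ hl hδ (fun q => ?_) f
    have hcont : Continuous fun y : ℝ => tmul (ofCc (hatC (p + κ * y) hδ)) b :=
      (continuous_tmul_left b).comp ((continuous_ofCc_hatC hδ).comp (by fun_prop))
    have hcl : IsClosed {y : ℝ | tmul (ofCc (hatC (p + κ * y) hδ)) b ∈ J} := hJ.preimage hcont
    -- For y = x_w with J₀ in the ideal generated by ρ_w(I) this follows from `hword`. Such y are
    -- dense and the condition is closed in y because the hat depends continuously on its peak.
    have hall : ∀ y : ℝ, tmul (ofCc (hatC (p + κ * y) hδ)) b ∈ J := by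
      intro y
      refine hcl.closure_subset_iff.2 ?_ (hJ₀d y)
      rintro _ ⟨w, rfl, hw⟩
      have hsub : closedIdealSpan (wordHom ρ w '' (I : Set A))
          ⊆ sliceIdeal hJ hl hr {ofCc (hatC (p + κ * wordSum x w) hδ)} := by
        refine closedIdealSpan_subset (isClosed_sliceIdeal hJ hl hr _) ?_
        rintro _ ⟨c, hc, rfl⟩
        refine (mem_sliceIdeal hJ hl hr).2 ?_
        rintro f rfl
        exact hword w p c ((mem_sliceIdeal hJ hl hr).1 hc _ rfl)
      exact (mem_sliceIdeal hJ hl hr).1 (hsub (hw hb)) _ rfl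
    have := hall ((q - p) / κ)
    rwa [mul_div_cancel₀ _ hκ, add_sub_cancel] at this
  have hL0 : L ≠ ⊥ := by
    intro h
    refine hJ₀0 (le_antisymm (fun b hb => ?_) bot_le)
    rw [← h]
    exact hJ₀L b hb
  -- As L tests against all f, the shift in the twisted endomorphism is undone by translating f
  -- beforehand.
  have hLinv : ∀ n, ∀ a ∈ L, ρ n a ∈ L := by
    intro n a ha
    refine (mem_sliceIdeal hJ hl hr).2 fun f _ => ?_
    have h1 := hinv n _ ((mem_sliceIdeal hJ hl hr).1 ha
      (twistHom (NonUnitalStarAlgHom.id ℂ ℂ) (-(κ * x n)) f) trivial)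
    convert h1 using 1
    ext s
    simp
  rcases hmin L (isClosed_sliceIdeal hJ hl hr _) hLinv with h | h
  · exact absurd h hL0
  · refine le_antisymm le_top fun g _ => mem_of_tmul_mem hJ (fun φ b => ?_) g
    have hb : b ∈ L := by rw [h]; trivial
    exact (mem_sliceIdeal hJ hl hr).1 hb _ trivial

end FunctionIdeals

end QuasiFree

namespace QuasiFree

/-! ### Positive functionals and representations -/

section Functionals

theorem norm_one_le_one {B : Type u} [CStarAlgebra B] : ‖(1 : B)‖ ≤ 1 := by
  have h := CStarRing.norm_star_mul_self (x := (1 : B))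
  rw [star_one, one_mul] at h
  nlinarith [norm_nonneg (1 : B)]

/-- A functional on a unital C⋆-algebra of norm at most one with value one at the unit is
positive. -/
theorem nonneg_of_map_one {B : Type u} [CStarAlgebra B] (f : B →L[ℂ] ℂ) (hf : ‖f‖ ≤ 1)
    (h1 : f 1 = 1) (c : B) : 0 ≤ (f (star c * c)).re ∧ (f (star c * c)).im = 0 := by
  let _ := CStarAlgebra.spectralOrder B
  have _ := CStarAlgebra.spectralOrderedRing B
  set b := star c * c with hb
  have hbsa : IsSelfAdjoint b := IsSelfAdjoint.star_mul_self c
  have hb0 : 0 ≤ b := star_mul_self_nonneg c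
  have hle : ∀ y : B, ‖f y‖ ≤ ‖y‖ := fun y =>
    (f.le_opNorm y).trans (mul_le_of_le_one_left (norm_nonneg _) hf)
  have hfz : ∀ z : ℂ, f (z • 1) = z := fun z => by simp [h1]
  have hone : ‖(1 : B)‖ ≤ 1 := norm_one_le_one
  constructor
  -- From 0 ≤ b ≤ ‖b‖ the element ‖b‖ − b has norm at most ‖b‖, so ‖b‖ − Re f(b) ≤ ‖b‖.
  · have h2 : ‖(‖b‖ : ℂ) • (1 : B) - b‖ ≤ ‖b‖ := by
      have e : (‖b‖ : ℂ) • (1 : B) = algebraMap ℝ B ‖b‖ := by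
        rw [Algebra.algebraMap_eq_smul_one, Complex.coe_smul]
      have h3 : b ≤ (‖b‖ : ℂ) • (1 : B) := e ▸ hbsa.le_algebraMap_norm_self
      have h4 : ‖(‖b‖ : ℂ) • (1 : B) - b‖ ≤ ‖(‖b‖ : ℂ) • (1 : B)‖ :=
        CStarAlgebra.norm_le_norm_of_nonneg_of_le (sub_nonneg.2 h3) (sub_le_self _ hb0)
      refine h4.trans ?_
      rw [norm_smul, Complex.norm_real, norm_norm]
      exact mul_le_of_le_one_right (norm_nonneg _) hone
    have h5 := (hle _).trans h2
    rw [map_sub, hfz] at h5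
    have h6 := (Complex.abs_re_le_norm _).trans h5
    rw [Complex.sub_re, Complex.ofReal_re] at h6
    linarith [(abs_le.1 h6).2]
  -- Comparing |f(b + it)|² with ‖b + it‖² ≤ ‖b‖² + t² gives a bound that is affine in t on the
  -- left, which forces Im f(b) = 0.
  · have key : ∀ t : ℝ, (f b).im ^ 2 + 2 * t * (f b).im ≤ ‖b‖ ^ 2 := by
      intro t
      set y := b + (t * Complex.I : ℂ) • (1 : B) with hy
      have hyy : star y * y = b * b + ((t ^ 2 : ℝ) : ℂ) • (1 : B) := by
        rw [hy, star_add, hbsa.star_eq, star_smul, star_one, add_mul, mul_add, mul_add,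
          smul_mul_smul_comm, smul_mul_assoc, mul_smul_comm, one_mul, mul_one, mul_one,
          RCLike.star_def, map_mul, Complex.conj_I, Complex.conj_ofReal]
        have : (↑t * -Complex.I * (↑t * Complex.I) : ℂ) = ((t ^ 2 : ℝ) : ℂ) := by
          push_cast
          linear_combination (-(t : ℂ) ^ 2) * Complex.I_mul_I
        rw [this]
        simp only [mul_neg, neg_smul]
        abel
      have h2 : ‖y‖ ^ 2 ≤ ‖b‖ ^ 2 + t ^ 2 := by
        rw [sq, ← CStarRing.norm_star_mul_self, hyy]
        refine (norm_add_le _ _).trans (add_le_add ?_ ?_)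
        · rw [sq]; exact norm_mul_le _ _
        · rw [norm_smul, Complex.norm_real, Real.norm_of_nonneg (sq_nonneg t)]
          exact mul_le_of_le_one_right (sq_nonneg t) hone
      have h3 : ‖f y‖ ^ 2 ≤ ‖b‖ ^ 2 + t ^ 2 :=
        (pow_le_pow_left₀ (norm_nonneg _) (hle y) 2).trans h2
      rw [hy, map_add, hfz, Complex.sq_norm, Complex.normSq_apply] at h3
      simp only [Complex.add_re, Complex.add_im, Complex.mul_re, Complex.mul_im,
        Complex.ofReal_re, Complex.ofReal_im, Complex.I_re, Complex.I_im] at h3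
      nlinarith [sq_nonneg (f b).re]
    by_contra h
    have := key (‖b‖ ^ 2 / (f b).im)
    rw [mul_assoc, div_mul_cancel₀ _ h] at this
    have h7 : 0 < (f b).im ^ 2 := by positivity
    nlinarith [sq_nonneg ‖b‖]

/-- Every nonzero positive element is detected by some state-like functional. -/
theorem exists_functional {B : Type u} [CStarAlgebra B] {c : B} (hc : c ≠ 0) :
    ∃ f : B →L[ℂ] ℂ, ‖f‖ ≤ 1 ∧ f 1 = 1 ∧ f (star c * c) ≠ 0 := by
  let _ := CStarAlgebra.spectralOrder B
  have _ := CStarAlgebra.spectralOrderedRing B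
  have : Nontrivial B := ⟨⟨c, 0, hc⟩⟩
  set b := star c * c with hb
  have hb0 : 0 ≤ b := star_mul_self_nonneg c
  have hbn : 0 < ‖b‖ := by
    rw [hb, CStarRing.norm_star_mul_self]
    have := norm_pos_iff.2 hc
    positivity
  -- For b ≥ 0 the norms of 1 and b add up, so a functional norming 1 + b takes the value 1 at the
  -- unit and cannot vanish at b.
  have hn : 1 + ‖b‖ ≤ ‖1 + b‖ := by
    have h1 : ‖b‖ ∈ spectrum ℝ b := CStarAlgebra.norm_mem_spectrum_of_nonneg hb0
    have h2 : 1 + ‖b‖ ∈ spectrum ℝ (1 + b) := by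
      have h3 := (spectrum.add_mem_add_iff (a := b) (r := ‖b‖) (s := 1)).2 h1
      rwa [map_one, add_comm ‖b‖] at h3
    have h4 := spectrum.norm_le_norm_of_mem h2
    rwa [Real.norm_of_nonneg (by positivity)] at h4
  obtain ⟨f, hf, hfv⟩ := exists_dual_vector'' ℂ (1 + b)
  have hle : ∀ y : B, ‖f y‖ ≤ ‖y‖ := fun y =>
    (f.le_opNorm y).trans (mul_le_of_le_one_left (norm_nonneg _) hf)
  have h1 : (f 1).re + (f b).re = ‖1 + b‖ := by
    have := congrArg Complex.re hfv
    simpa using this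
  have h2 : (f 1).re ≤ 1 := (Complex.re_le_norm _).trans ((hle 1).trans norm_one_le_one)
  have h3 : (f b).re ≤ ‖b‖ := (Complex.re_le_norm _).trans (hle b)
  have h4 : (f 1).re = 1 := by linarith
  have h5 : ‖f 1‖ ≤ 1 := (hle 1).trans norm_one_le_one
  refine ⟨f, hf, ?_, fun h0 => ?_⟩
  · have h6 : ‖f 1‖ ^ 2 ≤ 1 := pow_le_one₀ (norm_nonneg _) h5
    rw [Complex.sq_norm, Complex.normSq_apply, h4] at h6
    refine Complex.ext (by simpa using h4) ?_
    simp only [Complex.one_im]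
    nlinarith
  · rw [h0] at h1
    simp only [Complex.zero_re] at h1
    linarith

/-- The representations of a C⋆-algebra on Hilbert spaces separate its points. -/
theorem exists_representation {A : Type u} [NonUnitalCStarAlgebra A] {a : A} (ha : a ≠ 0) :
    ∃ (H : Type u) (_ : NormedAddCommGroup H) (_ : InnerProductSpace ℂ H) (_ : CompleteSpace H)
      (r : A →⋆ₙₐ[ℂ] (H →L[ℂ] H)), r a ≠ 0 := by
  let _ := CStarAlgebra.spectralOrder A
  have _ := CStarAlgebra.spectralOrderedRing A
  have ha' : (Unitization.inr a : Unitization ℂ A) ≠ 0 := fun h =>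
    ha (Unitization.inr_injective (R := ℂ) (by simpa using h))
  obtain ⟨f, hf, hf1, hfa⟩ := exists_functional ha'
  open scoped ComplexOrder in
  let g : A →ₚ[ℂ] ℂ := PositiveLinearMap.mk₀
    (f.toLinearMap ∘ₗ (Unitization.inrHom ℂ ℂ A)) (by
      intro y hy
      obtain ⟨c, rfl⟩ := CStarAlgebra.nonneg_iff_eq_star_mul_self.1 hy
      have h := nonneg_of_map_one f hf hf1 (Unitization.inr c)
      rw [Complex.nonneg_iff]
      have e : (f.toLinearMap ∘ₗ (Unitization.inrHom ℂ ℂ A)) (star c * c)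
          = f (star (Unitization.inr c) * Unitization.inr c) := by
        simp [Unitization.inrHom]
      rw [e]
      exact ⟨h.1, h.2.symm⟩)
  have hg : ∀ y, g y = f (Unitization.inr y) := fun y => rfl
  refine ⟨g.GNS, inferInstance, inferInstance, inferInstance, g.gnsNonUnitalStarAlgHom,
    fun h0 => hfa ?_⟩
  -- If a acts as zero in the GNS representation, the vectors a b have norm zero; letting b run
  -- through an approximate unit yields g(a⋆a) = 0, against the choice of f.
  have h1 : ∀ b : A, g (star (a * b) * (a * b)) = 0 := by
    intro b
    have h2 := congrArg (fun T => T (g.toPreGNS b : g.GNS)) h0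
    simp only [PositiveLinearMap.gnsNonUnitalStarAlgHom_apply_coe] at h2
    have h3 : ‖g.leftMulMapPreGNS a (g.toPreGNS b)‖ = 0 := by
      rw [← UniformSpace.Completion.norm_coe (E := g.PreGNS), h2]
      simp
    have h4 := PositiveLinearMap.preGNS_norm_sq g (g.leftMulMapPreGNS a (g.toPreGNS b))
    rw [h3] at h4
    simpa using h4.symm
  have hlim : Tendsto (fun e => g (star (a * e) * (a * e))) (contractiveUnit A)
      (𝓝 (g (star a * a))) := by
    have h5 : Tendsto (fun e => a * e) (contractiveUnit A) (𝓝 a) :=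
      (contractiveUnit_isApproximateUnit A).tendsto_mul_left a
    have hgc : Continuous g := by
      have : (g : A → ℂ) = fun y => f (Unitization.inr y) := rfl
      rw [this]
      exact f.continuous.comp (Unitization.isometry_inr (𝕜 := ℂ) (A := A)).continuous
    exact (hgc.tendsto _).comp (h5.star.mul h5)
  have h6 : g (star a * a) = 0 := by
    refine tendsto_nhds_unique hlim ?_
    simp only [h1]
    exact tendsto_const_nhds
  rw [hg] at h6
  simpa using h6

end Functionals

/-! ### The Fock representation -/

section Fock

variable {H : Type u} [NormedAddCommGroup H] [InnerProductSpace ℂ H]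

/-- The operator `(T h) w = D w (h (j w))` on `ℓ²`, for an injection `j` and a bounded family `D`
of operators. -/
noncomputable def reindexOp {ι : Type} (j : ι → ι) (hj : Function.Injective j)
    (D : ι → H →L[ℂ] H) (C : ℝ) (hD : ∀ w, ‖D w‖ ≤ C) :
    lp (fun _ : ι => H) 2 →L[ℂ] lp (fun _ : ι => H) 2 :=
  have hb : ∀ (h : lp (fun _ : ι => H) 2) (w : ι),
      ‖D w (h (j w))‖ ^ 2 ≤ C ^ 2 * ‖h (j w)‖ ^ 2 := fun h w => by
    rw [← mul_pow]
    exact pow_le_pow_left₀ (norm_nonneg _) ((D w).le_of_opNorm_le (hD w) _) 2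
  have hs : ∀ h : lp (fun _ : ι => H) 2, Summable fun w => ‖h w‖ ^ 2 := fun h => by
    simpa using (lp.memℓp h).summable (by simp)
  LinearMap.mkContinuous
    { toFun := fun h => ⟨fun w => D w (h (j w)), memℓp_gen (by
        simpa using Summable.of_nonneg_of_le (fun w => by positivity) (hb h)
          (((hs h).comp_injective hj).mul_left (C ^ 2)))⟩
      map_add' := fun h k => by ext w; exact (D w).map_add _ _
      map_smul' := fun c h => by ext w; exact (D w).map_smul _ _ }
    |C| fun h => by
      rw [← sq_le_sq₀ (norm_nonneg _) (by positivity), mul_pow, sq_abs]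
      have e : ∀ k : lp (fun _ : ι => H) 2, ‖k‖ ^ 2 = ∑' w, ‖k w‖ ^ 2 := fun k => by
        simpa using lp.norm_rpow_eq_tsum (p := 2) (by simp) k
      rw [e, e h]
      calc _ ≤ ∑' w, C ^ 2 * ‖h (j w)‖ ^ 2 := by
            refine Summable.tsum_le_tsum (hb h) ?_ (((hs h).comp_injective hj).mul_left (C ^ 2))
            exact Summable.of_nonneg_of_le (fun w => by positivity) (hb h)
              (((hs h).comp_injective hj).mul_left (C ^ 2))
        _ = C ^ 2 * ∑' w, ‖h (j w)‖ ^ 2 := tsum_mul_left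
        _ ≤ C ^ 2 * ∑' w, ‖h w‖ ^ 2 := by
            refine mul_le_mul_of_nonneg_left ?_ (sq_nonneg C)
            exact ((hs h).comp_injective hj).tsum_le_tsum_of_inj j hj (fun w _ => by positivity)
              (fun w => le_rfl) (hs h)

@[simp] theorem reindexOp_apply {ι : Type} (j : ι → ι) (hj : Function.Injective j)
    (D : ι → H →L[ℂ] H) (C : ℝ) (hD : ∀ w, ‖D w‖ ≤ C) (h : lp (fun _ : ι => H) 2) (w : ι) :
    reindexOp j hj D C hD h w = D w (h (j w)) := rfl

variable [CompleteSpace H] {A : Type u} [NonUnitalCStarAlgebra A] (ρ : ℕ → A →⋆ₙₐ[ℂ] A)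
  (r : A →⋆ₙₐ[ℂ] (H →L[ℂ] H))

/-- The Fock space over `H`. -/
abbrev Fock (H : Type u) [NormedAddCommGroup H] : Type u := lp (fun _ : List ℕ => H) 2

omit [CompleteSpace H] in
theorem fock_ext {S T : Fock H →L[ℂ] Fock H}
    (h : ∀ w v, S (lp.single 2 w v) = T (lp.single 2 w v)) : S = T := by
  refine ContinuousLinearMap.ext fun k => ?_
  have hk := lp.hasSum_single (p := 2) (by simp) k
  have h1 := S.hasSum hk
  have h2 := T.hasSum hk
  simp only [h] at h1
  exact h1.unique h2

/-- The left action of `A` on Fock space. -/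
noncomputable def fockCoeff : A →⋆ₙₐ[ℂ] (Fock H →L[ℂ] Fock H) where
  toFun a := reindexOp id Function.injective_id (fun w => r (wordHom ρ w a)) ‖a‖ fun w =>
    (NonUnitalStarAlgHom.norm_apply_le r _).trans
      (NonUnitalStarAlgHom.norm_apply_le (wordHom ρ w) a)
  map_smul' c a := by ext h w; simp
  map_zero' := by ext h w; simp
  map_add' a b := by ext h w; simp
  map_mul' a b := by ext h w; simp
  map_star' a := by
    refine (ContinuousLinearMap.eq_adjoint_iff _ _).2 fun h k => ?_
    rw [lp.inner_eq_tsum, lp.inner_eq_tsum]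
    refine tsum_congr fun w => ?_
    have e : r (wordHom ρ w (star a)) = ContinuousLinearMap.adjoint (r (wordHom ρ w a)) := by
      rw [map_star, map_star, ContinuousLinearMap.star_eq_adjoint]
    simp [e, ContinuousLinearMap.adjoint_inner_left]

theorem fockCoeff_apply (a : A) (h : Fock H) (w : List ℕ) :
    fockCoeff ρ r a h w = r (wordHom ρ w a) (h w) := rfl

/-- The annihilation operators on Fock space. -/
noncomputable def annihilation (H : Type u) [NormedAddCommGroup H] [InnerProductSpace ℂ H]
    (n : ℕ) : Fock H →L[ℂ] Fock H :=
  reindexOp (List.cons n) (List.cons_injective) (fun _ => ContinuousLinearMap.id ℂ H) 1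
    fun _ => ContinuousLinearMap.norm_id_le

omit [CompleteSpace H] in
@[simp] theorem annihilation_apply (n : ℕ) (h : Fock H) (w : List ℕ) :
    annihilation H n h w = h (n :: w) := rfl

theorem star_annihilation_single (n : ℕ) (w : List ℕ) (v : H) :
    star (annihilation H n) (lp.single 2 w v) = lp.single 2 (n :: w) v := by
  refine ext_inner_right ℂ fun k => ?_
  rw [ContinuousLinearMap.star_eq_adjoint, ContinuousLinearMap.adjoint_inner_left,
    lp.inner_single_left, lp.inner_single_left, annihilation_apply]

theorem annihilation_mul_star (m n : ℕ) :
    annihilation H m * star (annihilation H n) = if m = n then 1 else 0 := by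
  refine fock_ext fun w v => ?_
  rw [mul_apply_eq_comp, star_annihilation_single]
  ext u
  rw [annihilation_apply]
  split_ifs with h
  · subst h
    by_cases hu : u = w
    · subst hu; simp
    · simp [lp.single_apply, hu]
  · simp [lp.single_apply, h]

theorem annihilation_mul_fockCoeff (n : ℕ) (a : A) :
    annihilation H n * fockCoeff ρ r a = fockCoeff ρ r (ρ n a) * annihilation H n := by
  ext h w
  rfl

theorem fockCoeff_mul_star (n : ℕ) (a : A) :
    fockCoeff ρ r a * star (annihilation H n)
      = star (annihilation H n) * fockCoeff ρ r (ρ n a) := by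
  have := congrArg star (annihilation_mul_fockCoeff ρ r n (star a))
  simpa [← map_star] using this

end Fock

/-! ### Representations of the Toeplitz relations from orthogonal isometries. -/

section Construction

variable {A : Type u} [NonUnitalCStarAlgebra A] {ρ : ℕ → A →⋆ₙₐ[ℂ] A} {D : Type u}
  [CStarAlgebra D] (c : A →⋆ₙₐ[ℂ] D) (S : ℕ → D)

theorem star_mul_orthogonal (hS : ∀ m n, star (S m) * S n = if m = n then 1 else 0)
    (m n : ℕ) (a b : A) :
    star (S m * c a) * (S n * c b) = if m = n then c (star a * b) else 0 := by
  rw [star_mul, mul_assoc, ← mul_assoc (star (S m)), hS]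
  split_ifs <;> simp [map_star]

/-- By orthogonality and the C⋆-identity the squared norm of a partial sum is at most that of the
corresponding partial sum of ξₙ⋆ξₙ, so the Cauchy criterion carries over. -/
theorem summable_isometries (hS : ∀ m n, star (S m) * S n = if m = n then 1 else 0)
    (ξ : hilbertModule A) : Summable fun n => S n * c (ξ.1 n) := by
  have hξ : Summable fun n => star (ξ.1 n) * ξ.1 n := ξ.2
  rw [summable_iff_vanishing_norm] at hξ ⊢
  intro ε hε
  obtain ⟨s, hs⟩ := hξ (ε ^ 2) (by positivity)
  refine ⟨s, fun t ht => ?_⟩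
  have h : ‖∑ n ∈ t, S n * c (ξ.1 n)‖ ^ 2 ≤ ‖∑ n ∈ t, star (ξ.1 n) * ξ.1 n‖ := by
    rw [sq, ← CStarRing.norm_star_mul_self, star_sum, Finset.sum_mul_sum]
    simp only [star_mul_orthogonal c S hS]
    have : ∀ i ∈ t, (∑ j ∈ t, if i = j then c (star (ξ.1 i) * ξ.1 j) else 0)
        = c (star (ξ.1 i) * ξ.1 i) := fun i hi => by simp [hi]
    rw [Finset.sum_congr rfl this, ← map_sum]
    exact NonUnitalStarAlgHom.norm_apply_le c _
  exact lt_of_pow_lt_pow_left₀ 2 hε.le (h.trans_lt (hs t ht))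

/-- The representation of the Toeplitz–Pimsner relations given by a representation of `A` and a
sequence of isometries with orthogonal ranges. -/
noncomputable def toeplitzRepOfIsometries
    (hS : ∀ m n, star (S m) * S n = if m = n then 1 else 0)
    (hc : ∀ n a, c a * S n = S n * c (ρ n a)) : ToeplitzRep ρ where
  carrier := D
  coeff := c
  op :=
    { toFun := fun ξ => ∑' n, S n * c (ξ.1 n)
      map_add' := fun ξ η => by
        rw [← (summable_isometries c S hS ξ).tsum_add (summable_isometries c S hS η)]
        refine tsum_congr fun n => ?_
        rw [← mul_add, ← map_add]
        rfl
      map_smul' := fun z ξ => by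
        rw [RingHom.id_apply, ← (summable_isometries c S hS ξ).tsum_const_smul]
        refine tsum_congr fun n => ?_
        rw [← mul_smul_comm, ← map_smul]
        rfl }
  op_left a ξ := by
    change ∑' n, S n * c (ρ n a * ξ.1 n) = c a * ∑' n, S n * c (ξ.1 n)
    rw [← (summable_isometries c S hS ξ).tsum_mul_left]
    refine tsum_congr fun n => ?_
    rw [map_mul, ← mul_assoc, ← hc, mul_assoc]
  op_right ξ a := by
    change ∑' n, S n * c (ξ.1 n * a) = (∑' n, S n * c (ξ.1 n)) * c a
    rw [← (summable_isometries c S hS ξ).tsum_mul_right]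
    refine tsum_congr fun n => ?_
    rw [map_mul, mul_assoc]
  star_op_mul_op ξ η := by
    change star (∑' n, S n * c (ξ.1 n)) * (∑' n, S n * c (η.1 n)) = c (ip ξ η)
    have h1 : ∀ n, star (S n * c (ξ.1 n)) * (∑' n, S n * c (η.1 n))
        = c (star (ξ.1 n) * η.1 n) := by
      intro n
      rw [← (summable_isometries c S hS η).tsum_mul_left]
      simp only [star_mul_orthogonal c S hS]
      rw [tsum_eq_single n fun m hm => if_neg hm.symm, if_pos rfl]
    have h2 := ((summable_isometries c S hS ξ).hasSum.star).mul_right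
      (∑' n, S n * c (η.1 n))
    simp only [h1] at h2
    have h3 := (summable_ip ξ η).hasSum.map c (continuous_starHom c)
    exact h2.unique h3

end Construction

/-- The copy of `A` in the Toeplitz–Pimsner algebra is faithful. -/
theorem univCoeff_injective {A : Type u} [NonUnitalCStarAlgebra A] (ρ : ℕ → A →⋆ₙₐ[ℂ] A)
    {a : A} (h : univCoeff ρ a = 0) : a = 0 := by
  by_contra ha
  obtain ⟨H, _, _, _, r, hr⟩ := exists_representation ha
  refine hr (ContinuousLinearMap.ext fun v => ?_)
  let R : ToeplitzRep ρ := toeplitzRepOfIsometries (fockCoeff ρ r)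
    (fun n => star (annihilation H n))
    (fun m n => by rw [star_star]; exact annihilation_mul_star m n)
    (fun n a => fockCoeff_mul_star ρ r n a)
  have h1 : fockCoeff ρ r a = 0 := congrArg (fun y : ToeplitzProd ρ => y R) h
  -- At the empty word the Fock representation acts by r itself.
  have h2 := congrArg (fun T : Fock H →L[ℂ] Fock H => T (lp.single 2 [] v) []) h1
  simpa [fockCoeff_apply, wordHom] using h2

end QuasiFree

namespace QuasiFree

open scoped ZeroAtInfty CompactlySupported BoundedContinuousFunction FourierTransform

/-! ### Multiplication operators -/

section MulOp

variable {H : Type w} [NormedAddCommGroup H] [InnerProductSpace ℂ H] [CompleteSpace H]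

omit [CompleteSpace H] in
theorem memLp_bcf (G : ℝ →ᵇ (H →L[ℂ] H)) : MemLp G ∞ (volume : Measure ℝ) :=
  memLp_top_of_bound G.continuous.aestronglyMeasurable ‖G‖
    (Eventually.of_forall G.norm_coe_le_norm)

theorem coeFn_holderL {G : ℝ → (H →L[ℂ] H)} (hG : MemLp G ∞ (volume : Measure ℝ)) (ξ : L2 H) :
    (ContinuousLinearMap.id ℂ (H →L[ℂ] H)).holderL volume ∞ 2 2 (hG.toLp _) ξ
      =ᵐ[volume] fun s => G s (ξ s) := by
  filter_upwards [(ContinuousLinearMap.id ℂ (H →L[ℂ] H)).coeFn_holder (r := 2) (hG.toLp _) ξ,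
    hG.coeFn_toLp] with s h1 h2
  refine Eq.trans h1 ?_
  rw [h2]
  rfl

/-- The operator of multiplication by `G` on `L²(ℝ, H)`. -/
noncomputable def mulOpAux (G : ℝ →ᵇ (H →L[ℂ] H)) : L2 H →L[ℂ] L2 H :=
  (ContinuousLinearMap.id ℂ (H →L[ℂ] H)).holderL volume ∞ 2 2 ((memLp_bcf G).toLp _)

theorem coeFn_mulOpAux (G : ℝ →ᵇ (H →L[ℂ] H)) (ξ : L2 H) :
    mulOpAux G ξ =ᵐ[volume] fun s => G s (ξ s) :=
  coeFn_holderL (memLp_bcf G) ξ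

/-- Multiplication operators on `L²(ℝ, H)` as a representation of the bounded continuous
operator-valued functions. -/
noncomputable def mulOp : (ℝ →ᵇ (H →L[ℂ] H)) →⋆ₙₐ[ℂ] (L2 H →L[ℂ] L2 H) where
  toFun := mulOpAux
  map_smul' c G := by
    ext ξ
    change (mulOpAux (c • G) ξ : L2 H) =ᵐ[volume] (c • mulOpAux G ξ : L2 H)
    filter_upwards [coeFn_mulOpAux (c • G) ξ, coeFn_mulOpAux G ξ,
      Lp.coeFn_smul c (mulOpAux G ξ)] with s h1 h2 h3
    rw [h1, h3, Pi.smul_apply, h2]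
    rfl
  map_zero' := by
    ext ξ
    change (mulOpAux 0 ξ : L2 H) =ᵐ[volume] (0 : L2 H)
    filter_upwards [coeFn_mulOpAux 0 ξ, Lp.coeFn_zero H 2 (volume : Measure ℝ)] with s h1 h2
    rw [h1, h2]
    rfl
  map_add' G K := by
    ext ξ
    change (mulOpAux (G + K) ξ : L2 H) =ᵐ[volume] (mulOpAux G ξ + mulOpAux K ξ : L2 H)
    filter_upwards [coeFn_mulOpAux (G + K) ξ, coeFn_mulOpAux G ξ, coeFn_mulOpAux K ξ,
      Lp.coeFn_add (mulOpAux G ξ) (mulOpAux K ξ)] with s h1 h2 h3 h4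
    rw [h1, h4, Pi.add_apply, h2, h3]
    rfl
  map_mul' G K := by
    ext ξ
    change (mulOpAux (G * K) ξ : L2 H) =ᵐ[volume] (mulOpAux G (mulOpAux K ξ) : L2 H)
    filter_upwards [coeFn_mulOpAux (G * K) ξ, coeFn_mulOpAux G (mulOpAux K ξ),
      coeFn_mulOpAux K ξ] with s h1 h2 h3
    rw [h1, h2, h3]
    rfl
  map_star' G := by
    refine (ContinuousLinearMap.eq_adjoint_iff _ _).2 fun ξ η => ?_
    rw [L2.inner_def, L2.inner_def]
    refine integral_congr_ae ?_
    filter_upwards [coeFn_mulOpAux (star G) ξ, coeFn_mulOpAux G η] with s h1 h2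
    rw [h1, h2, BoundedContinuousFunction.star_apply, ContinuousLinearMap.star_eq_adjoint,
      ContinuousLinearMap.adjoint_inner_left]

theorem coeFn_mulOp (G : ℝ →ᵇ (H →L[ℂ] H)) (ξ : L2 H) :
    mulOp G ξ =ᵐ[volume] fun s => G s (ξ s) :=
  coeFn_mulOpAux G ξ

theorem mulOp_one : mulOp (1 : ℝ →ᵇ (H →L[ℂ] H)) = 1 := by
  ext ξ
  filter_upwards [coeFn_mulOp (1 : ℝ →ᵇ (H →L[ℂ] H)) ξ] with s h1
  rw [h1]
  rfl

theorem mulOp_injective {G : ℝ →ᵇ (H →L[ℂ] H)} (h : mulOp G = 0) : G = 0 := by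
  refine BoundedContinuousFunction.ext fun s => ContinuousLinearMap.ext fun v => ?_
  -- test on the indicator function of a bounded interval
  let T : Set ℝ := Set.Ioo (s - 1) (s + 1)
  have hT : volume T ≠ ∞ := by simp [T]
  have h1 := coeFn_mulOp G (indicatorConstLp 2 (measurableSet_Ioo (a := s - 1) (b := s + 1)) hT v)
  rw [h] at h1
  have h2 : ∀ᵐ y ∂(volume.restrict T), G y v = (fun _ => (0 : H)) y := by
    rw [ae_restrict_iff' measurableSet_Ioo]
    filter_upwards [h1, Lp.coeFn_zero H 2 (volume : Measure ℝ),
      indicatorConstLp_coeFn (p := 2) (hs := measurableSet_Ioo (a := s - 1) (b := s + 1))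
        (hμs := hT) (c := v)] with y h3 h4 h5 hy
    rw [h5, Set.indicator_of_mem hy] at h3
    rw [← h3]
    exact h4
  have h6 := Measure.eqOn_open_of_ae_eq h2 isOpen_Ioo
    ((G.continuous.clm_apply continuous_const).continuousOn) continuousOn_const
  exact h6 (show s ∈ T by simp [T])

/-- The translation of an operator-valued function. -/
noncomputable def shiftFn (G : ℝ →ᵇ (H →L[ℂ] H)) (t : ℝ) : ℝ →ᵇ (H →L[ℂ] H) :=
  G.compContinuous ⟨fun s => s - t, by fun_prop⟩

omit [CompleteSpace H] in
theorem coeFn_translation (t : ℝ) (ξ : L2 H) :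
    translation H t ξ =ᵐ[volume] fun s => ξ (s - t) :=
  Lp.coeFn_compMeasurePreserving ξ (measurePreserving_sub_right volume t)

theorem translation_mul_mulOp (t : ℝ) (G : ℝ →ᵇ (H →L[ℂ] H)) :
    translation H t * mulOp G = mulOp (shiftFn G t) * translation H t := by
  ext ξ
  change (translation H t (mulOp G ξ) : L2 H) =ᵐ[volume]
    (mulOp (shiftFn G t) (translation H t ξ) : L2 H)
  have h0 := (measurePreserving_sub_right volume t).quasiMeasurePreserving.ae_eq
    (coeFn_mulOp G ξ)
  filter_upwards [coeFn_translation t (mulOp G ξ), coeFn_mulOp (shiftFn G t) (translation H t ξ),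
    coeFn_translation t ξ, h0] with s h1 h2 h3 h4
  rw [h1, h2, h3]
  exact h4

/-- Constant multiplication operators. -/
noncomputable def constOp : (H →L[ℂ] H) →⋆ₙₐ[ℂ] (L2 H →L[ℂ] L2 H) where
  toFun T := mulOp (BoundedContinuousFunction.const ℝ T)
  map_smul' c T := by rw [← map_smul]; rfl
  map_zero' := by rw [← map_zero mulOp]; rfl
  map_add' S T := by rw [← map_add]; rfl
  map_mul' S T := by rw [← map_mul]; rfl
  map_star' T := by rw [← map_star]; rfl

theorem coeFn_constOp (T : H →L[ℂ] H) (ξ : L2 H) :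
    constOp T ξ =ᵐ[volume] fun s => T (ξ s) :=
  coeFn_mulOp _ ξ

/-- The function `s ↦ exp(-2πi t s)` with values in the scalar operators. -/
noncomputable def charFn (H : Type w) [NormedAddCommGroup H] [InnerProductSpace ℂ H] (t : ℝ) :
    ℝ →ᵇ (H →L[ℂ] H) :=
  BoundedContinuousFunction.ofNormedAddCommGroup
    (fun s => (𝐞 (-(t * s)) : ℂ) • (1 : H →L[ℂ] H))
    (by
      have := Real.continuous_fourierChar
      fun_prop) 1 fun s => by
      rw [norm_smul, Circle.norm_coe, one_mul]
      exact ContinuousLinearMap.norm_id_le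

omit [CompleteSpace H] in
@[simp] theorem charFn_apply (t s : ℝ) :
    charFn H t s = (𝐞 (-(t * s)) : ℂ) • (1 : H →L[ℂ] H) := rfl

end MulOp

/-! ### The Fourier transform -/

section Fourier

variable {H : Type w} [NormedAddCommGroup H] [InnerProductSpace ℂ H] [CompleteSpace H]

/-- The Fourier transform on `L²(ℝ, H)`. -/
noncomputable abbrev four (H : Type w) [NormedAddCommGroup H] [InnerProductSpace ℂ H]
    [CompleteSpace H] : L2 H ≃ₗᵢ[ℂ] L2 H := Lp.fourierTransformₗᵢ ℝ H

theorem four_toLp (f : SchwartzMap ℝ H) : four H (f.toLp 2) = (𝓕 f).toLp 2 :=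
  SchwartzMap.toLp_fourier_eq f

omit [CompleteSpace H] in
theorem ext_toLp {S T : L2 H → L2 H} (hS : Continuous S) (hT : Continuous T)
    (h : ∀ f : SchwartzMap ℝ H, S (f.toLp 2) = T (f.toLp 2)) (ξ : L2 H) : S ξ = T ξ :=
  DenseRange.induction_on (p := fun ξ => S ξ = T ξ)
    (SchwartzMap.denseRange_toLpCLM (p := 2) ENNReal.ofNat_ne_top) ξ (isClosed_eq hS hT) h

/-- Both sides are continuous, so the classical rule for Schwartz functions suffices. -/
theorem four_translation (t : ℝ) (ξ : L2 H) :
    four H (translation H t ξ) = mulOp (charFn H t) (four H ξ) := by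
  refine ext_toLp (S := fun ξ => four H (translation H t ξ))
    (T := fun ξ => mulOp (charFn H t) (four H ξ))
    ((four H).continuous.comp (translation H t).continuous)
    ((mulOp (charFn H t)).continuous.comp (four H).continuous) (fun f => ?_) ξ
  have h1 : translation H t (f.toLp 2) = (f.compSubConstCLM ℂ t).toLp 2 := by
    refine Lp.ext ?_
    have h0 := (measurePreserving_sub_right volume t).quasiMeasurePreserving.ae_eq
      (f.coeFn_toLp 2)
    filter_upwards [coeFn_translation t (f.toLp 2), (f.compSubConstCLM ℂ t).coeFn_toLp 2, h0]
      with s h1 h2 h3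
    rw [h1, h2]
    exact h3
  rw [h1, four_toLp, four_toLp]
  refine Lp.ext ?_
  filter_upwards [(𝓕 (f.compSubConstCLM ℂ t)).coeFn_toLp 2, (𝓕 f).coeFn_toLp 2,
    coeFn_mulOp (charFn H t) ((𝓕 f).toLp 2)] with s h2 h3 h4
  rw [h2, h4, h3, charFn_apply]
  have h5 := congrFun (VectorFourier.fourierIntegral_comp_add_right 𝐞 volume (innerₗ ℝ)
    (f : ℝ → H) (-t)) s
  rw [SchwartzMap.fourier_coe, SchwartzMap.fourier_coe]
  refine Eq.trans h5 ?_
  rw [Circle.smul_def]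
  have : (innerₗ ℝ) (-t) s = -(t * s) := by simp [mul_comm]
  rw [this]
  rfl

theorem four_constOp (T : H →L[ℂ] H) (ξ : L2 H) :
    four H (constOp T ξ) = constOp T (four H ξ) := by
  refine ext_toLp (S := fun ξ => four H (constOp T ξ)) (T := fun ξ => constOp T (four H ξ))
    ((four H).continuous.comp (constOp T).continuous)
    ((constOp T).continuous.comp (four H).continuous) (fun f => ?_) ξ
  have h1 : constOp T (f.toLp 2) = (f.postcompCLM T).toLp 2 := by
    refine Lp.ext ?_
    filter_upwards [coeFn_constOp T (f.toLp 2), (f.postcompCLM T).coeFn_toLp 2,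
      f.coeFn_toLp 2] with s h1 h2 h3
    rw [h1, h2, h3]
    rfl
  rw [h1, four_toLp, four_toLp]
  refine Lp.ext ?_
  filter_upwards [(𝓕 (f.postcompCLM T)).coeFn_toLp 2, (𝓕 f).coeFn_toLp 2,
    coeFn_constOp T ((𝓕 f).toLp 2)] with s h2 h3 h4
  rw [h2, h4, h3, SchwartzMap.fourier_coe, SchwartzMap.fourier_coe]
  change ∫ v, _ = T (∫ v, _)
  rw [← T.integral_comp_comm]
  · refine integral_congr_ae (Eventually.of_forall fun v => ?_)
    simp [Circle.smul_def]
  · exact (VectorFourier.fourierIntegral_convergent_iff Real.continuous_fourierChar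
      (by exact continuous_inner (𝕜 := ℝ) (E := ℝ)) s).2 f.integrable

/-- Multiplication operators in Fourier space. -/
noncomputable def conjFour : (L2 H →L[ℂ] L2 H) →⋆ₙₐ[ℂ] (L2 H →L[ℂ] L2 H) :=
  ((four H).symm.conjStarAlgEquiv : (L2 H →L[ℂ] L2 H) →⋆ₐ[ℂ] (L2 H →L[ℂ] L2 H))

theorem conjFour_apply (T : L2 H →L[ℂ] L2 H) (ξ : L2 H) :
    conjFour T ξ = (four H).symm (T (four H ξ)) := rfl

theorem conjFour_one : conjFour (1 : L2 H →L[ℂ] L2 H) = 1 := by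
  ext1 ξ
  simp [conjFour_apply]

theorem conjFour_injective {T : L2 H →L[ℂ] L2 H} (h : conjFour T = 0) : T = 0 := by
  ext1 ξ
  have := congrArg (fun S : L2 H →L[ℂ] L2 H => S ((four H).symm ξ)) h
  simpa [conjFour_apply] using this

theorem conjFour_charFn (t : ℝ) : conjFour (mulOp (charFn H t)) = translation H t := by
  ext1 ξ
  rw [conjFour_apply, ← four_translation, LinearIsometryEquiv.symm_apply_apply]

theorem conjFour_constOp (T : H →L[ℂ] H) : conjFour (constOp T) = constOp T := by
  ext1 ξ
  rw [conjFour_apply, ← four_constOp, LinearIsometryEquiv.symm_apply_apply]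

theorem translation_zero : translation H 0 = 1 := by
  rw [← conjFour_charFn, ← conjFour_one, ← mulOp_one]
  congr 2
  ext1 s
  simp

/-- In Fourier space translations are multiplications by characters, where the group law is
pointwise. -/
theorem translation_add (s t : ℝ) :
    translation H (s + t) = translation H s * translation H t := by
  rw [← conjFour_charFn, ← conjFour_charFn, ← conjFour_charFn, ← map_mul, ← map_mul]
  congr 2
  ext1 y
  rw [BoundedContinuousFunction.mul_apply, charFn_apply, charFn_apply, charFn_apply, add_mul,
    neg_add, AddChar.map_add_eq_mul, Circle.coe_mul, smul_mul_smul_comm, one_mul]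

theorem star_translation (t : ℝ) : star (translation H t) = translation H (-t) := by
  rw [← conjFour_charFn, ← conjFour_charFn, ← map_star, ← map_star]
  congr 2
  ext1 y
  rw [BoundedContinuousFunction.star_apply, charFn_apply, charFn_apply, star_smul, star_one,
    RCLike.star_def, ← Circle.coe_inv_eq_conj, ← AddChar.map_neg_eq_inv, neg_mul, neg_neg]

/-- The scalar operator-valued function given by `f`. -/
noncomputable def scalarFn (H : Type w) [NormedAddCommGroup H] [InnerProductSpace ℂ H]
    (f : C₀(ℝ, ℂ)) : ℝ →ᵇ (H →L[ℂ] H) :=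
  BoundedContinuousFunction.ofNormedAddCommGroup (fun s => f s • (1 : H →L[ℂ] H))
    (f.continuous.smul continuous_const) ‖f‖ fun s => by
      rw [norm_smul]
      exact (mul_le_of_le_one_right (norm_nonneg _) ContinuousLinearMap.norm_id_le).trans
        (norm_apply_le f s)

omit [CompleteSpace H] in
@[simp] theorem scalarFn_apply (f : C₀(ℝ, ℂ)) (s : ℝ) :
    scalarFn H f s = f s • (1 : H →L[ℂ] H) := rfl

theorem integrable_translation (φ : C_c(ℝ, ℂ)) (ξ : L2 H) :
    Integrable (fun t => φ t • translation H t ξ) :=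
  (φ.continuous.smul (continuous_translation ξ)).integrable_of_hasCompactSupport
    φ.hasCompactSupport.smul_right

/-- The integrated translations `∫ φ(t) λₜ dt`. -/
noncomputable def lam (H : Type w) [NormedAddCommGroup H] [InnerProductSpace ℂ H]
    [CompleteSpace H] (φ : C_c(ℝ, ℂ)) : L2 H →L[ℂ] L2 H :=
  conjFour (mulOp (scalarFn H (fourierCc φ)))

/-- After a Fourier transform and pairing with a vector ζ, this is the Fubini identity that moves
the Fourier transform from φ to the integrable function s ↦ ⟨ζ(s), η(s)⟩. -/
theorem lam_apply (φ : C_c(ℝ, ℂ)) (ξ : L2 H) :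
    lam H φ ξ = ∫ t, φ t • translation H t ξ := by
  rw [lam, conjFour_apply, LinearIsometryEquiv.symm_apply_eq,
    show four H (∫ t, φ t • translation H t ξ) = ((four H).toContinuousLinearEquiv :
      L2 H →L[ℂ] L2 H) (∫ t, φ t • translation H t ξ) from rfl,
    ← ContinuousLinearMap.integral_comp_comm _ (integrable_translation φ ξ)]
  have h1 : ∀ t, ((four H).toContinuousLinearEquiv : L2 H →L[ℂ] L2 H) (φ t • translation H t ξ)
      = φ t • mulOp (charFn H t) (four H ξ) := fun t => by
    rw [map_smul]
    exact congrArg _ (four_translation t ξ)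
  have hint : Integrable fun t => φ t • mulOp (charFn H t) (four H ξ) := by
    simp only [← h1]
    exact ContinuousLinearMap.integrable_comp _ (integrable_translation φ ξ)
  simp only [h1]
  set η := four H ξ
  refine ext_inner_left ℂ fun ζ => ?_
  rw [← integral_inner hint]
  let h : ℝ → ℂ := fun s => inner ℂ (ζ s) (η s)
  have hh : Integrable h := L2.integrable_inner ζ η
  have hφ : Integrable (φ : ℝ → ℂ) :=
    φ.continuous.integrable_of_hasCompactSupport φ.hasCompactSupport
  have h2 : inner ℂ ζ (mulOp (scalarFn H (fourierCc φ)) η) = ∫ s, fourierCc φ s • h s := by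
    rw [L2.inner_def]
    refine integral_congr_ae ?_
    filter_upwards [coeFn_mulOp (scalarFn H (fourierCc φ)) η] with s hs
    rw [hs, scalarFn_apply]
    simp [h, inner_smul_right]
  have h3 : ∀ t, inner ℂ ζ (φ t • mulOp (charFn H t) η)
      = φ t • VectorFourier.fourierIntegral 𝐞 volume (innerₗ ℝ).flip h t := by
    intro t
    rw [inner_smul_right, L2.inner_def, smul_eq_mul]
    congr 1
    refine integral_congr_ae ?_
    filter_upwards [coeFn_mulOp (charFn H t) η] with s hs
    rw [hs, charFn_apply]
    have : ((innerₗ ℝ).flip s) t = t * s := by simp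
    rw [this]
    simp [h, inner_smul_right, Circle.smul_def]
  rw [h2]
  simp only [h3]
  exact VectorFourier.integral_fourierIntegral_smul_eq_flip (L := innerₗ ℝ)
    Real.continuous_fourierChar (by exact continuous_inner (𝕜 := ℝ) (E := ℝ)) hφ hh

end Fourier

end QuasiFree

namespace QuasiFree

open scoped ZeroAtInfty CompactlySupported BoundedContinuousFunction FourierTransform

/-! ### The regular representation -/

section Regular

variable {B : Type v} [NonUnitalCStarAlgebra B] (α : Flow B)
  {H : Type w} [NormedAddCommGroup H] [InnerProductSpace ℂ H] [CompleteSpace H]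
  (π : B →⋆ₙₐ[ℂ] (H →L[ℂ] H))

/-- The orbit function `s ↦ π (α₋ₛ b)`. -/
noncomputable def orbitFn : B →⋆ₙₐ[ℂ] (ℝ →ᵇ (H →L[ℂ] H)) where
  toFun b := BoundedContinuousFunction.ofNormedAddCommGroup (fun s => π (α.hom (-s) b))
    ((continuous_starHom π).comp ((α.continuous b).comp continuous_neg)) ‖b‖ fun s =>
    (NonUnitalStarAlgHom.norm_apply_le π _).trans
      (NonUnitalStarAlgHom.norm_apply_le (α.hom (-s)) b)
  map_smul' c b := by ext1 s; simp
  map_zero' := by ext1 s; simp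
  map_add' a b := by ext1 s; simp
  map_mul' a b := by ext1 s; simp
  map_star' b := by ext1 s; simp [map_star]

theorem orbitFn_apply (b : B) (s : ℝ) : orbitFn α π b s = π (α.hom (-s) b) := rfl

/-- The regular representation of the coefficient algebra. -/
noncomputable def regHom : B →⋆ₙₐ[ℂ] (L2 H →L[ℂ] L2 H) := mulOp.comp (orbitFn α π)

theorem regHom_apply (b : B) : regHom α π b = regCoeff α π b := rfl

theorem translation_mul_regHom (t : ℝ) (b : B) :
    translation H t * regHom α π b = regHom α π (α.hom t b) * translation H t := by
  change translation H t * mulOp (orbitFn α π b) = mulOp (orbitFn α π (α.hom t b)) * _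
  rw [translation_mul_mulOp]
  congr 2
  ext1 s
  change π (α.hom (-(s - t)) b) = π (α.hom (-s) (α.hom t b))
  rw [← α.map_add]
  congr 2
  congr 1
  ring

theorem regHom_of_fixed {b : B} (hb : ∀ t, α.hom t b = b) : regHom α π b = constOp (π b) := by
  change mulOp (orbitFn α π b) = mulOp (BoundedContinuousFunction.const ℝ (π b))
  congr 1
  ext1 s
  rw [orbitFn_apply, hb]
  rfl

/-- The function `t ↦ φ(t) b`. -/
noncomputable def ccSmul (φ : C_c(ℝ, ℂ)) (b : B) : C_c(ℝ, B) where
  toFun t := φ t • b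
  continuous_toFun := φ.continuous.smul continuous_const
  hasCompactSupport' := φ.hasCompactSupport.smul_right

theorem integratedForm_apply (f : C_c(ℝ, B)) (ξ : L2 H) :
    integratedForm α π f ξ = ∫ t, regCoeff α π (f t) (translation H t ξ) := rfl

theorem integratedForm_ccSmul (φ : C_c(ℝ, ℂ)) (b : B) :
    integratedForm α π (ccSmul φ b) = regHom α π b * lam H φ := by
  ext1 ξ
  rw [integratedForm_apply, mul_apply_eq_comp, lam_apply,
    ← ContinuousLinearMap.integral_comp_comm _ (integrable_translation φ ξ)]
  refine integral_congr_ae (Eventually.of_forall fun t => ?_)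
  change regCoeff α π (φ t • b) _ = _
  simp only [← regHom_apply]
  rw [map_smul, map_smul]
  rfl

theorem integratedForm_sub_apply (f g : C_c(ℝ, B)) (ξ : L2 H) :
    (integratedForm α π f - integratedForm α π g) ξ
      = ∫ t, regCoeff α π (f t - g t) (translation H t ξ) := by
  rw [sub_apply, integratedForm_apply, integratedForm_apply,
    ← integral_sub (integrable_aux α π f ξ) (integrable_aux α π g ξ)]
  refine integral_congr_ae (Eventually.of_forall fun t => ?_)
  simp only [regCoeff_sub]
  rfl

/-- Two integrated forms are close if the functions are uniformly close and supported in a common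
bounded interval. -/
theorem norm_integratedForm_sub_le (f g : C_c(ℝ, B)) {R ε : ℝ} (hR : 0 ≤ R) (hε : 0 ≤ ε)
    (h : ∀ t, ‖f t - g t‖ ≤ ε) (hs : ∀ t, R < |t| → f t = 0 ∧ g t = 0) :
    ‖integratedForm α π f - integratedForm α π g‖ ≤ 2 * R * ε := by
  refine ContinuousLinearMap.opNorm_le_bound _ (by positivity) fun ξ => ?_
  rw [integratedForm_sub_apply]
  have hz : ∀ t, t ∉ Set.Icc (-R) R → regCoeff α π (f t - g t) (translation H t ξ) = 0 := by
    intro t ht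
    have ht' : R < |t| := by
      by_contra hcon
      exact ht (abs_le.1 (not_lt.1 hcon))
    rw [(hs t ht').1, (hs t ht').2, sub_zero, regCoeff_zero]
    rfl
  rw [← setIntegral_eq_integral_of_forall_compl_eq_zero hz]
  have hle : ∀ t, ‖regCoeff α π (f t - g t) (translation H t ξ)‖ ≤ ε * ‖ξ‖ := fun t => by
    refine (ContinuousLinearMap.le_opNorm _ _).trans ?_
    gcongr
    · exact (norm_regCoeff_le α π _).trans (h t)
    · exact (Lp.norm_compMeasurePreserving ξ (measurePreserving_sub_right volume t)).le
  refine (norm_setIntegral_le_of_norm_le_const (by simp) fun t _ => hle t).trans (le_of_eq ?_)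
  rw [Real.volume_real_Icc_of_le (by linarith)]
  ring

end Regular

/-! ### Strong limits of bounded families -/

section StrongLimit

variable {K : Type w} [NormedAddCommGroup K] [InnerProductSpace ℂ K] [CompleteSpace K]

/-- Pointwise limits of contractions exist if they exist on a dense subspace. -/
theorem cauchy_map_of_dense {ι : Type v} {l : Filter ι} [l.NeBot] {T : ι → K →L[ℂ] K}
    (hT : ∀ᶠ i in l, ‖T i‖ ≤ 1) {p : Submodule ℂ K} (hp : p.topologicalClosure = ⊤)
    (h : ∀ ξ ∈ p, ∃ η, Tendsto (fun i => T i ξ) l (𝓝 η)) (ξ : K) :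
    ∃ η, Tendsto (fun i => T i ξ) l (𝓝 η) := by
  refine cauchy_map_iff_exists_tendsto.1 (Metric.cauchy_iff.2 ⟨inferInstance, fun ε hε => ?_⟩)
  have hξ : ξ ∈ closure (p : Set K) := by
    rw [← Submodule.topologicalClosure_coe, hp]
    trivial
  obtain ⟨ζ, hζ, hd⟩ := Metric.mem_closure_iff.1 hξ (ε / 4) (by positivity)
  obtain ⟨η, hη⟩ := h ζ hζ
  have h1 := Metric.tendsto_nhds.1 hη (ε / 4) (by positivity)
  have h2 : ∀ᶠ i in l, dist (T i ξ) η < ε / 2 := by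
    filter_upwards [h1, hT] with i hi hTi
    have h3 : dist (T i ξ) (T i ζ) ≤ dist ξ ζ := by
      rw [dist_eq_norm, dist_eq_norm, ← map_sub]
      exact ((T i).le_of_opNorm_le hTi _).trans_eq (one_mul _)
    calc _ ≤ dist (T i ξ) (T i ζ) + dist (T i ζ) η := dist_triangle _ _ _
      _ < ε / 2 := by linarith
  refine ⟨Metric.ball η (ε / 2), mem_map.2 h2, fun a ha b hb => ?_⟩
  calc _ ≤ dist a η + dist b η := dist_triangle_right _ _ _
    _ < ε := by
      have := Metric.mem_ball.1 ha
      have := Metric.mem_ball.1 hb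
      linarith

omit [CompleteSpace K] in
/-- The pointwise limit of a family of contractions. -/
theorem exists_strongLimit {ι : Type v} {l : Filter ι} [l.NeBot] {T : ι → K →L[ℂ] K}
    (hT : ∀ᶠ i in l, ‖T i‖ ≤ 1) (h : ∀ ξ, ∃ η, Tendsto (fun i => T i ξ) l (𝓝 η)) :
    ∃ S : K →L[ℂ] K, ‖S‖ ≤ 1 ∧ ∀ ξ, Tendsto (fun i => T i ξ) l (𝓝 (S ξ)) := by
  choose f hf using h
  have hle : ∀ ξ, ‖f ξ‖ ≤ 1 * ‖ξ‖ := fun ξ => by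
    refine le_of_tendsto (hf ξ).norm ?_
    filter_upwards [hT] with i hi
    exact (T i).le_of_opNorm_le hi ξ
  let F : K →ₗ[ℂ] K :=
    { toFun := f
      map_add' := fun ξ η => by
        refine tendsto_nhds_unique (hf (ξ + η)) ?_
        simp only [map_add]
        exact (hf ξ).add (hf η)
      map_smul' := fun c ξ => by
        refine tendsto_nhds_unique (hf (c • ξ)) ?_
        simp only [map_smul]
        exact (hf ξ).const_smul c }
  exact ⟨F.mkContinuous 1 hle, LinearMap.mkContinuous_norm_le _ zero_le_one _, hf⟩

/-- The subspace spanned by the range of a representation and by its kernel is dense. -/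
theorem dense_range_sup_kernel {A : Type u} [NonUnitalCStarAlgebra A]
    (r : A →⋆ₙₐ[ℂ] (K →L[ℂ] K)) :
    (Submodule.span ℂ ({ξ | ∃ a η, ξ = r a η} ∪ {ξ | ∀ a, r a ξ = 0})).topologicalClosure = ⊤ := by
  rw [Submodule.topologicalClosure_eq_top_iff, Submodule.eq_bot_iff]
  intro ζ hζ
  have h1 : ∀ a, r a ζ = 0 := by
    intro a
    refine ext_inner_left ℂ fun η => ?_
    rw [inner_zero_right]
    have h2 := hζ (r (star a) η) (Submodule.subset_span (Or.inl ⟨star a, η, rfl⟩))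
    rwa [map_star, ContinuousLinearMap.star_eq_adjoint,
      ContinuousLinearMap.adjoint_inner_left] at h2
  have h3 := hζ ζ (Submodule.subset_span (Or.inr h1))
  exact inner_self_eq_zero.1 h3

end StrongLimit

end QuasiFree

namespace QuasiFree

open scoped ZeroAtInfty CompactlySupported BoundedContinuousFunction FourierTransform

/-! ### Generators of the Toeplitz–Pimsner algebra -/

section Generators

variable {A : Type u} [NonUnitalCStarAlgebra A] (ρ : ℕ → A →⋆ₙₐ[ℂ] A)

/-- The copy of `A` in the Toeplitz–Pimsner algebra. -/
noncomputable def coeffHom : A →⋆ₙₐ[ℂ] toeplitz ρ where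
  toFun a := ⟨univCoeff ρ a, NonUnitalStarSubalgebra.le_topologicalClosure _
    (NonUnitalStarAlgebra.subset_adjoin ℂ _ (Or.inl ⟨a, rfl⟩))⟩
  map_smul' c a := by ext R; exact map_smul R.coeff c a
  map_zero' := by ext R; exact map_zero R.coeff
  map_add' a b := by ext R; exact map_add R.coeff a b
  map_mul' a b := by ext R; exact map_mul R.coeff a b
  map_star' a := by ext R; exact map_star R.coeff a

/-- The symbols `T_ξ` as elements of the Toeplitz–Pimsner algebra. -/
noncomputable def symb : hilbertModule A →ₗ[ℂ] toeplitz ρ where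
  toFun ξ := ⟨univOp ρ ξ, NonUnitalStarSubalgebra.le_topologicalClosure _
    (NonUnitalStarAlgebra.subset_adjoin ℂ _ (Or.inr ⟨ξ, rfl⟩))⟩
  map_add' ξ η := by ext R; exact R.op.map_add ξ η
  map_smul' c ξ := by ext R; exact R.op.map_smul c ξ

/-- The symbols `T_{δₙ ⊗ a}`. -/
noncomputable def creation (n : ℕ) (a : A) : toeplitz ρ := symb ρ (delta n a)

variable {ρ}

theorem leftAct_delta (b : A) (n : ℕ) (a : A) :
    leftAct ρ b (delta n a) = delta n (ρ n b * a) := by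
  ext m
  change ρ m b * Pi.single (M := fun _ => A) n a m = Pi.single (M := fun _ => A) n (ρ n b * a) m
  by_cases h : m = n
  · subst h; simp
  · simp [Pi.single_eq_of_ne h]

theorem rightAct_delta (n : ℕ) (a b : A) : rightAct (delta n a) b = delta n (a * b) := by
  ext m
  change Pi.single (M := fun _ => A) n a m * b = Pi.single (M := fun _ => A) n (a * b) m
  by_cases h : m = n
  · subst h; simp
  · simp [Pi.single_eq_of_ne h]

theorem ip_delta (m n : ℕ) (a b : A) :
    ip (delta m a) (delta n b) = if m = n then star a * b else 0 := by
  change ∑' k, star (Pi.single (M := fun _ => A) m a k) * Pi.single (M := fun _ => A) n b k = _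
  rw [tsum_eq_single n fun k hk => by rw [Pi.single_eq_of_ne hk, mul_zero]]
  split_ifs with h
  · subst h; simp
  · rw [Pi.single_eq_of_ne (Ne.symm h)]; simp

theorem delta_sub (n : ℕ) (a b : A) : delta n (a - b) = delta n a - delta n b := by
  ext m
  exact congrFun (Pi.single_sub (f := fun _ => A) n a b) m

theorem coeffHom_mul_creation (a : A) (n : ℕ) (b : A) :
    coeffHom ρ a * creation ρ n b = creation ρ n (ρ n a * b) := by
  ext R
  exact ((R.op_left a (delta n b)).symm.trans (by rw [leftAct_delta]; rfl))

theorem creation_mul_coeffHom (n : ℕ) (a b : A) :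
    creation ρ n a * coeffHom ρ b = creation ρ n (a * b) := by
  ext R
  exact ((R.op_right (delta n a) b).symm.trans (by rw [rightAct_delta]; rfl))

theorem star_creation_mul_creation (m n : ℕ) (a b : A) :
    star (creation ρ m a) * creation ρ n b = if m = n then coeffHom ρ (star a * b) else 0 := by
  have h : star (creation ρ m a) * creation ρ n b = coeffHom ρ (ip (delta m a) (delta n b)) := by
    ext R
    exact R.star_op_mul_op (delta m a) (delta n b)
  rw [h, ip_delta]
  split_ifs
  · rfl
  · exact map_zero _

theorem creation_sub (n : ℕ) (a b : A) :
    creation ρ n (a - b) = creation ρ n a - creation ρ n b := by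
  rw [creation, delta_sub, map_sub]
  rfl

theorem norm_creation_le (n : ℕ) (a : A) : ‖creation ρ n a‖ ≤ ‖a‖ := by
  have h : ‖creation ρ n a‖ * ‖creation ρ n a‖ ≤ ‖a‖ * ‖a‖ := by
    rw [← CStarRing.norm_star_mul_self, star_creation_mul_creation, if_pos rfl,
      ← CStarRing.norm_star_mul_self]
    exact NonUnitalStarAlgHom.norm_apply_le _ _
  exact abs_le_of_sq_le_sq' (by simpa [sq] using h) (norm_nonneg _) |>.2

theorem continuous_creation (n : ℕ) : Continuous (creation ρ n) := by
  refine (LipschitzWith.of_dist_le_mul (K := 1) fun a b => ?_).continuous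
  rw [dist_eq_norm, dist_eq_norm, ← creation_sub]
  simpa using norm_creation_le n (a - b)

theorem hasSum_symb (ξ : hilbertModule A) :
    HasSum (fun n => creation ρ n (ξ.1 n)) (symb ρ ξ) := by
  have h : HasSum (fun n => ((creation ρ n (ξ.1 n) : toeplitz ρ) : ToeplitzProd ρ))
      ((symb ρ ξ : toeplitz ρ) : ToeplitzProd ρ) := hasSum_univOp ρ ξ
  rw [HasSum] at h ⊢
  rw [tendsto_subtype_rng]
  refine h.congr fun s => ?_
  exact (map_sum (NonUnitalStarSubalgebraClass.subtype (toeplitz ρ))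
    (fun n => creation ρ n (ξ.1 n)) s).symm

theorem flow_coeffHom (x : ℕ → ℝ) (t : ℝ) (a : A) :
    (quasiFreeFlow ρ x).hom t (coeffHom ρ a) = coeffHom ρ a := rfl

theorem flow_creation (x : ℕ → ℝ) (t : ℝ) (n : ℕ) (a : A) :
    (quasiFreeFlow ρ x).hom t (creation ρ n a)
      = (Circle.exp (x n * t) : ℂ) • creation ρ n a := by
  rw [creation, ← map_smul, ← phase_delta]
  rfl

/-- The Toeplitz–Pimsner algebra is generated by the coefficients and the creation operators. -/
theorem toeplitz_induction {p : toeplitz ρ → Prop} (hp : IsClosed {b | p b})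
    (hzero : p 0) (hadd : ∀ a b, p a → p b → p (a + b)) (hsmul : ∀ (c : ℂ) a, p a → p (c • a))
    (hmul : ∀ a b, p a → p b → p (a * b))
    (hcoeff : ∀ a, p (coeffHom ρ a)) (hcre : ∀ n a, p (creation ρ n a))
    (hstar : ∀ n a, p (star (creation ρ n a))) (b : toeplitz ρ) : p b := by
  have hsum : ∀ (s : Finset ℕ) (f : ℕ → toeplitz ρ), (∀ n, p (f n)) → p (∑ n ∈ s, f n) := by
    intro s f hf
    induction s using Finset.cons_induction with
    | empty => simpa using hzero
    | cons i s hi ih => rw [Finset.sum_cons]; exact hadd _ _ (hf i) ih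
  -- Stability of p under adjoints is not assumed, so p is required of b and of its adjoint at once.
  let N : NonUnitalStarSubalgebra ℂ (toeplitz ρ) :=
    { carrier := {b | p b ∧ p (star b)}
      add_mem' := fun h h' => ⟨hadd _ _ h.1 h'.1, by rw [star_add]; exact hadd _ _ h.2 h'.2⟩
      zero_mem' := ⟨hzero, by rw [star_zero]; exact hzero⟩
      mul_mem' := fun h h' => ⟨hmul _ _ h.1 h'.1, by rw [star_mul]; exact hmul _ _ h'.2 h.2⟩
      smul_mem' := fun c b h => ⟨hsmul c _ h.1, by rw [star_smul]; exact hsmul _ _ h.2⟩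
      star_mem' := fun h => ⟨h.2, by rw [star_star]; exact h.1⟩ }
  have hNc : IsClosed (N : Set (toeplitz ρ)) :=
    hp.inter (hp.preimage continuous_star)
  have hcl : IsClosed ((N.map (NonUnitalStarSubalgebraClass.subtype (toeplitz ρ)) :
      NonUnitalStarSubalgebra ℂ (ToeplitzProd ρ)) : Set (ToeplitzProd ρ)) := by
    rw [NonUnitalStarSubalgebra.coe_map]
    exact (toeplitz_isClosed ρ).isClosedEmbedding_subtypeVal.isClosedMap _ hNc
  have hle : toeplitz ρ ≤ N.map (NonUnitalStarSubalgebraClass.subtype (toeplitz ρ)) := by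
    refine NonUnitalStarSubalgebra.topologicalClosure_minimal _
      (NonUnitalStarAlgebra.adjoin_le ?_) hcl
    rintro _ (⟨a, rfl⟩ | ⟨ξ, rfl⟩)
    · exact ⟨coeffHom ρ a, ⟨hcoeff a, by rw [← map_star]; exact hcoeff _⟩, rfl⟩
    · refine ⟨symb ρ ξ, ⟨?_, ?_⟩, rfl⟩
      · exact hp.mem_of_tendsto (hasSum_symb ξ) (Eventually.of_forall fun s =>
          hsum s _ fun n => hcre n _)
      · exact hp.mem_of_tendsto (hasSum_symb ξ).star (Eventually.of_forall fun s =>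
          hsum s _ fun n => hstar n _)
  obtain ⟨c, hc, h⟩ := hle b.2
  have : c = b := Subtype.ext h
  exact this ▸ hc.1

end Generators

/-! ### The system of isometries on `L²(ℝ, H)` -/

section System

variable {A : Type u} [NonUnitalCStarAlgebra A] {ρ : ℕ → A →⋆ₙₐ[ℂ] A}
  {H : Type w} [NormedAddCommGroup H] [InnerProductSpace ℂ H] [CompleteSpace H]
  (x : ℕ → ℝ) (π : toeplitz ρ →⋆ₙₐ[ℂ] (H →L[ℂ] H))

/-- The coefficients acting on `L²(ℝ, H)`. -/
noncomputable def coeffOp : A →⋆ₙₐ[ℂ] (L2 H →L[ℂ] L2 H) :=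
  (constOp.comp π).comp (coeffHom ρ)

theorem regHom_coeffHom (a : A) : regHom (quasiFreeFlow ρ x) π (coeffHom ρ a) = coeffOp π a :=
  regHom_of_fixed _ _ fun t => flow_coeffHom x t a

/-- The creation operators acting on `L²(ℝ, H)`. -/
noncomputable def creationOp (n : ℕ) (a : A) : L2 H →L[ℂ] L2 H :=
  regHom (quasiFreeFlow ρ x) π (creation ρ n a)

theorem coeffOp_mul_creationOp (a : A) (n : ℕ) (b : A) :
    coeffOp π a * creationOp x π n b = creationOp x π n (ρ n a * b) := by
  rw [← regHom_coeffHom x, creationOp, ← map_mul, coeffHom_mul_creation]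
  rfl

theorem creationOp_mul_coeffOp (n : ℕ) (a b : A) :
    creationOp x π n a * coeffOp π b = creationOp x π n (a * b) := by
  rw [← regHom_coeffHom x, creationOp, ← map_mul, creation_mul_coeffHom]
  rfl

theorem star_creationOp_mul_creationOp (m n : ℕ) (a b : A) :
    star (creationOp x π m a) * creationOp x π n b
      = if m = n then coeffOp π (star a * b) else 0 := by
  rw [creationOp, creationOp, ← map_star, ← map_mul, star_creation_mul_creation]
  split_ifs
  · rw [regHom_coeffHom]
  · exact map_zero _

theorem translation_mul_creationOp (t : ℝ) (n : ℕ) (a : A) :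
    translation H t * creationOp x π n a
      = (Circle.exp (x n * t) : ℂ) • (creationOp x π n a * translation H t) := by
  rw [creationOp, translation_mul_regHom, flow_creation, map_smul, smul_mul_assoc]

theorem norm_creationOp_le (n : ℕ) (a : A) : ‖creationOp x π n a‖ ≤ ‖a‖ :=
  (NonUnitalStarAlgHom.norm_apply_le _ _).trans (norm_creation_le n a)

theorem continuous_creationOp (n : ℕ) : Continuous (creationOp x π n) :=
  (continuous_starHom _).comp (continuous_creation n)

/-- Since A need not be unital, δₙ ⊗ 1 has to be replaced by a strong limit of T_{δₙ ⊗ e}. The limit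
exists on the range of the coefficients, is zero on their common kernel, and extends to the closure
by contractivity. -/
theorem exists_isometryOp (n : ℕ) : ∃ S : L2 H →L[ℂ] L2 H, ‖S‖ ≤ 1 ∧
    ∀ ξ, Tendsto (fun e => creationOp x π n e ξ) (contractiveUnit A) (𝓝 (S ξ)) := by
  have hn : ∀ᶠ e in contractiveUnit A, ‖creationOp x π n e‖ ≤ 1 :=
    (contractiveUnit_norm A).mono fun e he => (norm_creationOp_le x π n e).trans he
  have hr : ∀ a : A, Tendsto (fun e => creationOp x π n e * coeffOp π a) (contractiveUnit A)
      (𝓝 (creationOp x π n a)) := fun a => by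
    simp only [creationOp_mul_coeffOp]
    exact ((continuous_creationOp x π n).tendsto a).comp
      ((contractiveUnit_isApproximateUnit A).tendsto_mul_right a)
  refine exists_strongLimit hn
    (cauchy_map_of_dense hn (dense_range_sup_kernel (coeffOp π)) fun ξ hξ => ?_)
  induction hξ using Submodule.span_induction with
  | mem ξ hξ =>
    rcases hξ with ⟨a, η, rfl⟩ | hξ
    · exact ⟨creationOp x π n a η,
        ((ContinuousLinearMap.apply ℂ (L2 H) η).continuous.tendsto _).comp (hr a)⟩
    · refine ⟨0, ?_⟩
      have h0 : ∀ e, creationOp x π n e ξ = 0 := fun e => by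
        -- T_{δₙ ⊗ ee'} factors through the coefficient e', which kills ξ.
        have h1 : Tendsto (fun e' => creationOp x π n (e * e') ξ) (contractiveUnit A)
            (𝓝 (creationOp x π n e ξ)) :=
          ((ContinuousLinearMap.apply ℂ (L2 H) ξ).continuous.tendsto _).comp
            (((continuous_creationOp x π n).tendsto e).comp
              ((contractiveUnit_isApproximateUnit A).tendsto_mul_left e))
        refine tendsto_nhds_unique h1 ?_
        have h2 : ∀ e', creationOp x π n (e * e') ξ = 0 := fun e' => by
          rw [← creationOp_mul_coeffOp, mul_apply_eq_comp, hξ, map_zero]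
        simp only [h2]
        exact tendsto_const_nhds
      simp only [h0]
      exact tendsto_const_nhds
  | zero => exact ⟨0, by simp⟩
  | add ξ η _ _ h h' =>
    obtain ⟨a, ha⟩ := h
    obtain ⟨b, hb⟩ := h'
    exact ⟨a + b, by simpa only [map_add] using ha.add hb⟩
  | smul c ξ _ h =>
    obtain ⟨a, ha⟩ := h
    exact ⟨c • a, by simpa only [map_smul] using ha.const_smul c⟩

/-- The strong limit of `T_{δₙ ⊗ e}` along an approximate unit. -/
noncomputable def isometryOp (n : ℕ) : L2 H →L[ℂ] L2 H := (exists_isometryOp x π n).choose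

theorem norm_isometryOp_le (n : ℕ) : ‖isometryOp x π n‖ ≤ 1 :=
  (exists_isometryOp x π n).choose_spec.1

theorem tendsto_isometryOp (n : ℕ) (ξ : L2 H) :
    Tendsto (fun e => creationOp x π n e ξ) (contractiveUnit A) (𝓝 (isometryOp x π n ξ)) :=
  (exists_isometryOp x π n).choose_spec.2 ξ

theorem isometryOp_mul_coeffOp (n : ℕ) (a : A) :
    isometryOp x π n * coeffOp π a = creationOp x π n a := by
  ext1 ξ
  refine tendsto_nhds_unique (tendsto_isometryOp x π n (coeffOp π a ξ)) ?_
  have h : ∀ e, creationOp x π n e (coeffOp π a ξ) = creationOp x π n (e * a) ξ := fun e => by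
    rw [← creationOp_mul_coeffOp]
    rfl
  simp only [h]
  exact ((ContinuousLinearMap.apply ℂ (L2 H) ξ).continuous.tendsto _).comp
    (((continuous_creationOp x π n).tendsto a).comp
      ((contractiveUnit_isApproximateUnit A).tendsto_mul_right a))

theorem coeffOp_mul_isometryOp (n : ℕ) (a : A) :
    coeffOp π a * isometryOp x π n = isometryOp x π n * coeffOp π (ρ n a) := by
  rw [isometryOp_mul_coeffOp]
  ext1 ξ
  refine tendsto_nhds_unique
    (((coeffOp π a).continuous.tendsto _).comp (tendsto_isometryOp x π n ξ)) ?_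
  have h : ∀ e, (coeffOp π a) (creationOp x π n e ξ) = creationOp x π n (ρ n a * e) ξ :=
    fun e => by
      rw [← coeffOp_mul_creationOp]
      rfl
  simp only [Function.comp_def, h]
  exact ((ContinuousLinearMap.apply ℂ (L2 H) ξ).continuous.tendsto _).comp
    (((continuous_creationOp x π n).tendsto (ρ n a)).comp
      ((contractiveUnit_isApproximateUnit A).tendsto_mul_left (ρ n a)))

theorem star_isometryOp_mul (m n : ℕ) (a : A) :
    star (isometryOp x π m) * (isometryOp x π n * coeffOp π a)
      = if m = n then coeffOp π a else 0 := by
  rw [isometryOp_mul_coeffOp]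
  ext1 ξ
  refine ext_inner_left ℂ fun ζ => ?_
  rw [mul_apply_eq_comp, ContinuousLinearMap.star_eq_adjoint,
    ContinuousLinearMap.adjoint_inner_right]
  refine tendsto_nhds_unique ((tendsto_isometryOp x π m ζ).inner tendsto_const_nhds) ?_
  have h : ∀ e, inner ℂ (creationOp x π m e ζ) (creationOp x π n a ξ)
      = inner ℂ ζ ((if m = n then coeffOp π (star e * a) else 0 : L2 H →L[ℂ] L2 H) ξ) := by
    intro e
    rw [← star_creationOp_mul_creationOp x, mul_apply_eq_comp,
      ContinuousLinearMap.star_eq_adjoint, ContinuousLinearMap.adjoint_inner_right]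
  simp only [h]
  refine Tendsto.inner tendsto_const_nhds ?_
  split_ifs
  -- The approximate unit is eventually selfadjoint, so its adjoints act as an approximate unit too.
  · have h2 : Tendsto (fun e : A => coeffOp π (star e * a)) (contractiveUnit A)
        (𝓝 (coeffOp π a)) := by
      refine ((continuous_starHom (coeffOp π)).tendsto a).comp
        (((contractiveUnit_isApproximateUnit A).tendsto_mul_right a).congr' ?_)
      filter_upwards [contractiveUnit_star A] with e he
      rw [he]
    exact ((ContinuousLinearMap.apply ℂ (L2 H) ξ).continuous.tendsto _).comp h2
  · exact tendsto_const_nhds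

theorem translation_mul_isometryOp (t : ℝ) (n : ℕ) :
    translation H t * isometryOp x π n
      = (Circle.exp (x n * t) : ℂ) • (isometryOp x π n * translation H t) := by
  ext1 ξ
  refine tendsto_nhds_unique
    (((translation H t).continuous.tendsto _).comp (tendsto_isometryOp x π n ξ)) ?_
  have h : ∀ e, translation H t (creationOp x π n e ξ)
      = (Circle.exp (x n * t) : ℂ) • creationOp x π n e (translation H t ξ) := fun e =>
    congrArg (fun T : L2 H →L[ℂ] L2 H => T ξ) (translation_mul_creationOp x π t n e)
  simp only [Function.comp_def, h]
  exact (tendsto_isometryOp x π n (translation H t ξ)).const_smul _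

/-- The function `t ↦ φ(t) exp(i y t)`. -/
noncomputable def modulate (φ : C_c(ℝ, ℂ)) (y : ℝ) : C_c(ℝ, ℂ) where
  toFun t := φ t * (Circle.exp (y * t) : ℂ)
  continuous_toFun := φ.continuous.mul (by fun_prop)
  hasCompactSupport' := φ.hasCompactSupport.mul_right

theorem lam_mul_isometryOp (φ : C_c(ℝ, ℂ)) (n : ℕ) :
    lam H φ * isometryOp x π n = isometryOp x π n * lam H (modulate φ (x n)) := by
  ext1 ξ
  rw [mul_apply_eq_comp, mul_apply_eq_comp, lam_apply, lam_apply,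
    ← ContinuousLinearMap.integral_comp_comm _ (integrable_translation _ ξ)]
  refine integral_congr_ae (Eventually.of_forall fun t => ?_)
  have h := congrArg (fun T : L2 H →L[ℂ] L2 H => T ξ) (translation_mul_isometryOp x π t n)
  have h' : translation H t (isometryOp x π n ξ)
    = (Circle.exp (x n * t) : ℂ) • isometryOp x π n (translation H t ξ) := h
  simp only
  rw [h', map_smul, smul_smul]
  rfl

/-- The flow has phases exp(iyt) while the Fourier kernel is exp(−2πi ts); this is the source of the
factor 1/(2π) in all shifts. -/
theorem fourierCc_modulate (φ : C_c(ℝ, ℂ)) (y s : ℝ) :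
    fourierCc (modulate φ y) s = fourierCc φ (s - 1 / (2 * Real.pi) * y) := by
  rw [fourierCc_apply, fourierCc_apply, Real.fourier_real_eq_integral_exp_smul,
    Real.fourier_real_eq_integral_exp_smul]
  refine integral_congr_ae (Eventually.of_forall fun t => ?_)
  change Complex.exp _ * (φ t * (Circle.exp (y * t) : ℂ)) = Complex.exp _ * φ t
  rw [Circle.coe_exp, mul_comm (φ t), ← mul_assoc, ← Complex.exp_add]
  congr 2
  have hpi : (Real.pi : ℂ) ≠ 0 := by exact_mod_cast Real.pi_ne_zero
  push_cast
  field_simp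
  ring

/-- Operator-valued functions from functions with values in `A`. -/
noncomputable def liftFn (r : A →⋆ₙₐ[ℂ] (H →L[ℂ] H)) : C₀(ℝ, A) →⋆ₙₐ[ℂ] (ℝ →ᵇ (H →L[ℂ] H)) where
  toFun g := BoundedContinuousFunction.ofNormedAddCommGroup (fun s => r (g s))
    ((continuous_starHom r).comp g.continuous) ‖g‖ fun s =>
      (NonUnitalStarAlgHom.norm_apply_le r _).trans (norm_apply_le g s)
  map_smul' c g := by ext1 s; exact map_smul r c _
  map_zero' := by ext1 s; exact map_zero r
  map_add' g h := by ext1 s; exact map_add r _ _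
  map_mul' g h := by ext1 s; exact map_mul r _ _
  map_star' g := by ext1 s; exact map_star r _

theorem liftFn_apply (r : A →⋆ₙₐ[ℂ] (H →L[ℂ] H)) (g : C₀(ℝ, A)) (s : ℝ) :
    liftFn r g s = r (g s) := rfl

/-- The representation of `C₀(ℝ, A)` given by the coefficients and the integrated translations. -/
noncomputable def fourRep : C₀(ℝ, A) →⋆ₙₐ[ℂ] (L2 H →L[ℂ] L2 H) :=
  conjFour.comp (mulOp.comp (liftFn (π.comp (coeffHom ρ))))

theorem fourRep_apply (g : C₀(ℝ, A)) :
    fourRep π g = conjFour (mulOp (liftFn (π.comp (coeffHom ρ)) g)) := rfl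

theorem fourRep_injective (hπ : Function.Injective π) : Function.Injective (fourRep π) := by
  refine (injective_iff_map_eq_zero _).2 fun g hg => ?_
  have h1 := mulOp_injective (conjFour_injective hg)
  refine ZeroAtInftyContinuousMap.ext fun s => ?_
  have h2 : π (coeffHom ρ (g s)) = 0 := congrArg (fun G : ℝ →ᵇ (H →L[ℂ] H) => G s) h1
  have h3 : coeffHom ρ (g s) = 0 := hπ (by rw [h2, map_zero])
  exact univCoeff_injective ρ (congrArg Subtype.val h3)

/-- The link with the crossed product: these tensors go to integrated forms of functions φ(t) a, and
they span a dense subspace of C₀(ℝ, A). -/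
theorem fourRep_tmul (φ : C_c(ℝ, ℂ)) (a : A) :
    fourRep π (tmul (fourierCc φ) a) = coeffOp π a * lam H φ := by
  have h1 : coeffOp π a = conjFour (constOp (π (coeffHom ρ a))) := (conjFour_constOp _).symm
  rw [h1, lam, ← map_mul]
  change conjFour (mulOp _) = conjFour (mulOp (BoundedContinuousFunction.const ℝ _) * mulOp _)
  rw [← map_mul mulOp]
  congr 2
  ext1 s
  change π (coeffHom ρ (fourierCc φ s • a)) = π (coeffHom ρ a) * (fourierCc φ s • 1)
  rw [map_smul, map_smul, mul_smul_comm, mul_one]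

theorem lam_mul_coeffOp (φ : C_c(ℝ, ℂ)) (a : A) :
    lam H φ * coeffOp π a = coeffOp π a * lam H φ := by
  have h1 : coeffOp π a = conjFour (constOp (π (coeffHom ρ a))) := (conjFour_constOp _).symm
  rw [h1, lam, ← map_mul, ← map_mul]
  change conjFour (mulOp _ * mulOp (BoundedContinuousFunction.const ℝ _))
    = conjFour (mulOp (BoundedContinuousFunction.const ℝ _) * _)
  rw [← map_mul mulOp, ← map_mul mulOp]
  congr 2
  ext1 s
  change (fourierCc φ s • 1) * π (coeffHom ρ a) = π (coeffHom ρ a) * (fourierCc φ s • 1)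
  rw [mul_smul_comm, mul_one, smul_mul_assoc, one_mul]

/-- Equality of continuous linear maps on `C₀(ℝ, A)` can be checked on Fourier transforms. -/
theorem eq_of_tmul_fourierCc {D : Type v} [NormedAddCommGroup D] [NormedSpace ℂ D]
    (F G : C₀(ℝ, A) →L[ℂ] D)
    (h : ∀ φ a, F (tmul (fourierCc φ) a) = G (tmul (fourierCc φ) a)) (g : C₀(ℝ, A)) :
    F g = G g := by
  have hcl : IsClosed ((LinearMap.eqLocus F.toLinearMap G.toLinearMap :
      Submodule ℂ C₀(ℝ, A)) : Set C₀(ℝ, A)) :=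
    (isClosed_eq F.continuous G.continuous : IsClosed {g | F g = G g})
  exact mem_of_tmul_fourierCc_mem hcl h g

/-- `fourRep` as a continuous linear map. -/
noncomputable def fourRepL : C₀(ℝ, A) →L[ℂ] (L2 H →L[ℂ] L2 H) :=
  ⟨⟨⟨fourRep π, map_add (fourRep π)⟩, map_smul (fourRep π)⟩, continuous_starHom _⟩

/-- A ⋆-homomorphism of `C₀(ℝ, A)` as a continuous linear map. -/
noncomputable def homL (r : C₀(ℝ, A) →⋆ₙₐ[ℂ] C₀(ℝ, A)) : C₀(ℝ, A) →L[ℂ] C₀(ℝ, A) :=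
  ⟨⟨⟨r, map_add r⟩, map_smul r⟩, continuous_starHom _⟩

/-- On the tensors φ̂ ⊗ a, the operator a λ(φ) moves past Sₙ at the cost of modulating φ by exp(i xₙ
t), which translates φ̂, and of replacing a by ρₙ(a). -/
theorem fourRep_mul_isometryOp (n : ℕ) (g : C₀(ℝ, A)) :
    fourRep π g * isometryOp x π n
      = isometryOp x π n * fourRep π (twistHom (ρ n) (1 / (2 * Real.pi) * x n) g) := by
  refine eq_of_tmul_fourierCc
    ((ContinuousLinearMap.mul ℂ (L2 H →L[ℂ] L2 H)).flip (isometryOp x π n) ∘L fourRepL π)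
    (ContinuousLinearMap.mul ℂ (L2 H →L[ℂ] L2 H) (isometryOp x π n) ∘L fourRepL π ∘L
      homL (twistHom (ρ n) (1 / (2 * Real.pi) * x n))) (fun φ a => ?_) g
  change fourRep π (tmul (fourierCc φ) a) * isometryOp x π n = isometryOp x π n *
    fourRep π (twistHom (ρ n) (1 / (2 * Real.pi) * x n) (tmul (fourierCc φ) a))
  have h : twistHom (ρ n) (1 / (2 * Real.pi) * x n) (tmul (fourierCc φ) a)
      = tmul (fourierCc (modulate φ (x n))) (ρ n a) := by
    ext s
    rw [twistHom_apply, tmul_apply, tmul_apply, map_smul, fourierCc_modulate]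
  rw [h, fourRep_tmul, fourRep_tmul, mul_assoc, lam_mul_isometryOp, ← mul_assoc, ← mul_assoc,
    coeffOp_mul_isometryOp]

theorem star_isometryOp_mul_fourRep (m n : ℕ) (g : C₀(ℝ, A)) :
    star (isometryOp x π m) * (isometryOp x π n * fourRep π g)
      = if m = n then fourRep π g else 0 := by
  refine eq_of_tmul_fourierCc
    (ContinuousLinearMap.mul ℂ (L2 H →L[ℂ] L2 H) (star (isometryOp x π m)) ∘L
      ContinuousLinearMap.mul ℂ (L2 H →L[ℂ] L2 H) (isometryOp x π n) ∘L fourRepL π)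
    (if m = n then fourRepL π else 0) (fun φ a => ?_) g |>.trans ?_
  · change star (isometryOp x π m) * (isometryOp x π n * fourRep π (tmul (fourierCc φ) a)) = _
    rw [fourRep_tmul, ← mul_assoc, ← mul_assoc, mul_assoc (star _), star_isometryOp_mul]
    split_ifs
    · exact (fourRep_tmul π φ a).symm
    · exact zero_mul _
  · split_ifs <;> rfl

theorem translation_mul_fourRep_comm (t : ℝ) (g : C₀(ℝ, A)) :
    translation H t * fourRep π g = fourRep π g * translation H t := by
  rw [← conjFour_charFn, fourRep_apply, ← map_mul, ← map_mul, ← map_mul, ← map_mul]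
  congr 2
  ext1 s
  rw [BoundedContinuousFunction.mul_apply, BoundedContinuousFunction.mul_apply, charFn_apply,
    mul_smul_comm, mul_one, smul_mul_assoc, one_mul]

theorem exists_translation_mul_fourRep (t : ℝ) (g : C₀(ℝ, A)) :
    ∃ g', translation H t * fourRep π g = fourRep π g' := by
  refine ⟨{ toFun := fun s => (Real.fourierChar (-(t * s)) : ℂ) • g s
            continuous_toFun := by
              have := Real.continuous_fourierChar
              have := g.continuous
              fun_prop
            zero_at_infty' := by
              rw [tendsto_zero_iff_norm_tendsto_zero]
              simp only [norm_smul, Circle.norm_coe, one_mul]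
              exact tendsto_zero_iff_norm_tendsto_zero.1 g.zero_at_infty' }, ?_⟩
  rw [← conjFour_charFn, fourRep_apply, fourRep_apply, ← map_mul, ← map_mul]
  congr 2
  ext1 s
  rw [BoundedContinuousFunction.mul_apply, charFn_apply, smul_mul_assoc, one_mul, liftFn_apply,
    liftFn_apply, ← map_smul]
  rfl

/-- The system of isometries on `L²(ℝ, H)` that generates the crossed product. -/
noncomputable def system (hπ : Function.Injective π) (hnd : ∀ n, Nondegenerate (ρ n))
    (hnorm : ∀ a : A, limsup (fun n => ‖ρ n a‖) atTop = ‖a‖)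
    (hK : ∀ z : Circle, (fun _ : ℕ => z) ∈ orbitClosure x) :
    PhaseSystem C₀(ℝ, A) (L2 H) where
  σ n := twistHom (ρ n) (1 / (2 * Real.pi) * x n)
  Ψ := fourRep π
  S := isometryOp x π
  injective := fourRep_injective π hπ
  essential n := essential_twistHom (hnd n).essential _
  map_mul_S := fourRep_mul_isometryOp x π
  star_S_mul := star_isometryOp_mul_fourRep x π
  norm_S_le := norm_isometryOp_le x π
  exists_norm_lt b N r hr := exists_norm_lt_twistHom hnorm _ b N r hr
  x := x
  U := translation H
  U_zero := translation_zero
  U_mul_star t := by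
    rw [star_translation, ← translation_add, add_neg_cancel, translation_zero]
  star_mul_U t := by
    rw [star_translation, ← translation_add, neg_add_cancel, translation_zero]
  U_mul_S := translation_mul_isometryOp x π
  U_mul_map := translation_mul_fourRep_comm π
  U_map_mem := exists_translation_mul_fourRep π
  const_mem := hK

end System

end QuasiFree

namespace QuasiFree

open scoped ZeroAtInfty CompactlySupported

/-! ### The algebra spanned by the monomials -/

namespace CuntzSystem

variable {B : Type u} [NonUnitalCStarAlgebra B] {D : Type v} [CStarAlgebra D]
  (P : CuntzSystem B D)

/-- First letters either cancel or are orthogonal. When one word is exhausted, Ψ b or Ψ c is moved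
past what remains of the other. -/
theorem map_star_word_mul_word (v u : List ℕ) (b c : B) :
    P.Ψ b * star (P.word v) * (P.word u * P.Ψ c) = 0 ∨
      P.Ψ b * star (P.word v) * (P.word u * P.Ψ c) ∈ P.monomials := by
  induction v generalizing u with
  | nil =>
    right
    rw [word_nil, star_one, mul_one, ← mul_assoc, map_mul_word, mul_assoc, ← map_mul]
    exact P.word_mul_map_mem _ _
  | cons i v ih =>
    cases u with
    | nil =>
      right
      rw [word_nil, one_mul, mul_assoc, star_word_mul_map, ← mul_assoc, ← map_mul]
      exact ⟨[], i :: v, _, by rw [word_nil, one_mul]⟩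
    | cons j u =>
      have h : P.Ψ b * star (P.word (i :: v)) * (P.word (j :: u) * P.Ψ c)
          = P.Ψ b * star (P.word v) * (if i = j then P.word u * P.Ψ c else 0) := by
        rw [← P.star_S_mul_S_mul (P.leftEssential_word_mul (leftEssential_map _ c) u) i j,
          word_cons, word_cons, star_mul]
        simp only [mul_assoc]
      rw [h]
      split_ifs
      · exact ih u
      · left; rw [mul_zero]

theorem mul_monomials {y z : D} (hy : y ∈ P.monomials) (hz : z ∈ P.monomials) :
    y * z ∈ Submodule.span ℂ P.monomials := by
  obtain ⟨u, v, b, rfl⟩ := hy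
  obtain ⟨u', v', c, rfl⟩ := hz
  have h : P.word u * P.Ψ b * star (P.word v) * (P.word u' * P.Ψ c * star (P.word v'))
      = P.word u * (P.Ψ b * star (P.word v) * (P.word u' * P.Ψ c)) * star (P.word v') := by
    simp only [mul_assoc]
  rw [h]
  rcases P.map_star_word_mul_word v u' b c with h0 | ⟨w, w', d, hd⟩
  · rw [h0, mul_zero, zero_mul]
    exact zero_mem _
  · rw [hd]
    refine Submodule.subset_span ⟨u ++ w, v' ++ w', d, ?_⟩
    rw [word_append, word_append, star_mul]
    simp only [mul_assoc]

/-- The ⋆-algebra spanned by the monomials. -/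
noncomputable def spanAlg : NonUnitalStarSubalgebra ℂ D where
  carrier := Submodule.span ℂ P.monomials
  add_mem' := fun h h' => add_mem h h'
  zero_mem' := zero_mem (Submodule.span ℂ P.monomials)
  smul_mem' := fun c _ h => (Submodule.span ℂ P.monomials).smul_mem c h
  mul_mem' := by
    intro y z hy hz
    exact Submodule.span_induction₂ (p := fun y z _ _ => y * z ∈ Submodule.span ℂ P.monomials)
      (fun y z hy hz => P.mul_monomials hy hz) (fun z _ => by rw [zero_mul]; exact zero_mem _)
      (fun z _ => by rw [mul_zero]; exact zero_mem _)
      (fun x y z _ _ _ h h' => by rw [add_mul]; exact add_mem h h')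
      (fun x y z _ _ _ h h' => by rw [mul_add]; exact add_mem h h')
      (fun c x y _ _ h => by rw [smul_mul_assoc]; exact Submodule.smul_mem _ c h)
      (fun c x y _ _ h => by rw [mul_smul_comm]; exact Submodule.smul_mem _ c h) hy hz
  star_mem' := by
    intro y hy
    exact Submodule.span_induction (p := fun y _ => star y ∈ Submodule.span ℂ P.monomials)
      (fun y hy => Submodule.subset_span (P.star_mem_monomials hy))
      (by rw [star_zero]; exact zero_mem _)
      (fun x y _ _ h h' => by rw [star_add]; exact add_mem h h')
      (fun c x _ h => by rw [star_smul]; exact Submodule.smul_mem _ _ h) hy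

/-- The C⋆-algebra generated by the monomials. -/
noncomputable def closedAlg : NonUnitalStarSubalgebra ℂ D := P.spanAlg.topologicalClosure

theorem coe_closedAlg :
    (P.closedAlg : Set D) = closure (Submodule.span ℂ P.monomials : Set D) := rfl

theorem isClosed_closedAlg : IsClosed (P.closedAlg : Set D) := isClosed_closure

theorem mem_closedAlg {y : D} (hy : y ∈ P.monomials) : y ∈ P.closedAlg :=
  subset_closure (Submodule.subset_span hy)

theorem leftEssential_of_mem_closedAlg {y : D} (hy : y ∈ P.closedAlg) : LeftEssential P.Ψ y := by
  have hC : P.Generates P.closedAlg := P.coe_closedAlg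
  let p : Submodule ℂ D :=
    { carrier := {y | LeftEssential P.Ψ y}
      add_mem' := fun h h' => LeftEssential.add h h'
      zero_mem' := by
        change LeftEssential _ _
        simpa using leftEssential_map P.Ψ 0
      smul_mem' := fun z g h => by
        have : LeftEssential P.Ψ g := h
        change Tendsto _ _ _
        simp only [mul_smul_comm]
        exact this.const_smul z }
  exact hC.induction (p := p) (isClosed_leftEssential _) (fun y hy => P.leftEssential_monomial hy)
    hy

/-- A closed ⋆-subalgebra that contains all `Ψ b` and all `S n Ψ b` contains all monomials. -/
theorem closedAlg_le {C : NonUnitalStarSubalgebra ℂ D} (hC : IsClosed (C : Set D))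
    (h : ∀ b, P.Ψ b ∈ C) (hS : ∀ n b, P.S n * P.Ψ b ∈ C) : P.closedAlg ≤ C := by
  have h1 : ∀ w b, P.word w * P.Ψ b ∈ C := by
    intro w b
    induction w with
    | nil => simpa using h b
    | cons i w ih =>
      rw [word_cons, mul_assoc]
      -- Only S i Ψ(e) is known to lie in C, so an approximate unit is inserted after S i.
      refine hC.mem_of_tendsto (Tendsto.const_mul (P.S i)
        (P.leftEssential_word_mul (leftEssential_map _ b) w)) (Eventually.of_forall fun e => ?_)
      rw [← mul_assoc]
      exact mul_mem (hS i e) ih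
  have h2 : P.monomials ⊆ C := by
    rintro _ ⟨u, v, b, rfl⟩
    have hc : Continuous P.Ψ := continuous_starHom _
    refine hC.mem_of_tendsto (((hc.tendsto b).comp
      ((contractiveUnit_isApproximateUnit B).tendsto_mul_left b)).const_mul (P.word u)
        |>.mul_const (star (P.word v))) (Eventually.of_forall fun e => ?_)
    have : P.word u * P.Ψ (b * e) * star (P.word v)
        = (P.word u * P.Ψ b) * star (P.word v * P.Ψ (star e)) := by
      rw [star_mul, ← map_star, star_star, map_mul]
      simp only [mul_assoc]
    simp only [Function.comp_apply]
    rw [this]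
    exact mul_mem (h1 u b) (star_mem (h1 v _))
  have h3 : (Submodule.span ℂ P.monomials : Set D) ⊆ C := fun y hy =>
    Submodule.span_induction (p := fun y _ => y ∈ C) (fun y hy => h2 hy) (zero_mem C)
      (fun x y _ _ h h' => add_mem h h') (fun c x _ h => SMulMemClass.smul_mem c h) hy
  exact fun y hy => hC.closure_subset_iff.2 h3 hy

end CuntzSystem

/-! ### The crossed product is generated by the system of isometries -/

section Generation

variable {B : Type v} [NonUnitalCStarAlgebra B] (α : Flow B)
  {H : Type w} [NormedAddCommGroup H] [InnerProductSpace ℂ H] [CompleteSpace H]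
  (π : B →⋆ₙₐ[ℂ] (H →L[ℂ] H))

theorem integratedForm_mem (f : C_c(ℝ, B)) : integratedForm α π f ∈ reducedCrossedProduct α π :=
  NonUnitalStarSubalgebra.le_topologicalClosure _
    (NonUnitalStarAlgebra.subset_adjoin ℂ _ ⟨f, rfl⟩)

theorem isClosed_reducedCrossedProduct :
    IsClosed (reducedCrossedProduct α π : Set (L2 H →L[ℂ] L2 H)) :=
  NonUnitalStarSubalgebra.isClosed_topologicalClosure _

theorem integratedForm_add (f g : C_c(ℝ, B)) :
    integratedForm α π (f + g) = integratedForm α π f + integratedForm α π g := by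
  ext1 ξ
  rw [add_apply, integratedForm_apply, integratedForm_apply, integratedForm_apply,
    ← integral_add (integrable_aux α π f ξ) (integrable_aux α π g ξ)]
  refine integral_congr_ae (Eventually.of_forall fun t => ?_)
  change regCoeff α π (f t + g t) _ = _
  simp only [← regHom_apply]
  rw [map_add]
  rfl

theorem integratedForm_zero : integratedForm α π 0 = 0 := by
  simpa using integratedForm_add α π 0 0

/-- Membership of integrated forms in a closed ⋆-subalgebra can be checked on the functions
`φ(t) b`. -/
theorem integratedForm_mem_of_ccSmul {N : NonUnitalStarSubalgebra ℂ (L2 H →L[ℂ] L2 H)}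
    (hN : IsClosed (N : Set (L2 H →L[ℂ] L2 H)))
    (h : ∀ φ b, integratedForm α π (ccSmul φ b) ∈ N) (f : C_c(ℝ, B)) :
    integratedForm α π f ∈ N := by
  obtain ⟨R, hR⟩ := f.hasCompactSupport.isCompact.isBounded.subset_closedBall 0
  have hf0 : ∀ t, |R| < |t| → f t = 0 := by
    intro t ht
    by_contra h0
    have h1 := hR (subset_tsupport f h0)
    rw [Metric.mem_closedBall, dist_zero_right, Real.norm_eq_abs] at h1
    exact absurd (h1.trans (le_abs_self R)) (not_le.2 ht)
  refine hN.closure_subset_iff.2 le_rfl (Metric.mem_closure_iff.2 fun ε hε => ?_)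
  -- Both functions vanish off [−(|R| + 1), |R| + 1], an interval of length 2(|R| + 1), so the
  -- operators differ by at most ε/2.
  set ε' := ε / (4 * (|R| + 1)) with hε'
  have hRpos : 0 < |R| + 1 := by positivity
  obtain ⟨n, δ, hδ, hδ1, hn⟩ := exists_norm_sub_sum_hat_le
    (f.continuous.uniformContinuous_of_tendsto_cocompact f.hasCompactSupport.is_zero_at_infty)
    f.hasCompactSupport.is_zero_at_infty (ε := ε') (by positivity)
  let q : C_c(ℝ, B) := ∑ k ∈ Finset.range (2 * n + 1),
    ccSmul (hatC (((k : ℝ) - n) * δ) hδ) (f (((k : ℝ) - n) * δ))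
  have hq : ∀ t, q t = ∑ k ∈ Finset.range (2 * n + 1),
      hat (((k : ℝ) - n) * δ) δ t • f (((k : ℝ) - n) * δ) := by
    intro t
    rw [CompactlySupportedContinuousMap.sum_apply]
    refine Finset.sum_congr rfl fun k _ => ?_
    change (hat (((k : ℝ) - n) * δ) δ t : ℂ) • f (((k : ℝ) - n) * δ) = _
    rw [Complex.coe_smul]
  have hqN : integratedForm α π q ∈ N := by
    have : ∀ s : Finset ℕ, integratedForm α π (∑ k ∈ s,
        ccSmul (hatC (((k : ℝ) - n) * δ) hδ) (f (((k : ℝ) - n) * δ))) ∈ N := by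
      intro s
      induction s using Finset.cons_induction with
      | empty => rw [Finset.sum_empty, integratedForm_zero]; exact zero_mem N
      | cons i s hi ih =>
        rw [Finset.sum_cons, integratedForm_add]
        exact add_mem (h _ _) ih
    exact this _
  refine ⟨_, hqN, ?_⟩
  rw [dist_eq_norm]
  refine (norm_integratedForm_sub_le α π f q hRpos.le (ε := ε') (by positivity)
    (fun t => ?_) fun t ht => ⟨hf0 t (by linarith), ?_⟩).trans_lt ?_
  · rw [hq]
    exact hn t
  · rw [hq]
    refine Finset.sum_eq_zero fun k _ => ?_
    -- Either the node lies where f vanishes, or its hat, of width at most 1, cannot reach t.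
    by_cases hk : |R| < |((k : ℝ) - n) * δ|
    · rw [hf0 _ hk, smul_zero]
    · rw [hat_eq_zero hδ, zero_smul]
      have := abs_sub_abs_le_abs_sub t (((k : ℝ) - n) * δ)
      linarith
  · rw [hε']
    have : 2 * (|R| + 1) * (ε / (4 * (|R| + 1))) = ε / 2 := by
      field_simp
      ring
    rw [this]
    exact half_lt_self hε

end Generation

/-! ### The crossed product as the closed span of the monomials. -/

section System

variable {A : Type u} [NonUnitalCStarAlgebra A] {ρ : ℕ → A →⋆ₙₐ[ℂ] A}
  {H : Type w} [NormedAddCommGroup H] [InnerProductSpace ℂ H] [CompleteSpace H]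
  {x : ℕ → ℝ} {π : toeplitz ρ →⋆ₙₐ[ℂ] (H →L[ℂ] H)}

theorem star_isometryOp_mul_translation (n : ℕ) (t : ℝ) :
    star (isometryOp x π n) * translation H t
      = (Circle.exp (x n * t) : ℂ) • (translation H t * star (isometryOp x π n)) := by
  have h := congrArg star (translation_mul_isometryOp x π (-t) n)
  rw [star_mul, star_smul, star_mul, star_translation, neg_neg, RCLike.star_def,
    ← Circle.coe_inv_eq_conj, ← Circle.exp_neg, mul_neg, neg_neg] at h
  exact h

theorem star_isometryOp_mul_lam (n : ℕ) (φ : C_c(ℝ, ℂ)) :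
    star (isometryOp x π n) * lam H φ = lam H (modulate φ (x n)) * star (isometryOp x π n) := by
  ext1 ξ
  rw [mul_apply_eq_comp, mul_apply_eq_comp, lam_apply, lam_apply,
    ← ContinuousLinearMap.integral_comp_comm _ (integrable_translation _ ξ)]
  refine integral_congr_ae (Eventually.of_forall fun t => ?_)
  have h := congrArg (fun T : L2 H →L[ℂ] L2 H => T ξ)
    (star_isometryOp_mul_translation (x := x) (π := π) n t)
  have h' : star (isometryOp x π n) (translation H t ξ)
    = (Circle.exp (x n * t) : ℂ) • translation H t (star (isometryOp x π n) ξ) := h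
  simp only
  rw [map_smul, h', smul_smul]
  rfl

theorem mul_fourRep_mem {N : NonUnitalStarSubalgebra ℂ (L2 H →L[ℂ] L2 H)}
    (hN : IsClosed (N : Set (L2 H →L[ℂ] L2 H))) {T : L2 H →L[ℂ] L2 H}
    (hT : ∀ φ a, T * (coeffOp π a * lam H φ) ∈ N) (g : C₀(ℝ, A)) : T * fourRep π g ∈ N := by
  let p : Submodule ℂ C₀(ℝ, A) :=
    { carrier := {g | T * fourRep π g ∈ N}
      add_mem' := fun {g h} hg hh => by
        change T * fourRep π (g + h) ∈ N
        rw [map_add, mul_add]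
        exact add_mem hg hh
      zero_mem' := by
        change T * fourRep π 0 ∈ N
        rw [map_zero, mul_zero]
        exact zero_mem N
      smul_mem' := fun c g hg => by
        change T * fourRep π (c • g) ∈ N
        rw [map_smul, mul_smul_comm]
        exact SMulMemClass.smul_mem c hg }
  have hp : IsClosed (p : Set C₀(ℝ, A)) :=
    hN.preimage (continuous_const.mul (continuous_starHom (fourRep π)))
  refine mem_of_tmul_fourierCc_mem hp (fun φ a => ?_) g
  change T * fourRep π (tmul (fourierCc φ) a) ∈ N
  rw [fourRep_tmul]
  exact hT φ a

variable (hπ : Function.Injective π) (hnd : ∀ n, Nondegenerate (ρ n))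
  (hnorm : ∀ a : A, limsup (fun n => ‖ρ n a‖) atTop = ‖a‖)
  (hK : ∀ z : Circle, (fun _ : ℕ => z) ∈ orbitClosure x)

/-- On generators: a λ(φ) is in Ψ(B), T_{δₙ ⊗ a} λ(φ) in Sₙ Ψ(B), and the adjoint case reduces to
Ψ(B) Sₙ⋆ by moving λ(φ) across Sₙ⋆. -/
theorem regHom_mul_lam_mem (b : toeplitz ρ) (φ : C_c(ℝ, ℂ)) :
    regHom (quasiFreeFlow ρ x) π b * lam H φ ∈ (system x π hπ hnd hnorm hK).closedAlg := by
  set P := (system x π hπ hnd hnorm hK).toCuntzSystem with hP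
  set N := P.closedAlg with hN
  have hNc : IsClosed (N : Set (L2 H →L[ℂ] L2 H)) := P.isClosed_closedAlg
  have hΨ : ∀ g, fourRep π g ∈ N := fun g => P.mem_closedAlg (P.map_mem_monomials g)
  have hSΨ : ∀ n g, isometryOp x π n * fourRep π g ∈ N := fun n g =>
    P.mem_closedAlg (P.S_mul_map_mem n g)
  have hcoeff : ∀ a φ, coeffOp π a * lam H φ ∈ N := fun a φ => by
    rw [← fourRep_tmul]
    exact hΨ _
  -- left multipliers of `Ψ B` into `N` are left multipliers of `N`
  have hmul : ∀ T : L2 H →L[ℂ] L2 H, (∀ g, T * fourRep π g ∈ N) → ∀ y ∈ N, T * y ∈ N := by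
    intro T hT y hy
    refine hNc.mem_of_tendsto (Tendsto.const_mul T (P.leftEssential_of_mem_closedAlg hy))
      (Eventually.of_forall fun e => ?_)
    rw [← mul_assoc]
    exact mul_mem (hT e) hy
  have hext : ∀ T : L2 H →L[ℂ] L2 H, (∀ φ a, T * (coeffOp π a * lam H φ) ∈ N) →
      ∀ g, T * fourRep π g ∈ N := fun T => mul_fourRep_mem hNc
  have hcoeffN : ∀ a, ∀ y ∈ N, coeffOp π a * y ∈ N := fun a =>
    hmul _ (hext _ fun φ c => by rw [← mul_assoc, ← map_mul]; exact hcoeff _ _)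
  have hcoeffNr : ∀ a, ∀ y ∈ N, y * coeffOp π a ∈ N := fun a y hy => by
    have := star_mem (hcoeffN (star a) _ (star_mem hy))
    rwa [star_mul, star_star, ← map_star, star_star] at this
  -- Because λ(φ) commutes with the coefficients, knowing T λ(φ) ∈ N for every φ already makes T a
  -- left multiplier of N.
  have hlift : ∀ T : L2 H →L[ℂ] L2 H, (∀ φ, T * lam H φ ∈ N) → ∀ y ∈ N, T * y ∈ N := fun T hT =>
    hmul _ (hext _ fun φ a => by
      rw [← lam_mul_coeffOp, ← mul_assoc]
      exact hcoeffNr a _ (hT φ))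
  -- The product step needs the statement for all φ at once: it makes the left factor a multiplier
  -- of N, to be applied to the right factor times λ(φ).
  revert φ
  refine toeplitz_induction (p := fun b => ∀ φ, regHom (quasiFreeFlow ρ x) π b * lam H φ ∈ N)
    ?_ ?_ ?_ ?_ ?_ ?_ ?_ ?_ b
  · rw [Set.ofPred_forall]
    exact isClosed_iInter fun φ =>
      hNc.preimage ((continuous_starHom (regHom (quasiFreeFlow ρ x) π)).mul continuous_const)
  · intro φ
    rw [map_zero, zero_mul]
    exact zero_mem N
  · intro a b ha hb φ
    rw [map_add, add_mul]
    exact add_mem (ha φ) (hb φ)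
  · intro c a ha φ
    rw [map_smul, smul_mul_assoc]
    exact SMulMemClass.smul_mem c (ha φ)
  · intro a b ha hb φ
    rw [map_mul, mul_assoc]
    exact hlift _ ha _ (hb φ)
  · intro a φ
    rw [regHom_coeffHom]
    exact hcoeff a φ
  · intro n a φ
    change creationOp x π n a * lam H φ ∈ N
    rw [← isometryOp_mul_coeffOp, mul_assoc, ← fourRep_tmul]
    exact hSΨ _ _
  · intro n a φ
    rw [map_star]
    change star (creationOp x π n a) * lam H φ ∈ N
    rw [← isometryOp_mul_coeffOp, star_mul, mul_assoc, star_isometryOp_mul_lam, ← mul_assoc,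
      ← map_star, ← fourRep_tmul]
    have := star_mem (hSΨ n (star (tmul (fourierCc (modulate φ (x n))) (star a))))
    rwa [star_mul, ← map_star, star_star] at this

/-- One inclusion comes from approximating functions in C_c by sums of φ(t) b, the other from a λ(φ)
and Sₙ a λ(φ) = T_{δₙ ⊗ a} λ(φ) being integrated forms. -/
theorem system_generates :
    (system x π hπ hnd hnorm hK).Generates (reducedCrossedProduct (quasiFreeFlow ρ x) π) := by
  set P := (system x π hπ hnd hnorm hK).toCuntzSystem with hP
  rw [CuntzSystem.Generates, ← CuntzSystem.coe_closedAlg]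
  congr 1
  refine le_antisymm ?_ ?_
  · refine NonUnitalStarSubalgebra.topologicalClosure_minimal _
      (NonUnitalStarAlgebra.adjoin_le ?_) P.isClosed_closedAlg
    rintro _ ⟨f, rfl⟩
    refine integratedForm_mem_of_ccSmul _ _ P.isClosed_closedAlg (fun φ b => ?_) f
    rw [integratedForm_ccSmul]
    exact regHom_mul_lam_mem hπ hnd hnorm hK b φ
  · have hcl := isClosed_reducedCrossedProduct (quasiFreeFlow ρ x) π
    refine P.closedAlg_le hcl (fun g => ?_) fun n g => ?_
    · have := mul_fourRep_mem hcl (T := 1) (fun φ a => by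
        rw [one_mul, ← regHom_coeffHom x, ← integratedForm_ccSmul]
        exact integratedForm_mem _ _ _) g
      rwa [one_mul] at this
    · refine mul_fourRep_mem hcl (T := isometryOp x π n) (fun φ a => ?_) g
      rw [← mul_assoc, isometryOp_mul_coeffOp, creationOp, ← integratedForm_ccSmul]
      exact integratedForm_mem _ _ _

end System

end QuasiFree

open QuasiFree in
/-- Simplicity of the reduced crossed product of the Toeplitz–Pimsner algebra by the quasi-free
flow. -/
theorem theorem4p4 {A : Type u} [NonUnitalCStarAlgebra A] [Nontrivial A]
    [TopologicalSpace.SeparableSpace A]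
    (ρ : ℕ → A →⋆ₙₐ[ℂ] A) (hnd : ∀ n, Nondegenerate (ρ n))
    (hnorm : ∀ a : A, limsup (fun n => ‖ρ n a‖) atTop = ‖a‖)
    (hmin : ∀ I : TwoSidedIdeal A, IsClosed (I : Set A) →
      (∀ n, ∀ a ∈ I, ρ n a ∈ I) → I = ⊥ ∨ I = ⊤)
    (x : ℕ → ℝ)
    (hK : ∀ z : Circle, (fun _ : ℕ => z) ∈ orbitClosure x)
    (hdense : ∀ I : TwoSidedIdeal A, IsClosed (I : Set A) → I ≠ ⊥ →
      ∃ J : TwoSidedIdeal A, IsClosed (J : Set A) ∧ J ≠ ⊥ ∧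
        Dense {y : ℝ | ∃ w : List ℕ, wordSum x w = y ∧
          (J : Set A) ⊆ closedIdealSpan (wordHom ρ w '' (I : Set A))})
    {H : Type w} [NormedAddCommGroup H] [InnerProductSpace ℂ H] [CompleteSpace H]
    (π : toeplitz ρ →⋆ₙₐ[ℂ] (H →L[ℂ] H)) (hπ : Function.Injective π) :
    IsSimpleCStar (reducedCrossedProduct (quasiFreeFlow ρ x) π) := by
  have hnt : Nontrivial (ZeroAtInftyContinuousMap ℝ A) := by
    obtain ⟨a, ha⟩ := exists_ne (0 : A)
    refine ⟨⟨tmul (ofCc (hatC 0 one_pos)) a, 0, fun h => ha ?_⟩⟩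
    have h0 := congrArg (fun g : ZeroAtInftyContinuousMap ℝ A => g 0) h
    simpa [hat] using h0
  refine PhaseSystem.isSimpleCStar (system_generates hπ hnd hnorm hK)
    fun J hJ hl hr hinv hJ0 => ?_
  exact eq_top_of_twistHom_invariant hJ hl hr hmin hdense
    (κ := 1 / (2 * Real.pi)) (by positivity) hinv hJ0
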